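/- **Setting.** Let $(M^d,g)$, $d\ge 3$, be a Riemannian manifold, $f\in C^\infty(M)$ a positive function, $m\in(0,\infty)$ and $\mu\in\mathbb{R}$. Put $$\mathrm{Ric}_\phi^m=\mathrm{Ric}-\tfrac{m}{f}\nabla^2 f,\qquad F_\phi^m=f\Delta f+(m-1)(|\nabla f|^2-\mu),\qquad R_\phi^m=R-\tfrac{2m}{f}\Delta f-\tfrac{m(m-1)}{f^2}(|\nabla f|^2-\mu),$$ $$J_\phi^m=\tfrac{1}{2(d+m-1)}R_\phi^m,\qquad P_\phi^m=\tfrac{1}{d+m-2}(\mathrm{Ric}_\phi^m-J_\phi^m g),\qquad Y_\phi^m=J_\phi^m-\mathrm{tr}_g P_\phi^m,$$ $dP_\phi^m(x,y,z)=\nabla_xP_\phi^m(y,z)-\nabla_yP_\phi^m(x,z)$, and let $\wedge$ be the Kulkarni–Nomizu product $(h\wedge k)(x,y,z,w)=h(x,z)k(y,w)+h(y,w)k(x,z)-h(x,w)k(y,z)-h(y,z)k(x,w)$; $\mathrm{Rm}$ is normalized so that $\mathrm{Rm}(x,y,x,y)>0$ for linearly independent $x,y$ on round spheres. **Weighted ambient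 spaces.** Write $(t,x,\rho)$ for points of $\mathbb{R}_+\times M\times\mathbb{R}$, $\delta_s(t,x,\rho)=(st,x,\rho)$ for $s>0$, and $\iota(t,x)=(t,x,0)$. A *weighted ambient space* for $(M,g,f,m,\mu)$ consists of an open set $\widetilde{\mathcal G}\subseteq\mathbb{R}_+\times M\times\mathbb{R}$ that contains $\mathbb{R}_+\times M\times\{0\}$ and is invariant under all $\delta_s$, a smooth metric $\widetilde g$ of signature $(d+1,1)$ and a smooth positive function $\widetilde f$ on $\widetilde{\mathcal G}$, such that $\delta_s^*\widetilde g=s^2\widetilde g$, $\delta_s^*\widetilde f=s\widetilde f$, $\iota^*\widetilde g=t^2g$, $\iota^*\widetilde f=tf$, and such that the tensor $S=\widetilde{\mathrm{Ric}}{}_\phi^m$ and the function $h=\widetilde F_\phi^m$ of $(\widetilde g,\widetilde f,m,\mu)$ satisfy * if $d+m$ is not an even integer: $S=O(\rho^\infty)$ and $h=O(\rho^\infty)$ (componentwise, along $\rho=0$); * if $d+m=2(k+1)$ with $k\in\mathbb{N}$: $S=O(\rho^k)$ and $h=O(\rho^k)$, and $S(\partial_t,\partial_t)$, $S(\partial_t,v)$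 for all $v$ tangent to $M$, and $mf^{-2}h-g^{ij}S_{ij}$ are $O(\rho^{k+1})$, where $i,j$ are indices on $M$. **Theorem 1.2.** Set $$(g_\rho)_{ij}=g_{ij}+2\rho(P_\phi^m)_{ij}+\rho^2(P_\phi^m)_{ik}(P_\phi^m)_j^k,\qquad f_\rho=f+\tfrac{f}{m}\rho\,Y_\phi^m,$$ $$\widetilde g=2\rho\,dt^2+2t\,d\rho\,dt+t^2g_\rho,\qquad \widetilde f=tf_\rho .$$ Assume that one of the following holds: 1. there is a constant $\lambda\in\mathbb{R}$ with $F_\phi^m=-\lambda f^2$ and $\mathrm{Ric}_\phi^m=\lambda g$; 2. $\mathrm{Rm}=P_\phi^m\wedge g$ and $dP_\phi^m=0$; 3. $f=1$ and there is a constant $\lambda\in\mathbb{R}$ with $\mathrm{Ric}_\phi^m=\lambda g$ and $R=d\lambda$, where moreover $\lambda=-(d-1)\mu$ unless $m=1$. Then for every open neighbourhood $W$ of $M\times\{0\}$ in $M\times\mathbb{R}$ on which $g_\rho$ is positive definite and $f_\rho>0$, the space $(\mathbb{R}_+\times W,\widetilde g,\widetilde f,m,\mu)$ is a weighted ambient space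 for $(M,g,f,m,\mu)$. Such a $W$ exists, and in cases 1 and 3, and whenever $M$ is compact, $W=M\times(-\epsilon,\epsilon)$ is such a neighbourhood for some constant $\epsilon>0$. -/

import Mathlib

set_option maxSynthPendingDepth 3

open scoped Manifold ContDiff Topology
open Set Filter Asymptotics

noncomputable section

namespace WeightedAmbient

/-! ## (Pseudo-)Riemannian geometry on a finite-dimensional vector space

`G : E → E →L[ℝ] E →L[ℝ] ℝ` is a field of nondegenerate symmetric bilinear forms near a point
`y : E` (the components of a metric in a chart).  `fderiv ℝ G y u v w = (∂_u G)(v, w)`, and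
`(G y).inverse` raises an index. -/

section Coordinates

variable {E : Type*} [NormedAddCommGroup E] [NormedSpace ℝ E]

/-- Christoffel symbols of the first kind,
`Γ_♭(u, v, w) = ½ ((∂_u G)(v, w) + (∂_v G)(u, w) - (∂_w G)(u, v))`. -/
def christoffelLow (G : E → E →L[ℝ] E →L[ℝ] ℝ) (y : E) : E →L[ℝ] E →L[ℝ] E →L[ℝ] ℝ :=
  let D : E →L[ℝ] E →L[ℝ] E →L[ℝ] ℝ := fderiv ℝ G y
  let swap : (E →L[ℝ] E →L[ℝ] ℝ) →L[ℝ] (E →L[ℝ] E →L[ℝ] ℝ) :=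
    (ContinuousLinearMap.flipₗᵢ ℝ E E ℝ).toContinuousLinearEquiv
  let D₂ : E →L[ℝ] E →L[ℝ] E →L[ℝ] ℝ := D.flip
  let D₃ : E →L[ℝ] E →L[ℝ] E →L[ℝ] ℝ := swap.comp D₂
  (1 / 2 : ℝ) • (D + D₂ - D₃)

theorem christoffelLow_apply (G : E → E →L[ℝ] E →L[ℝ] ℝ) (y u v w : E) :
    christoffelLow G y u v w =
      1 / 2 * (fderiv ℝ G y u v w + fderiv ℝ G y v u w - fderiv ℝ G y w u v) := rfl

/-- Christoffel symbols: `Γ(u, v)` is the vector with `G(Γ(u, v), w) = Γ_♭(u, v, w)`. -/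
def christoffel (G : E → E →L[ℝ] E →L[ℝ] ℝ) (y : E) : E →L[ℝ] E →L[ℝ] E :=
  (ContinuousLinearMap.compL ℝ E (E →L[ℝ] ℝ) E (G y).inverse).comp (christoffelLow G y)

theorem christoffel_apply (G : E → E →L[ℝ] E →L[ℝ] ℝ) (y u v : E) :
    christoffel G y u v = (G y).inverse (christoffelLow G y u v) := rfl

/-- The curvature operator, as the linear map `u ↦ R(u, v) w`. -/
def curvature (G : E → E →L[ℝ] E →L[ℝ] ℝ) (y v w : E) : E →L[ℝ] E :=
  ((fderiv ℝ (christoffel G) y).flip v).flip w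
    - (fderiv ℝ (christoffel G) y v).flip w
    + (christoffel G y).flip (christoffel G y v w)
    - (christoffel G y v).comp ((christoffel G y).flip w)

/-- `R(u, v) w = (∂_u Γ)(v, w) - (∂_v Γ)(u, w) + Γ(u, Γ(v, w)) - Γ(v, Γ(u, w))`. -/
theorem curvature_apply (G : E → E →L[ℝ] E →L[ℝ] ℝ) (y u v w : E) :
    curvature G y v w u =
      fderiv ℝ (christoffel G) y u v w - fderiv ℝ (christoffel G) y v u w
        + christoffel G y u (christoffel G y v w) - christoffel G y v (christoffel G y u w) := rfl

/-- The curvature tensor with four lower indices, `Rm(u, v, w, z) = G(R(u, v) z, w)`; with this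
order of the arguments `Rm(u, v, u, v)` is positive on round spheres and the trace of `Rm` over
its first and third arguments is the Ricci tensor. -/
def riemann (G : E → E →L[ℝ] E →L[ℝ] ℝ) (y u v w z : E) : ℝ :=
  G y (curvature G y v z u) w

/-- The Kulkarni-Nomizu product of two bilinear forms. -/
def kulkarniNomizu (h k : E →L[ℝ] E →L[ℝ] ℝ) (x y z w : E) : ℝ :=
  h x z * k y w + h y w * k x z - h x w * k y z - h y z * k x w

variable [FiniteDimensional ℝ E]

/-- The Ricci tensor, `Ric(v, w) = tr (u ↦ R(u, v) w)`. -/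
def ricci (G : E → E →L[ℝ] E →L[ℝ] ℝ) (y : E) : E →L[ℝ] E →L[ℝ] ℝ :=
  LinearMap.toContinuousBilinearMap <|
    LinearMap.mk₂ ℝ (fun v w => LinearMap.trace ℝ E (curvature G y v w : E →ₗ[ℝ] E))
      (fun v v' w => by
        rw [← map_add]; congr 1; ext u; simp [curvature_apply]; abel)
      (fun c v w => by
        rw [← map_smul]; congr 1; ext u; simp [curvature_apply, smul_sub, smul_add])
      (fun v w w' => by
        rw [← map_add]; congr 1; ext u; simp [curvature_apply]; abel)
      (fun c v w => by
        rw [← map_smul]; congr 1; ext u; simp [curvature_apply, smul_sub, smul_add])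

theorem ricci_apply (G : E → E →L[ℝ] E →L[ℝ] ℝ) (y v w : E) :
    ricci G y v w = LinearMap.trace ℝ E (curvature G y v w : E →ₗ[ℝ] E) := rfl

/-- The trace `g^{ij} B_{ij}` of a bilinear form `B` with respect to a nondegenerate form `g`. -/
def metricTrace (g B : E →L[ℝ] E →L[ℝ] ℝ) : ℝ :=
  LinearMap.trace ℝ E (g.inverse.comp B : E →ₗ[ℝ] E)

/-- The scalar curvature. -/
def scalarCurvature (G : E → E →L[ℝ] E →L[ℝ] ℝ) (y : E) : ℝ :=
  metricTrace (G y) (ricci G y)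


/-- The Hessian `∇²F(u, v) = ∂_u ∂_v F - (dF)(Γ(u, v))`. -/
def hessian (G : E → E →L[ℝ] E →L[ℝ] ℝ) (F : E → ℝ) (y : E) : E →L[ℝ] E →L[ℝ] ℝ :=
  fderiv ℝ (fderiv ℝ F) y
    - (ContinuousLinearMap.compL ℝ E E ℝ (fderiv ℝ F y)).comp (christoffel G y)

/-- The Laplacian `Δ F = tr ∇²F`. -/
def laplacian (G : E → E →L[ℝ] E →L[ℝ] ℝ) (F : E → ℝ) (y : E) : ℝ :=
  metricTrace (G y) (hessian G F y)

/-- The squared length `|∇F|²` of the gradient. -/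
def gradNormSq (G : E → E →L[ℝ] E →L[ℝ] ℝ) (F : E → ℝ) (y : E) : ℝ :=
  fderiv ℝ F y ((G y).inverse (fderiv ℝ F y))

/-! ### Weighted curvatures in coordinates -/

/-- The Bakry-Émery Ricci tensor `Ric_φ^m = Ric - (m / F) ∇²F`. -/
def ricciW (m : ℝ) (G : E → E →L[ℝ] E →L[ℝ] ℝ) (F : E → ℝ) (y : E) : E →L[ℝ] E →L[ℝ] ℝ :=
  ricci G y - (m / F y) • hessian G F y

/-- `F_φ^m = F Δ F + (m - 1) (|∇F|² - μ)`. -/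
def fibreW (m μ : ℝ) (G : E → E →L[ℝ] E →L[ℝ] ℝ) (F : E → ℝ) (y : E) : ℝ :=
  F y * laplacian G F y + (m - 1) * (gradNormSq G F y - μ)

/-- The weighted scalar curvature
`R_φ^m = R - (2m / F) Δ F - (m (m - 1) / F²) (|∇F|² - μ)`. -/
def scalarW (m μ : ℝ) (G : E → E →L[ℝ] E →L[ℝ] ℝ) (F : E → ℝ) (y : E) : ℝ :=
  scalarCurvature G y - 2 * m / F y * laplacian G F y
    - m * (m - 1) / F y ^ 2 * (gradNormSq G F y - μ)

/-- The weighted Schouten scalar `J_φ^m = R_φ^m / (2 (d + m - 1))`, where `d = dim E`. -/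
def schoutenScalarW (m μ : ℝ) (G : E → E →L[ℝ] E →L[ℝ] ℝ) (F : E → ℝ) (y : E) : ℝ :=
  1 / (2 * (Module.finrank ℝ E + m - 1)) * scalarW m μ G F y

/-- The weighted Schouten tensor `P_φ^m = (Ric_φ^m - J_φ^m g) / (d + m - 2)`. -/
def schoutenW (m μ : ℝ) (G : E → E →L[ℝ] E →L[ℝ] ℝ) (F : E → ℝ) (y : E) :
    E →L[ℝ] E →L[ℝ] ℝ :=
  (1 / (Module.finrank ℝ E + m - 2) : ℝ) • (ricciW m G F y - schoutenScalarW m μ G F y • G y)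

/-- `Y_φ^m = J_φ^m - tr P_φ^m`. -/
def traceDefectW (m μ : ℝ) (G : E → E →L[ℝ] E →L[ℝ] ℝ) (F : E → ℝ) (y : E) : ℝ :=
  schoutenScalarW m μ G F y - metricTrace (G y) (schoutenW m μ G F y)

/-- The covariant derivative `(∇_u B)(v, w)` of a field `B` of bilinear forms. -/
def covDeriv (G B : E → E →L[ℝ] E →L[ℝ] ℝ) (y u v w : E) : ℝ :=
  fderiv ℝ B y u v w - B y (christoffel G y u v) w - B y v (christoffel G y u w)

/-- The weighted Cotton tensor `dP_φ^m(u, v, w) = ∇_u P_φ^m(v, w) - ∇_v P_φ^m(u, w)`. -/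
def cottonW (m μ : ℝ) (G : E → E →L[ℝ] E →L[ℝ] ℝ) (F : E → ℝ) (y u v w : E) : ℝ :=
  covDeriv G (schoutenW m μ G F) y u v w - covDeriv G (schoutenW m μ G F) y v u w

end Coordinates

/-! ## Tensors on manifolds and their components in charts

In Mathlib the tangent space at a point `x` of a manifold modelled on `E` is a copy of `E`, the
identification being the derivative at `x` of the preferred chart `extChartAt I x`.  The value at
`x` of a curvature tensor is therefore its value in that chart at the image of `x`. -/

section Manifold

variable {E : Type*} [NormedAddCommGroup E] [NormedSpace ℝ E]
  {H : Type*} [TopologicalSpace H] (I : ModelWithCorners ℝ E H)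
  {N : Type*} [TopologicalSpace N] [ChartedSpace H N]

variable (N) in
/-- A field of bilinear forms on the tangent spaces of a manifold. -/
abbrev BilinField :=
  ∀ p : N, TangentSpace I p →L[ℝ] TangentSpace I p →L[ℝ] ℝ

variable {I}

/-- The components of a field of bilinear forms in the preferred chart at `x`: its pullback to
`E` by the inverse of the chart. -/
def inChart (B : BilinField I N) (x : N) (y : E) : E →L[ℝ] E →L[ℝ] ℝ :=
  let A : E →L[ℝ] TangentSpace I ((extChartAt I x).symm y) :=
    mfderiv 𝓘(ℝ, E) I (extChartAt I x).symm y
  (A.precomp ℝ).comp ((B ((extChartAt I x).symm y)).comp A)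

theorem inChart_apply (B : BilinField I N) (x : N) (y u v : E) :
    inChart B x y u v = B ((extChartAt I x).symm y)
      (mfderiv 𝓘(ℝ, E) I (extChartAt I x).symm y u)
      (mfderiv 𝓘(ℝ, E) I (extChartAt I x).symm y v) := rfl

/-- The expression of a function in the preferred chart at `x`. -/
def funInChart (I : ModelWithCorners ℝ E H) (f : N → ℝ) (x : N) (y : E) : ℝ :=
  f ((extChartAt I x).symm y)

variable [FiniteDimensional ℝ E]

/-- The Bakry-Émery Ricci tensor `Ric_φ^m` of `(N, g, f)`. -/
def bakryEmeryRicci (g : BilinField I N) (f : N → ℝ) (m : ℝ) : BilinField I N :=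
  fun x => ricciW (E := E) m (inChart g x) (funInChart I f x) (extChartAt I x x)

/-- The function `F_φ^m = f Δ f + (m - 1) (|∇f|² - μ)` of `(N, g, f)`. -/
def fibreCurvature (g : BilinField I N) (f : N → ℝ) (m μ : ℝ) (x : N) : ℝ :=
  fibreW m μ (inChart g x) (funInChart I f x) (extChartAt I x x)

/-- The scalar curvature `R` of `(N, g)`. -/
def scalarCurv (g : BilinField I N) (x : N) : ℝ :=
  scalarCurvature (inChart g x) (extChartAt I x x)

/-- The weighted Schouten tensor `P_φ^m` of `(N, g, f)`. -/
def schoutenTensor (g : BilinField I N) (f : N → ℝ) (m μ : ℝ) : BilinField I N :=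
  fun x => schoutenW (E := E) m μ (inChart g x) (funInChart I f x) (extChartAt I x x)

/-- The function `Y_φ^m` of `(N, g, f)`. -/
def traceDefect (g : BilinField I N) (f : N → ℝ) (m μ : ℝ) (x : N) : ℝ :=
  traceDefectW m μ (inChart g x) (funInChart I f x) (extChartAt I x x)

/-- The Riemann curvature tensor of `(N, g)` at `x`. -/
def riemannTensor (g : BilinField I N) (x : N) (u v w z : TangentSpace I x) : ℝ :=
  riemann (E := E) (inChart g x) (extChartAt I x x) u v w z

/-- The weighted Cotton tensor `dP_φ^m` of `(N, g, f)` at `x`. -/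
def cottonTensor (g : BilinField I N) (f : N → ℝ) (m μ : ℝ) (x : N)
    (u v w : TangentSpace I x) : ℝ :=
  cottonW (E := E) m μ (inChart g x) (funInChart I f x) (extChartAt I x x) u v w

end Manifold

/-! ## Weighted ambient spaces -/

section Ambient

/-- The model space of a `d`-dimensional manifold. -/
abbrev Model (d : ℕ) := EuclideanSpace ℝ (Fin d)

/-- The model of `ℝ × M × ℝ`, with coordinates `(t, x, ρ)`. -/
abbrev ambientModel (d : ℕ) :
    ModelWithCorners ℝ (ℝ × Model d × ℝ) (ModelProd ℝ (ModelProd (Model d) ℝ)) :=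
  𝓘(ℝ, ℝ).prod (𝓘(ℝ, Model d).prod 𝓘(ℝ, ℝ))

variable {d : ℕ} {M : Type*} [TopologicalSpace M] [ChartedSpace (Model d) M]

variable (d M) in
/-- Smooth Riemannian metrics on `M`. -/
abbrev SmoothMetric [IsManifold 𝓘(ℝ, Model d) ∞ M] :=
  Bundle.ContMDiffRiemannianMetric 𝓘(ℝ, Model d) ∞ (Model d)
    (fun x : M => TangentSpace 𝓘(ℝ, Model d) x)

/-- The dilation `δ_s (t, x, ρ) = (s t, x, ρ)`. -/
def dilation (s : ℝ) (p : ℝ × M × ℝ) : ℝ × M × ℝ := (s * p.1, p.2.1, p.2.2)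

/-- The embedding `ι (t, x) = (t, x, 0)`. -/
def iota (z : ℝ × M) : ℝ × M × ℝ := (z.1, z.2, 0)

/-- Weighted pre-ambient spaces for `(M, g, f)`.

The ray bundle `𝒢` of all triples `(s² g_x, s f(x), x)`, `s > 0`, is identified with `(0, ∞) × M`
through `(t² g_x, t f(x), x) ↔ (t, x)`, so that `𝒢 × ℝ` is the open subset `t > 0` of
`ℝ × M × ℝ`.  The canonical metric measure structure of `𝒢`, which at `(h, u, x)` is
`(X, Y) ↦ h(π_* X, π_* Y)` and `u`, becomes `(X, Y) ↦ t² g_x(π_* X, π_* Y)` and `t f(x)`.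
The metric `gt` and the function `ft` matter only on the domain `S`; smoothness of `gt` means
smoothness of its components in charts. -/
structure IsWeightedPreAmbient (g : BilinField 𝓘(ℝ, Model d) M) (f : M → ℝ)
    (S : Set (ℝ × M × ℝ)) (gt : BilinField (ambientModel d) (ℝ × M × ℝ))
    (ft : ℝ × M × ℝ → ℝ) : Prop where
  isOpen : IsOpen S
  subset : ∀ p ∈ S, 0 < p.1
  contains : ∀ (t : ℝ) (x : M), 0 < t → iota (t, x) ∈ S
  dilation_invariant : ∀ s : ℝ, 0 < s → ∀ p ∈ S, dilation s p ∈ S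
  symm : ∀ p ∈ S, ∀ u v : TangentSpace (ambientModel d) p, gt p u v = gt p v u
  smooth_metric : ∀ p ∈ S,
    ContDiffAt ℝ ∞ (inChart gt p) (extChartAt (ambientModel d) p p)
  /-- The metric has signature `(d + 1, 1)`. -/
  signature : ∀ p ∈ S,
    sigPos (LinearMap.BilinMap.toQuadraticMap (gt p).toBilinForm) = d + 1 ∧
    sigNeg (LinearMap.BilinMap.toQuadraticMap (gt p).toBilinForm) = 1
  smooth_density : ContMDiffOn (ambientModel d) 𝓘(ℝ, ℝ) ∞ ft S
  density_pos : ∀ p ∈ S, 0 < ft p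
  /-- `δ_s^* gt = s² gt`. -/
  metric_homogeneous : ∀ s : ℝ, 0 < s → ∀ p ∈ S, ∀ u v : TangentSpace (ambientModel d) p,
    gt (dilation s p)
      (mfderiv (ambientModel d) (ambientModel d) (dilation s) p u)
      (mfderiv (ambientModel d) (ambientModel d) (dilation s) p v) = s ^ 2 * gt p u v
  /-- `δ_s^* ft = s ft`. -/
  density_homogeneous : ∀ s : ℝ, 0 < s → ∀ p ∈ S, ft (dilation s p) = s * ft p
  /-- `ι^* gt` is the canonical degenerate metric of `𝒢`. -/
  metric_pullback : ∀ (t : ℝ) (x : M), 0 < t →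
    ∀ u v : TangentSpace (𝓘(ℝ, ℝ).prod 𝓘(ℝ, Model d)) ((t, x) : ℝ × M),
      gt (iota (t, x))
        (mfderiv (𝓘(ℝ, ℝ).prod 𝓘(ℝ, Model d)) (ambientModel d) iota (t, x) u)
        (mfderiv (𝓘(ℝ, ℝ).prod 𝓘(ℝ, Model d)) (ambientModel d) iota (t, x) v) =
      t ^ 2 * g x
        (mfderiv (𝓘(ℝ, ℝ).prod 𝓘(ℝ, Model d)) 𝓘(ℝ, Model d) Prod.snd ((t, x) : ℝ × M) u)
        (mfderiv (𝓘(ℝ, ℝ).prod 𝓘(ℝ, Model d)) 𝓘(ℝ, Model d) Prod.snd ((t, x) : ℝ × M) v)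
  /-- `ι^* ft` is the canonical function of `𝒢`. -/
  density_pullback : ∀ (t : ℝ) (x : M), 0 < t → ft (iota (t, x)) = t * f x

/-- `h = O(ρ^k)` for a function `h` on a neighbourhood of `𝒢 × {0}` in `𝒢 × ℝ`.  For smooth `h`
this says that `h` vanishes to order `k` along `𝒢 × {0}`, i.e. that `h` is `ρ^k` times a smooth
function. -/
def IsOrder (h : ℝ × M × ℝ → ℝ) (k : ℕ) : Prop :=
  ∀ (t : ℝ) (x : M), 0 < t → (fun ρ : ℝ => h (t, x, ρ)) =O[𝓝 0] fun ρ : ℝ => ρ ^ k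

/-- The component `S(u, v)` of a field of bilinear forms on `ℝ × M × ℝ`, where `u, v` are constant
vectors; they are identified with tangent vectors at `(t, x, ρ)` by the chart at `x`, which does
not depend on `t` and `ρ`. -/
def component (S : BilinField (ambientModel d) (ℝ × M × ℝ)) (u v : ℝ × Model d × ℝ)
    (p : ℝ × M × ℝ) : ℝ :=
  S p u v

/-- The restriction `S_{ij}` of a bilinear form to the directions tangent to `M`. -/
def tangentialPart (S : BilinField (ambientModel d) (ℝ × M × ℝ)) (p : ℝ × M × ℝ) :
    Model d →L[ℝ] Model d →L[ℝ] ℝ :=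
  let A : Model d →L[ℝ] ℝ × Model d × ℝ :=
    (ContinuousLinearMap.inr ℝ ℝ (Model d × ℝ)).comp (ContinuousLinearMap.inl ℝ (Model d) ℝ)
  let B : (ℝ × Model d × ℝ) →L[ℝ] (ℝ × Model d × ℝ) →L[ℝ] ℝ := S p
  B.bilinearComp A A

/-- `(S, h) = O(ρ^k)`: all components of `S`, and `h`, are `O(ρ^k)`. -/
def PairIsOrder (S : BilinField (ambientModel d) (ℝ × M × ℝ)) (h : ℝ × M × ℝ → ℝ) (k : ℕ) :
    Prop :=
  (∀ u v : ℝ × Model d × ℝ, IsOrder (component S u v) k) ∧ IsOrder h k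

/-- `(S, h) = O^{l,+}_{IJ}(ρ^k)`: the pair is `O(ρ^k)`, and `S_{00}`, `S_{0i}` and
`m f^{-l} h - g^{ij} S_{ij}` are `O(ρ^{k+1})`. -/
def PairIsOrderPlus (g : BilinField 𝓘(ℝ, Model d) M) (f : M → ℝ) (m : ℝ) (l : ℕ)
    (S : BilinField (ambientModel d) (ℝ × M × ℝ)) (h : ℝ × M × ℝ → ℝ) (k : ℕ) : Prop :=
  PairIsOrder S h k ∧
  IsOrder (component S (1, 0, 0) (1, 0, 0)) (k + 1) ∧
  (∀ w : Model d, IsOrder (component S (1, 0, 0) (0, w, 0)) (k + 1)) ∧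
  IsOrder (fun p => m / f p.2.1 ^ l * h p
    - metricTrace (E := Model d) (g p.2.1) (tangentialPart S p)) (k + 1)

/-- Weighted ambient spaces `(S, gt, ft, m, μ)` for `(M, g, f, m, μ)`: if `d + m` is not an even
natural number, then `Ric_φ^m` and `F_φ^m` of `(gt, ft)` are `O(ρ^∞)`, and if `d + m` is even, then
they are `O^{2,+}(ρ^{(d + m) / 2 - 1})`. -/
structure IsWeightedAmbient (g : BilinField 𝓘(ℝ, Model d) M) (f : M → ℝ) (m μ : ℝ)
    (S : Set (ℝ × M × ℝ)) (gt : BilinField (ambientModel d) (ℝ × M × ℝ))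
    (ft : ℝ × M × ℝ → ℝ) : Prop extends IsWeightedPreAmbient g f S gt ft where
  not_even : (¬ ∃ n : ℕ, (d : ℝ) + m = 2 * n) →
    ∀ k : ℕ, PairIsOrder (bakryEmeryRicci gt ft m) (fibreCurvature gt ft m μ) k
  even : ∀ k : ℕ, (d : ℝ) + m = 2 * (k + 1) →
    PairIsOrderPlus g f m 2 (bakryEmeryRicci gt ft m) (fibreCurvature gt ft m μ) k

/-! ## The explicit metric measure structure -/

/-- `(g_ρ)_{ij} = g_{ij} + 2 ρ P_{ij} + ρ² P_{ik} P_j^k`, with `P = P_φ^m`. -/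
def gRho (g : BilinField 𝓘(ℝ, Model d) M) (f : M → ℝ) (m μ ρ : ℝ) :
    BilinField 𝓘(ℝ, Model d) M := fun x =>
  let P : TangentSpace 𝓘(ℝ, Model d) x →L[ℝ] TangentSpace 𝓘(ℝ, Model d) x →L[ℝ] ℝ :=
    schoutenTensor g f m μ x
  let Psharp : TangentSpace 𝓘(ℝ, Model d) x →L[ℝ] TangentSpace 𝓘(ℝ, Model d) x :=
    (g x).inverse.comp P
  let PP : TangentSpace 𝓘(ℝ, Model d) x →L[ℝ] TangentSpace 𝓘(ℝ, Model d) x →L[ℝ] ℝ :=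
    (Psharp.precomp ℝ).comp P
  g x + (2 * ρ) • P + ρ ^ 2 • PP

/-- `f_ρ = f + (f / m) ρ Y_φ^m`. -/
def fRho (g : BilinField 𝓘(ℝ, Model d) M) (f : M → ℝ) (m μ ρ : ℝ) (x : M) : ℝ :=
  f x + f x / m * ρ * traceDefect g f m μ x

/-- The straight and normal metric `2 ρ dt² + 2 t dρ dt + t² g_ρ`. -/
def straightNormalMetric (gρ : ℝ → BilinField 𝓘(ℝ, Model d) M) :
    BilinField (ambientModel d) (ℝ × M × ℝ) := fun p =>
  let dt : (ℝ × Model d × ℝ) →L[ℝ] ℝ := ContinuousLinearMap.fst ℝ ℝ (Model d × ℝ)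
  let dx : (ℝ × Model d × ℝ) →L[ℝ] Model d :=
    (ContinuousLinearMap.fst ℝ (Model d) ℝ).comp (ContinuousLinearMap.snd ℝ ℝ (Model d × ℝ))
  let dρ : (ℝ × Model d × ℝ) →L[ℝ] ℝ :=
    (ContinuousLinearMap.snd ℝ (Model d) ℝ).comp (ContinuousLinearMap.snd ℝ ℝ (Model d × ℝ))
  let B : Model d →L[ℝ] Model d →L[ℝ] ℝ := gρ p.2.2 p.2.1
  let Q : (ℝ × Model d × ℝ) →L[ℝ] (ℝ × Model d × ℝ) →L[ℝ] ℝ :=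
    (2 * p.2.2) • dt.smulRight dt + p.1 • (dt.smulRight dρ + dρ.smulRight dt)
      + p.1 ^ 2 • B.bilinearComp dx dx
  Q

/-- The function `t f_ρ`. -/
def straightNormalDensity (fρ : ℝ → M → ℝ) (p : ℝ × M × ℝ) : ℝ := p.1 * fρ p.2.2 p.2.1

/-- `W` is an open neighbourhood of `M × {0}` in `M × ℝ` on which `g_ρ` is positive definite and
`f_ρ` is positive. -/
structure IsAdmissible (g : BilinField 𝓘(ℝ, Model d) M) (f : M → ℝ) (m μ : ℝ)
    (W : Set (M × ℝ)) : Prop where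
  isOpen : IsOpen W
  contains : ∀ x : M, (x, (0 : ℝ)) ∈ W
  metric_pos : ∀ q ∈ W, ∀ v : TangentSpace 𝓘(ℝ, Model d) q.1, v ≠ 0 →
    0 < gRho g f m μ q.2 q.1 v v
  density_pos : ∀ q ∈ W, 0 < fRho g f m μ q.2 q.1

/-- The subset `ℝ_+ × W` of `ℝ × M × ℝ`. -/
def rayDomain (W : Set (M × ℝ)) : Set (ℝ × M × ℝ) := Ioi 0 ×ˢ W

/-! ## The three special cases -/

/-- Quasi-Einstein spaces: `Ric_φ^m = lam g` and `F_φ^m = -lam f²` for a constant `lam`. -/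
def IsQuasiEinstein (g : BilinField 𝓘(ℝ, Model d) M) (f : M → ℝ) (m μ : ℝ) : Prop :=
  ∃ lam : ℝ, (∀ x : M, fibreCurvature g f m μ x = -lam * f x ^ 2) ∧
    ∀ x : M, bakryEmeryRicci g f m x = lam • g x

/-- Local conformal flatness in the weighted sense: `Rm = P_φ^m ∧ g` (Kulkarni-Nomizu product)
and `dP_φ^m = 0`. -/
def IsWeightedLCF (g : BilinField 𝓘(ℝ, Model d) M) (f : M → ℝ) (m μ : ℝ) : Prop :=
  (∀ (x : M) (u v w z : TangentSpace 𝓘(ℝ, Model d) x),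
    riemannTensor g x u v w z =
      kulkarniNomizu (E := Model d) (schoutenTensor g f m μ x) (g x) u v w z) ∧
  ∀ (x : M) (u v w : TangentSpace 𝓘(ℝ, Model d) x), cottonTensor g f m μ x u v w = 0

/-- The Gover-Leitner conditions: `f = 1`, `Ric_φ^m = lam g` and `R = d lam` for a constant `lam`,
where `lam = -(d - 1) μ` unless `m = 1` (for `m = 1` the parameter `μ` enters none of the weighted
curvatures). -/
def IsGoverLeitner (g : BilinField 𝓘(ℝ, Model d) M) (f : M → ℝ) (m μ : ℝ) : Prop :=
  (∀ x : M, f x = 1) ∧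
  ∃ lam : ℝ, (∀ x : M, bakryEmeryRicci g f m x = lam • g x) ∧
    (∀ x : M, scalarCurv g x = d * lam) ∧
    (m = 1 ∨ lam = -((d : ℝ) - 1) * μ)

end Ambient

end WeightedAmbient

end

/-!
In all three cases both weighted curvatures of `(g̃, f̃)` vanish identically, not only to finite
order along `ρ = 0`. The reason is that the ambient connection is a tractor connection in disguise.

Write `P = P_φ^m` and `u = (f / m) Y_φ^m`, so that `f̃ = t (f + ρ u)`. The coframe
`dt, (t + t ρ P) dx, d(t ρ)` (`ambientFrame`) identifies the tangent spaces of the ambient space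
with `ℝ ⊕ TM ⊕ ℝ` and turns `g̃ = 2 ρ dt² + 2 t dt dρ + t² g_ρ` into the tractor metric
`(a, ξ, b) ↦ 2 a b + g(ξ, ξ)`, because `g_ρ = g((1 + ρ P) ·, (1 + ρ P) ·)`. The tractor connection
attached to `P` is metric, and in this frame it is torsion-free exactly because `P` is a symmetric
Codazzi tensor; so it is the Levi-Civita connection of `g̃` (`isTorsionFreeFrame_ambient`).
Consequently the curvature of `g̃` is that of the tractor connection, whose only component is
`Rm - P ∧ g` (`IsAmbientPoint.curvature_eq`). If moreover `du = P(∇f, ·)`, then `df̃` is the tractor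
`(f, ∇f, u)`; its covariant derivative has the single component `∇²f + f P + u g`
(`IsAmbientPoint.hessian_eq`), and `|∇f̃|² = 2 f u + |∇f|²`.

If `Rm = P ∧ g` and `dP = 0`, then `P` is symmetric by the first Bianchi identity and `d ≥ 3`. The
trace of `Rm = P ∧ g` says that `∇²f + f P + u g = 0`, a second trace says that
`(m - 1) (2 f u + |∇f|² - μ) = 0`, and differentiating the Hessian equation gives `du = P(∇f, ·)`.
So the ambient metric is flat and `f̃` is affine.

In the other two cases `P = c g` for a constant `c`, and `u = c f`, respectively `f = 1` and
`u = -c`. Such a `P` is parallel, and the ambient weighted curvatures reduce to expressions in the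
weighted curvatures of `M` which vanish by hypothesis
(`IsAmbientPoint.ricciW_fibreW_of_conical`).

The curvatures of a manifold are defined at each point through the preferred chart at that point,
whereas the argument above needs them on a whole chart domain. Their naturality under changes of
coordinates bridges the gap.
-/

noncomputable section

namespace WeightedAmbient

/-! ### Derivatives of fields of linear and bilinear maps -/

section Calculus

variable {E V V' X : Type*} [NormedAddCommGroup E] [NormedSpace ℝ E] [NormedAddCommGroup V]
  [NormedSpace ℝ V] [NormedAddCommGroup V'] [NormedSpace ℝ V'] [NormedAddCommGroup X]
  [NormedSpace ℝ X]

theorem fderiv_apply_field {T : E → V →L[ℝ] X} {a : E → V} {y : E}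
    (hT : DifferentiableAt ℝ T y) (ha : DifferentiableAt ℝ a y) (u : E) :
    fderiv ℝ (fun z => T z (a z)) y u = fderiv ℝ T y u (a y) + T y (fderiv ℝ a y u) := by
  rw [fderiv_clm_apply hT ha]; simp [add_comm]

theorem fderiv_apply_const {T : E → V →L[ℝ] X} {y : E}
    (hT : DifferentiableAt ℝ T y) (a : V) (u : E) :
    fderiv ℝ (fun z => T z a) y u = fderiv ℝ T y u a := by
  rw [fderiv_apply_field hT (differentiableAt_const a)]; simp

theorem fderiv_apply₂_field {B : E → V →L[ℝ] V' →L[ℝ] X} {a : E → V} {b : E → V'} {y : E}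
    (hB : DifferentiableAt ℝ B y) (ha : DifferentiableAt ℝ a y) (hb : DifferentiableAt ℝ b y)
    (u : E) :
    fderiv ℝ (fun z => B z (a z) (b z)) y u =
      fderiv ℝ B y u (a y) (b y) + B y (fderiv ℝ a y u) (b y) + B y (a y) (fderiv ℝ b y u) := by
  rw [fderiv_apply_field (hB.clm_apply ha) hb, fderiv_apply_field hB ha]; simp

theorem fderiv_apply₂_const {B : E → V →L[ℝ] V' →L[ℝ] X} {y : E}
    (hB : DifferentiableAt ℝ B y) (a : V) (b : V') (u : E) :
    fderiv ℝ (fun z => B z a b) y u = fderiv ℝ B y u a b := by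
  rw [fderiv_apply_const (hB.clm_apply (differentiableAt_const a)), fderiv_apply_const hB]

/-- On a finite-dimensional space, smoothness of a field of linear maps may be tested on
vectors. -/
theorem contDiffAt_clm_of_apply [FiniteDimensional ℝ V] {n : WithTop ℕ∞} {T : E → V →L[ℝ] X}
    {y : E} (h : ∀ v, ContDiffAt ℝ n (fun z => T z v) y) : ContDiffAt ℝ n T y := by
  simp only [← contDiffWithinAt_univ] at h ⊢
  let d := Module.finrank ℝ V
  have hd : d = Module.finrank ℝ (Fin d → ℝ) := (Module.finrank_fin_fun ℝ).symm
  let e₁ := ContinuousLinearEquiv.ofFinrankEq hd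
  let e₂ := (e₁.arrowCongr (1 : X ≃L[ℝ] X)).trans (ContinuousLinearEquiv.piRing (Fin d))
  rw [← Function.id_comp T, ← e₂.symm_comp_self]
  exact e₂.symm.contDiff.comp_contDiffWithinAt (contDiffWithinAt_pi.mpr fun i => h _)

theorem fderiv_fderiv_symm {F : E → X} {y : E} {n : WithTop ℕ∞} (hF : ContDiffAt ℝ n F y)
    (hn : 2 ≤ n) (u v : E) :
    fderiv ℝ (fderiv ℝ F) y u v = fderiv ℝ (fderiv ℝ F) y v u :=
  hF.isSymmSndFDerivAt (by simpa using hn) u v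

theorem contDiffAt_fderiv {F : E → X} {y : E} (hF : ContDiffAt ℝ ∞ F y) :
    ContDiffAt ℝ ∞ (fderiv ℝ F) y :=
  hF.fderiv_right (by norm_num)

theorem isInvertible_of_injective [FiniteDimensional ℝ E] {T : E →L[ℝ] E}
    (h : Function.Injective T) : T.IsInvertible :=
  ⟨(LinearEquiv.ofInjectiveEndo (T : E →ₗ[ℝ] E) h).toContinuousLinearEquiv, by ext; rfl⟩

theorem isInvertible_of_nondegenerate [FiniteDimensional ℝ E] {B : E →L[ℝ] E →L[ℝ] ℝ}
    (h : ∀ v, (∀ w, B v w = 0) → v = 0) : B.IsInvertible := by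
  have hinj : Function.Injective (B : E →ₗ[ℝ] E →L[ℝ] ℝ) := by
    refine (injective_iff_map_eq_zero _).2 fun v hv => h v fun w => ?_
    exact DFunLike.congr_fun hv w
  have hdim : Module.finrank ℝ E = Module.finrank ℝ (E →L[ℝ] ℝ) := by
    rw [← (LinearMap.toContinuousLinearMap (𝕜 := ℝ) (E := E) (F' := ℝ)).finrank_eq,
      Module.finrank_linearMap, Module.finrank_self, mul_one]
  exact ⟨(LinearEquiv.ofInjectiveOfFinrankEq _ hinj hdim).toContinuousLinearEquiv, by ext; rfl⟩

theorem contDiffAt_inverse_field [CompleteSpace E] {B : X → E →L[ℝ] V} {y : X}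
    {n : WithTop ℕ∞} (hB : ContDiffAt ℝ n B y) (hi : (B y).IsInvertible) :
    ContDiffAt ℝ n (fun z => (B z).inverse) y := by
  obtain ⟨e, he⟩ := hi
  have := contDiffAt_map_inverse (𝕜 := ℝ) (n := n) e
  rw [he] at this
  exact this.comp y hB

end Calculus

/-! ### The Levi-Civita connection in a moving frame -/

section Frame

variable {E V : Type*} [NormedAddCommGroup E] [NormedSpace ℝ E] [NormedAddCommGroup V]
  [NormedSpace ℝ V]

/-- The frame `Θ` identifies the tangent spaces with `V`, near `y` it maps the metric `G` to the
field `B` of bilinear forms on `V`, and at `y` the connection `d + κ` on the trivial bundle with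
fibre `V` preserves `B` and is torsion-free when read through `Θ`. -/
structure IsTorsionFreeFrame (G : E → E →L[ℝ] E →L[ℝ] ℝ) (B : E → V →L[ℝ] V →L[ℝ] ℝ)
    (Θ : E → E →L[ℝ] V) (κ : E → E →L[ℝ] V →L[ℝ] V) (y : E) : Prop where
  eq : ∀ᶠ z in 𝓝 y, ∀ u w, G z u w = B z (Θ z u) (Θ z w)
  diff_metric : DifferentiableAt ℝ G y
  diff_form : DifferentiableAt ℝ B y
  diff_frame : DifferentiableAt ℝ Θ y
  symm : ∀ a b, B y a b = B y b a
  compat : ∀ u a b, fderiv ℝ B y u a b = B y (κ y u a) b + B y a (κ y u b)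
  torsion : ∀ u w, fderiv ℝ Θ y u w + κ y u (Θ y w) = fderiv ℝ Θ y w u + κ y w (Θ y u)
  frame_invertible : (Θ y).IsInvertible
  metric_invertible : (G y).IsInvertible

variable {G : E → E →L[ℝ] E →L[ℝ] ℝ} {B : E → V →L[ℝ] V →L[ℝ] ℝ}
    {Θ : E → E →L[ℝ] V} {κ : E → E →L[ℝ] V →L[ℝ] V} {y : E}

theorem IsTorsionFreeFrame.fderiv_metric (h : IsTorsionFreeFrame G B Θ κ y) (u v w : E) :
    fderiv ℝ G y u v w =
      B y (fderiv ℝ Θ y u v + κ y u (Θ y v)) (Θ y w) +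
        B y (Θ y v) (fderiv ℝ Θ y u w + κ y u (Θ y w)) := by
  have h1 : (fun z => G z v w) =ᶠ[𝓝 y] fun z => B z (Θ z v) (Θ z w) := by
    filter_upwards [h.eq] with z hz using hz v w
  have hv : ∀ v : E, DifferentiableAt ℝ (fun z => Θ z v) y := fun v =>
    h.diff_frame.clm_apply (differentiableAt_const v)
  rw [← fderiv_apply₂_const h.diff_metric, h1.fderiv_eq,
    fderiv_apply₂_field h.diff_form (hv v) (hv w), fderiv_apply_const h.diff_frame,
    fderiv_apply_const h.diff_frame, h.compat]
  simp only [map_add, add_apply]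
  ring

/-- The Koszul formula in a moving frame. -/
theorem IsTorsionFreeFrame.christoffel_eq (h : IsTorsionFreeFrame G B Θ κ y) (u w : E) :
    Θ y (christoffel G y u w) = fderiv ℝ Θ y u w + κ y u (Θ y w) := by
  set Z := (Θ y).inverse (fderiv ℝ Θ y u w + κ y u (Θ y w)) with hZ
  have hΘZ : Θ y Z = fderiv ℝ Θ y u w + κ y u (Θ y w) :=
    h.frame_invertible.self_apply_inverse _
  suffices christoffel G y u w = Z by rw [this, hΘZ]
  rw [christoffel_apply, h.metric_invertible.inverse_apply_eq]
  ext z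
  rw [christoffelLow_apply, h.eq.self_of_nhds, hΘZ, h.fderiv_metric, h.fderiv_metric,
    h.fderiv_metric, h.torsion w u, h.torsion z u, h.torsion z w,
    h.symm (Θ y u), h.symm (Θ y w)]
  ring

/-- The curvature of `G` is the curvature of the connection form `κ`. -/
theorem curvature_eq_of_frame (h : ∀ᶠ z in 𝓝 y, IsTorsionFreeFrame G B Θ κ z)
    (hΘ : ContDiffAt ℝ 2 Θ y) (hκ : DifferentiableAt ℝ κ y)
    (hΓ : DifferentiableAt ℝ (christoffel G) y) (u v w : E) :
    Θ y (curvature G y v w u) =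
      fderiv ℝ κ y u v (Θ y w) - fderiv ℝ κ y v u (Θ y w)
        + κ y u (κ y v (Θ y w)) - κ y v (κ y u (Θ y w)) := by
  have h0 := h.self_of_nhds
  have hΘ1 : DifferentiableAt ℝ Θ y := hΘ.differentiableAt (by norm_num)
  have hΘ2 : DifferentiableAt ℝ (fderiv ℝ Θ) y :=
    (hΘ.fderiv_right (m := 1) (by norm_num)).differentiableAt (by norm_num)
  -- differentiate `Θ Γ(v, w) = (∂_v Θ) w + κ(v) Θ w` in the direction `u`
  have key : ∀ u v w : E, Θ y (fderiv ℝ (christoffel G) y u v w) =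
      fderiv ℝ (fderiv ℝ Θ) y u v w + fderiv ℝ κ y u v (Θ y w) + κ y v (fderiv ℝ Θ y u w)
        - fderiv ℝ Θ y u (christoffel G y v w) := by
    intro u v w
    have h1 : (fun z => Θ z (christoffel G z v w)) =ᶠ[𝓝 y]
        fun z => fderiv ℝ Θ z v w + κ z v (Θ z w) := by
      filter_upwards [h] with z hz using hz.christoffel_eq v w
    have h2 := DFunLike.congr_fun (h1.fderiv_eq (𝕜 := ℝ)) u
    have hc : ∀ x : E, DifferentiableAt ℝ (fun _ : E => x) y := fun x =>
      differentiableAt_const x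
    have hΓv := (hΓ.clm_apply (hc v)).clm_apply (hc w)
    have hκv := hκ.clm_apply (hc v)
    rw [fderiv_apply_field hΘ1 hΓv, fderiv_apply₂_const hΓ,
      fderiv_fun_add ((hΘ2.clm_apply (hc v)).clm_apply (hc w))
        (hκv.clm_apply (hΘ1.clm_apply (hc w))), add_apply,
      fderiv_apply₂_const hΘ2, fderiv_apply_field hκv (hΘ1.clm_apply (hc w)),
      fderiv_apply_const hκ, fderiv_apply_const hΘ1] at h2
    rw [eq_sub_iff_add_eq, add_comm, h2, add_assoc]
  rw [curvature_apply, map_sub, map_add, map_sub, key, key, h0.christoffel_eq,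
    h0.christoffel_eq, h0.christoffel_eq, h0.christoffel_eq,
    fderiv_fderiv_symm hΘ le_rfl u v, map_add, map_add]
  abel

/-- If `l` is the differential of `F` in the frame, then the Hessian of `F` is the covariant
derivative of `l` with respect to `κ`. -/
theorem IsTorsionFreeFrame.hessian_eq (h : IsTorsionFreeFrame G B Θ κ y) {F : E → ℝ}
    {l : E → V →L[ℝ] ℝ} (hl : DifferentiableAt ℝ l y)
    (hF : ∀ᶠ z in 𝓝 y, ∀ u, fderiv ℝ F z u = l z (Θ z u))
    (hFd : DifferentiableAt ℝ (fderiv ℝ F) y) (u w : E) :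
    hessian G F y u w = fderiv ℝ l y u (Θ y w) - l y (κ y u (Θ y w)) := by
  have h1 : hessian G F y u w =
    fderiv ℝ (fderiv ℝ F) y u w - fderiv ℝ F y (christoffel G y u w) := rfl
  have h2 : (fun z => fderiv ℝ F z w) =ᶠ[𝓝 y] fun z => l z (Θ z w) := by
    filter_upwards [hF] with z hz using hz w
  rw [h1, hF.self_of_nhds, h.christoffel_eq, ← fderiv_apply_const hFd, h2.fderiv_eq,
    fderiv_apply_field hl (h.diff_frame.clm_apply (differentiableAt_const w)),
    fderiv_apply_const h.diff_frame, map_add]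
  ring

/-- If `l` is the differential of `F` in the frame and `X` is dual to `l`, then `|∇F|² = l(X)`. -/
theorem IsTorsionFreeFrame.gradNormSq_eq (h : IsTorsionFreeFrame G B Θ κ y) {F : E → ℝ}
    {l : V →L[ℝ] ℝ} (hF : ∀ u, fderiv ℝ F y u = l (Θ y u)) {X : V}
    (hX : ∀ v, B y X v = l v) : gradNormSq G F y = l X := by
  obtain ⟨u, rfl⟩ := h.frame_invertible.surjective X
  have h1 : (G y).inverse (fderiv ℝ F y) = u := by
    rw [h.metric_invertible.inverse_apply_eq]
    ext v
    rw [hF, h.eq.self_of_nhds, hX]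
  rw [gradNormSq, h1, hF]

end Frame

/-! ### The Levi-Civita connection of a smooth metric in coordinates -/

section LeviCivita

variable {E : Type*} [NormedAddCommGroup E] [NormedSpace ℝ E]
variable {G : E → E →L[ℝ] E →L[ℝ] ℝ} {y : E}

theorem lower_christoffel (hi : (G y).IsInvertible) (u v w : E) :
    G y (christoffel G y u v) w = christoffelLow G y u v w := by
  rw [christoffel_apply, hi.self_apply_inverse]

theorem fderiv_metric_symm (hG : DifferentiableAt ℝ G y)
    (hs : ∀ᶠ z in 𝓝 y, ∀ u v, G z u v = G z v u) (u v w : E) :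
    fderiv ℝ G y u v w = fderiv ℝ G y u w v := by
  rw [← fderiv_apply₂_const hG, ← fderiv_apply₂_const hG]
  congr 1
  exact Filter.EventuallyEq.fderiv_eq (by filter_upwards [hs] with z hz using hz v w)

theorem christoffel_symm (hG : DifferentiableAt ℝ G y)
    (hs : ∀ᶠ z in 𝓝 y, ∀ u v, G z u v = G z v u) (u v : E) :
    christoffel G y u v = christoffel G y v u := by
  rw [christoffel_apply, christoffel_apply]
  congr 1
  ext w
  rw [christoffelLow_apply, christoffelLow_apply, fderiv_metric_symm hG hs w u v]
  ring

theorem fderiv_metric_eq (hG : DifferentiableAt ℝ G y) (hi : (G y).IsInvertible)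
    (hs : ∀ᶠ z in 𝓝 y, ∀ u v, G z u v = G z v u) (u v w : E) :
    fderiv ℝ G y u v w = G y (christoffel G y u v) w + G y v (christoffel G y u w) := by
  rw [hs.self_of_nhds v, lower_christoffel hi, lower_christoffel hi, christoffelLow_apply,
    christoffelLow_apply, fderiv_metric_symm hG hs u w v]
  ring

theorem contDiffAt_christoffel [CompleteSpace E] (hG : ContDiffAt ℝ ∞ G y)
    (hi : (G y).IsInvertible) : ContDiffAt ℝ ∞ (christoffel G) y := by
  have h1 : ContDiffAt ℝ ∞ (christoffelLow G) y := by
    have h2 := contDiffAt_fderiv hG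
    unfold christoffelLow
    have hf : ContDiffAt ℝ ∞ (fun z => (fderiv ℝ G z).flip) y :=
      (ContinuousLinearMap.flipₗᵢ ℝ E E (E →L[ℝ] ℝ)).toContinuousLinearEquiv.contDiff.contDiffAt.comp
        y h2
    exact ContDiffAt.const_smul (1 / 2 : ℝ) ((h2.add hf).sub (ContDiffAt.clm_comp (g := fun _ =>
      ((ContinuousLinearMap.flipₗᵢ ℝ E E ℝ).toContinuousLinearEquiv :
        (E →L[ℝ] E →L[ℝ] ℝ) →L[ℝ] (E →L[ℝ] E →L[ℝ] ℝ))) contDiffAt_const hf))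
  have h3 : ContDiffAt ℝ ∞ (fun z => (G z).inverse) y := contDiffAt_inverse_field hG hi
  unfold christoffel
  exact (((ContinuousLinearMap.compL ℝ E (E →L[ℝ] ℝ) E).contDiff.contDiffAt.comp y h3)).clm_comp h1

end LeviCivita

/-! ### Naturality of the curvatures under changes of coordinates -/

section Naturality

variable {E : Type*} [NormedAddCommGroup E] [NormedSpace ℝ E]

/-- Near `y`, `φ` is a local diffeomorphism which pulls the smooth metric `G'` back to the smooth
metric `G`. -/
structure IsIsometryAt (φ : E → E) (G G' : E → E →L[ℝ] E →L[ℝ] ℝ) (y : E) : Prop where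
  smooth : ContDiffAt ℝ ∞ φ y
  smooth_source : ContDiffAt ℝ ∞ G y
  smooth_target : ContDiffAt ℝ ∞ G' (φ y)
  fderiv_invertible : (fderiv ℝ φ y).IsInvertible
  source_invertible : (G y).IsInvertible
  target_invertible : (G' (φ y)).IsInvertible
  target_symm : ∀ᶠ z in 𝓝 (φ y), ∀ u v, G' z u v = G' z v u
  eq : ∀ᶠ z in 𝓝 y, ∀ u v, G z u v = G' (φ z) (fderiv ℝ φ z u) (fderiv ℝ φ z v)

variable {φ : E → E} {G G' : E → E →L[ℝ] E →L[ℝ] ℝ} {y : E}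

theorem contDiffAt_comp_field {X : Type*} [NormedAddCommGroup X] [NormedSpace ℝ X] {B' : E → X}
    (hφ : ContDiffAt ℝ ∞ φ y) (hB : ContDiffAt ℝ ∞ B' (φ y)) :
    ContDiffAt ℝ ∞ (fun z => B' (φ z)) y :=
  hB.comp y hφ

theorem fderiv_comp_field {X : Type*} [NormedAddCommGroup X] [NormedSpace ℝ X] {B' : E → X}
    (hφ : DifferentiableAt ℝ φ y) (hB : DifferentiableAt ℝ B' (φ y)) (u : E) :
    fderiv ℝ (fun z => B' (φ z)) y u = fderiv ℝ B' (φ y) (fderiv ℝ φ y u) := by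
  have := fderiv_comp y hB hφ
  exact DFunLike.congr_fun this u

/-- The differential of a local isometry is a frame in which the Levi-Civita connection of the
source is the one of the target. -/
theorem IsIsometryAt.frame [CompleteSpace E] (h : IsIsometryAt φ G G' y) :
    IsTorsionFreeFrame G (fun z => G' (φ z)) (fderiv ℝ φ)
      (fun z => (christoffel G' (φ z)).comp (fderiv ℝ φ z)) y where
  eq := h.eq
  diff_metric := h.smooth_source.differentiableAt (by simp)
  diff_form := (contDiffAt_comp_field h.smooth h.smooth_target).differentiableAt (by simp)
  diff_frame := (contDiffAt_fderiv h.smooth).differentiableAt (by simp)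
  symm := h.target_symm.self_of_nhds
  compat u a b := by
    rw [fderiv_comp_field (h.smooth.differentiableAt (by simp))
      (h.smooth_target.differentiableAt (by simp)),
      fderiv_metric_eq (h.smooth_target.differentiableAt (by simp)) h.target_invertible
        h.target_symm]
    rfl
  torsion u w := by
    rw [fderiv_fderiv_symm h.smooth (by norm_cast) u w]
    congr 1
    exact christoffel_symm (h.smooth_target.differentiableAt (by simp)) h.target_symm _ _
  frame_invertible := h.fderiv_invertible
  metric_invertible := h.source_invertible

theorem IsIsometryAt.christoffel_eq [CompleteSpace E] (h : IsIsometryAt φ G G' y) (u w : E) :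
    fderiv ℝ φ y (christoffel G y u w) = fderiv ℝ (fderiv ℝ φ) y u w
      + christoffel G' (φ y) (fderiv ℝ φ y u) (fderiv ℝ φ y w) :=
  h.frame.christoffel_eq u w

theorem curvature_of_isometry [CompleteSpace E] (h : ∀ᶠ z in 𝓝 y, IsIsometryAt φ G G' z)
    (u v w : E) :
    fderiv ℝ φ y (curvature G y v w u) =
      curvature G' (φ y) (fderiv ℝ φ y v) (fderiv ℝ φ y w) (fderiv ℝ φ y u) := by
  have h0 := h.self_of_nhds
  have hφ := h0.smooth
  have hφ' := contDiffAt_fderiv hφ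
  have hΓ' := contDiffAt_christoffel h0.smooth_target h0.target_invertible
  have hΓ'φ := contDiffAt_comp_field hφ hΓ'
  have hD : ∀ u v w : E,
      fderiv ℝ (fun z => (christoffel G' (φ z)).comp (fderiv ℝ φ z)) y u v w =
        fderiv ℝ (christoffel G') (φ y) (fderiv ℝ φ y u) (fderiv ℝ φ y v) w
          + christoffel G' (φ y) (fderiv ℝ (fderiv ℝ φ) y u v) w := by
    intro u v w
    rw [← fderiv_apply₂_const (((hΓ'φ.clm_comp hφ')).differentiableAt (by simp))]
    have h1 := fderiv_apply₂_field (hΓ'φ.differentiableAt (by simp))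
      ((hφ'.differentiableAt (by simp)).clm_apply (differentiableAt_const v))
      (differentiableAt_const w) u
    rw [fderiv_comp_field (hφ.differentiableAt (by simp)) (hΓ'.differentiableAt (by simp)),
      fderiv_apply_const (hφ'.differentiableAt (by simp))] at h1
    simpa using h1
  rw [curvature_eq_of_frame (h.mono fun z hz => hz.frame) (hφ'.of_le (by norm_cast))
    ((hΓ'φ.clm_comp hφ').differentiableAt (by simp))
    ((contDiffAt_christoffel h0.smooth_source h0.source_invertible).differentiableAt (by simp)),
    hD, hD, fderiv_fderiv_symm hφ (by norm_cast) u v, curvature_apply]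
  simp only [ContinuousLinearMap.comp_apply]
  abel

theorem riemann_of_isometry [CompleteSpace E] (h : ∀ᶠ z in 𝓝 y, IsIsometryAt φ G G' z)
    (u v w z : E) :
    riemann G y u v w z = riemann G' (φ y) (fderiv ℝ φ y u) (fderiv ℝ φ y v)
      (fderiv ℝ φ y w) (fderiv ℝ φ y z) := by
  rw [riemann, riemann, h.self_of_nhds.eq.self_of_nhds, curvature_of_isometry h]

variable {F F' : E → ℝ}

/-- `φ` pulls the smooth function `F'` back to `F` near `y`. -/
structure IsPullbackAt (φ : E → E) (F F' : E → ℝ) (y : E) : Prop where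
  smooth : ContDiffAt ℝ ∞ F' (φ y)
  eq : ∀ᶠ z in 𝓝 y, F z = F' (φ z)

theorem eventually_differentiableAt {X Z : Type*} [NormedAddCommGroup X] [NormedSpace ℝ X]
    [NormedAddCommGroup Z] [NormedSpace ℝ Z] {f : Z → X} {y : Z}
    (hf : ContDiffAt ℝ ∞ f y) : ∀ᶠ z in 𝓝 y, DifferentiableAt ℝ f z := by
  filter_upwards [(hf.of_le (m := 1) (by norm_cast)).eventually (by simp)] with z hz
  exact hz.differentiableAt (by simp)

theorem IsPullbackAt.fderiv_eq (h : IsPullbackAt φ F F' y) (hφ : ContDiffAt ℝ ∞ φ y) :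
    ∀ᶠ z in 𝓝 y, fderiv ℝ F z = (fderiv ℝ F' (φ z)).comp (fderiv ℝ φ z) := by
  filter_upwards [eventually_differentiableAt hφ, h.eq.eventually_nhds,
    hφ.continuousAt.eventually (eventually_differentiableAt h.smooth)] with z hz hFz hF'
  rw [Filter.EventuallyEq.fderiv_eq hFz]
  exact fderiv_comp z hF' hz

theorem IsPullbackAt.fderiv_fderiv_eq (h : IsPullbackAt φ F F' y) (hφ : ContDiffAt ℝ ∞ φ y)
    (u w : E) :
    fderiv ℝ (fderiv ℝ F) y u w =
      fderiv ℝ (fderiv ℝ F') (φ y) (fderiv ℝ φ y u) (fderiv ℝ φ y w)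
        + fderiv ℝ F' (φ y) (fderiv ℝ (fderiv ℝ φ) y u w) := by
  have h1 := contDiffAt_comp_field hφ (contDiffAt_fderiv h.smooth)
  have hφ' := contDiffAt_fderiv hφ
  rw [Filter.EventuallyEq.fderiv_eq (h.fderiv_eq hφ),
    ← fderiv_apply_const ((h1.clm_comp hφ').differentiableAt (by simp))]
  have h2 := fderiv_apply_field (h1.differentiableAt (by simp))
    ((hφ'.differentiableAt (by simp)).clm_apply (differentiableAt_const w)) u
  rw [fderiv_comp_field (hφ.differentiableAt (by simp))
    ((contDiffAt_fderiv h.smooth).differentiableAt (by simp)),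
    fderiv_apply_const (hφ'.differentiableAt (by simp))] at h2
  exact h2

theorem hessian_of_isometry [CompleteSpace E] (h : IsIsometryAt φ G G' y)
    (hF : IsPullbackAt φ F F' y) (u w : E) :
    hessian G F y u w = hessian G' F' (φ y) (fderiv ℝ φ y u) (fderiv ℝ φ y w) := by
  have h1 : ∀ (G : E → E →L[ℝ] E →L[ℝ] ℝ) (F : E → ℝ) (y u w : E), hessian G F y u w =
      fderiv ℝ (fderiv ℝ F) y u w - fderiv ℝ F y (christoffel G y u w) := fun _ _ _ _ _ => rfl
  rw [h1, h1, hF.fderiv_fderiv_eq h.smooth, (hF.fderiv_eq h.smooth).self_of_nhds,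
    ContinuousLinearMap.comp_apply, h.christoffel_eq, map_add]
  ring

theorem trace_eq_of_conj {T : E →L[ℝ] E} (hT : T.IsInvertible) {A A' : E →ₗ[ℝ] E}
    (h : ∀ u, T (A u) = A' (T u)) : LinearMap.trace ℝ E A = LinearMap.trace ℝ E A' := by
  obtain ⟨e, rfl⟩ := hT
  rw [← LinearMap.trace_conj' A e.toLinearEquiv]
  congr 1
  ext u
  simpa [LinearEquiv.conj_apply] using h (e.symm u)

theorem inverse_of_pull {T : E →L[ℝ] E} (hT : T.IsInvertible) {g g' : E →L[ℝ] E →L[ℝ] ℝ}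
    (hg : g.IsInvertible) (hg' : g'.IsInvertible) (h : ∀ u v, g u v = g' (T u) (T v))
    (l : E →L[ℝ] ℝ) : T (g.inverse (l.comp T)) = g'.inverse l := by
  rw [eq_comm, hg'.inverse_apply_eq]
  ext v
  obtain ⟨v, rfl⟩ := hT.surjective v
  rw [← h, hg.self_apply_inverse]
  rfl

theorem metricTrace_of_pull {T : E →L[ℝ] E} (hT : T.IsInvertible)
    {g g' B B' : E →L[ℝ] E →L[ℝ] ℝ}
    (hg : g.IsInvertible) (hg' : g'.IsInvertible) (h : ∀ u v, g u v = g' (T u) (T v))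
    (hB : ∀ u v, B u v = B' (T u) (T v)) : metricTrace g B = metricTrace g' B' := by
  refine trace_eq_of_conj hT fun u => ?_
  have : B u = (B' (T u)).comp T := by ext v; exact hB u v
  change T (g.inverse (B u)) = g'.inverse (B' (T u))
  rw [this, inverse_of_pull hT hg hg' h]

theorem IsIsometryAt.metricTrace_eq (h : IsIsometryAt φ G G' y)
    {B B' : E →L[ℝ] E →L[ℝ] ℝ} (hB : ∀ u v, B u v = B' (fderiv ℝ φ y u) (fderiv ℝ φ y v)) :
    metricTrace (G y) B = metricTrace (G' (φ y)) B' :=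
  metricTrace_of_pull h.fderiv_invertible h.source_invertible h.target_invertible
    h.eq.self_of_nhds hB

theorem covDeriv_of_isometry [CompleteSpace E] (h : IsIsometryAt φ G G' y)
    {B B' : E → E →L[ℝ] E →L[ℝ] ℝ}
    (hBd : DifferentiableAt ℝ B y) (hBd' : DifferentiableAt ℝ B' (φ y))
    (hB : ∀ᶠ z in 𝓝 y, ∀ u v, B z u v = B' (φ z) (fderiv ℝ φ z u) (fderiv ℝ φ z v)) (u v w : E) :
    covDeriv G B y u v w =
      covDeriv G' B' (φ y) (fderiv ℝ φ y u) (fderiv ℝ φ y v) (fderiv ℝ φ y w) := by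
  have hφ := h.smooth.differentiableAt (by simp)
  have hφ' := (contDiffAt_fderiv h.smooth).differentiableAt (by simp)
  have hφa : ∀ v, DifferentiableAt ℝ (fun z => fderiv ℝ φ z v) y := fun v =>
    hφ'.clm_apply (differentiableAt_const v)
  have h1 : fderiv ℝ B y u v w = fderiv ℝ B' (φ y) (fderiv ℝ φ y u) (fderiv ℝ φ y v)
      (fderiv ℝ φ y w) + B' (φ y) (fderiv ℝ (fderiv ℝ φ) y u v) (fderiv ℝ φ y w)
      + B' (φ y) (fderiv ℝ φ y v) (fderiv ℝ (fderiv ℝ φ) y u w) := by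
    have h2 : (fun z => B z v w) =ᶠ[𝓝 y]
        fun z => B' (φ z) (fderiv ℝ φ z v) (fderiv ℝ φ z w) := by
      filter_upwards [hB] with z hz using hz v w
    rw [← fderiv_apply₂_const hBd, h2.fderiv_eq,
      fderiv_apply₂_field (B := fun z => B' (φ z)) (hBd'.comp y hφ) (hφa v) (hφa w),
      fderiv_comp_field hφ hBd', fderiv_apply_const hφ', fderiv_apply_const hφ']
  rw [covDeriv, covDeriv, h1, hB.self_of_nhds, hB.self_of_nhds, h.christoffel_eq,
    h.christoffel_eq]
  simp only [map_add, add_apply]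
  ring

variable [FiniteDimensional ℝ E]

theorem ricci_of_isometry (h : ∀ᶠ z in 𝓝 y, IsIsometryAt φ G G' z) (v w : E) :
    ricci G y v w = ricci G' (φ y) (fderiv ℝ φ y v) (fderiv ℝ φ y w) := by
  have := FiniteDimensional.complete ℝ E
  rw [ricci_apply, ricci_apply]
  exact trace_eq_of_conj h.self_of_nhds.fderiv_invertible fun u => curvature_of_isometry h u v w

variable (m μ : ℝ)

theorem ricciW_of_isometry (h : ∀ᶠ z in 𝓝 y, IsIsometryAt φ G G' z)
    (hF : IsPullbackAt φ F F' y) (u w : E) :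
    ricciW m G F y u w = ricciW m G' F' (φ y) (fderiv ℝ φ y u) (fderiv ℝ φ y w) := by
  have := FiniteDimensional.complete ℝ E
  have h1 : ∀ (G : E → E →L[ℝ] E →L[ℝ] ℝ) (F : E → ℝ) (y u w : E), ricciW m G F y u w =
      ricci G y u w - m / F y * hessian G F y u w := fun _ _ _ _ _ => rfl
  rw [h1, h1, ricci_of_isometry h, hessian_of_isometry h.self_of_nhds hF, hF.eq.self_of_nhds]

theorem scalarW_of_isometry (h : ∀ᶠ z in 𝓝 y, IsIsometryAt φ G G' z)
    (hF : IsPullbackAt φ F F' y) :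
    scalarW m μ G F y = scalarW m μ G' F' (φ y) := by
  have := FiniteDimensional.complete ℝ E
  have h0 := h.self_of_nhds
  have hgrad : gradNormSq G F y = gradNormSq G' F' (φ y) := by
    unfold gradNormSq
    rw [(hF.fderiv_eq h0.smooth).self_of_nhds, ContinuousLinearMap.comp_apply,
      inverse_of_pull h0.fderiv_invertible h0.source_invertible h0.target_invertible
        h0.eq.self_of_nhds]
  unfold scalarW
  rw [hgrad, hF.eq.self_of_nhds, scalarCurvature, scalarCurvature, laplacian, laplacian,
    h0.metricTrace_eq (ricci_of_isometry h), h0.metricTrace_eq (hessian_of_isometry h0 hF)]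

theorem schoutenW_of_isometry (h : ∀ᶠ z in 𝓝 y, IsIsometryAt φ G G' z)
    (hF : IsPullbackAt φ F F' y) (u w : E) :
    schoutenW m μ G F y u w = schoutenW m μ G' F' (φ y) (fderiv ℝ φ y u) (fderiv ℝ φ y w) := by
  have h1 : ∀ (G : E → E →L[ℝ] E →L[ℝ] ℝ) (F : E → ℝ) (y u w : E), schoutenW m μ G F y u w =
      (1 / (Module.finrank ℝ E + m - 2) : ℝ) *
        (ricciW m G F y u w - 1 / (2 * (Module.finrank ℝ E + m - 1)) * scalarW m μ G F y * G y u w)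
        := fun _ _ _ _ _ => rfl
  rw [h1, h1, ricciW_of_isometry m h hF, scalarW_of_isometry m μ h hF,
    h.self_of_nhds.eq.self_of_nhds]

theorem traceDefectW_of_isometry (h : ∀ᶠ z in 𝓝 y, IsIsometryAt φ G G' z)
    (hF : IsPullbackAt φ F F' y) :
    traceDefectW m μ G F y = traceDefectW m μ G' F' (φ y) := by
  unfold traceDefectW schoutenScalarW
  rw [scalarW_of_isometry m μ h hF,
    h.self_of_nhds.metricTrace_eq (schoutenW_of_isometry m μ h hF)]

end Naturality

/-! ### Smoothness of the weighted curvatures -/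

section Smoothness

variable {E : Type*} [NormedAddCommGroup E] [NormedSpace ℝ E] [FiniteDimensional ℝ E]
variable {G B : E → E →L[ℝ] E →L[ℝ] ℝ} {F : E → ℝ} {y : E}

theorem contDiffAt_trace {X : Type*} [NormedAddCommGroup X] [NormedSpace ℝ X]
    {T : X → E →L[ℝ] E} {x : X} (hT : ContDiffAt ℝ ∞ T x) :
    ContDiffAt ℝ ∞ (fun z => LinearMap.trace ℝ E (T z : E →ₗ[ℝ] E)) x := by
  let τ : (E →L[ℝ] E) →L[ℝ] ℝ := LinearMap.toContinuousLinearMap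
    ((LinearMap.trace ℝ E).comp (ContinuousLinearMap.coeLM ℝ))
  exact τ.contDiff.contDiffAt.comp x hT

theorem contDiffAt_ricci (hG : ContDiffAt ℝ ∞ G y) (hi : (G y).IsInvertible) :
    ContDiffAt ℝ ∞ (ricci G) y := by
  have := FiniteDimensional.complete ℝ E
  have hΓ := contDiffAt_christoffel hG hi
  have hΓ' := contDiffAt_fderiv hΓ
  have ha : ∀ {T : E → E →L[ℝ] E →L[ℝ] E} {a b : E → E}, ContDiffAt ℝ ∞ T y →
      ContDiffAt ℝ ∞ a y → ContDiffAt ℝ ∞ b y → ContDiffAt ℝ ∞ (fun z => T z (a z) (b z)) y :=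
    fun hT ha hb => (hT.clm_apply ha).clm_apply hb
  have hc : ∀ v : E, ContDiffAt ℝ ∞ (fun _ : E => v) y := fun _ => contDiffAt_const
  refine contDiffAt_clm_of_apply fun v => contDiffAt_clm_of_apply fun w => ?_
  refine contDiffAt_trace (contDiffAt_clm_of_apply fun u => ?_)
  simp only [curvature_apply]
  exact (((ha (hΓ'.clm_apply (hc u)) (hc v) (hc w)).sub
    (ha (hΓ'.clm_apply (hc v)) (hc u) (hc w))).add
      (ha hΓ (hc u) (ha hΓ (hc v) (hc w)))).sub (ha hΓ (hc v) (ha hΓ (hc u) (hc w)))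

theorem contDiffAt_metricTrace (hG : ContDiffAt ℝ ∞ G y) (hi : (G y).IsInvertible)
    (hB : ContDiffAt ℝ ∞ B y) : ContDiffAt ℝ ∞ (fun z => metricTrace (G z) (B z)) y := by
  have := FiniteDimensional.complete ℝ E
  exact contDiffAt_trace ((contDiffAt_inverse_field hG hi).clm_comp hB)

theorem contDiffAt_hessian (hG : ContDiffAt ℝ ∞ G y) (hi : (G y).IsInvertible)
    (hF : ContDiffAt ℝ ∞ F y) : ContDiffAt ℝ ∞ (hessian G F) y := by
  have := FiniteDimensional.complete ℝ E
  have hF' := contDiffAt_fderiv hF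
  exact (contDiffAt_fderiv hF').sub
    ((((ContinuousLinearMap.compL ℝ E E ℝ).contDiff.contDiffAt.comp y hF')).clm_comp
      (contDiffAt_christoffel hG hi))

variable (m μ : ℝ)

theorem contDiffAt_scalarW (hG : ContDiffAt ℝ ∞ G y) (hi : (G y).IsInvertible)
    (hF : ContDiffAt ℝ ∞ F y) (h0 : F y ≠ 0) : ContDiffAt ℝ ∞ (scalarW m μ G F) y := by
  have := FiniteDimensional.complete ℝ E
  have hF' := contDiffAt_fderiv hF
  have hgrad : ContDiffAt ℝ ∞ (gradNormSq G F) y :=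
    hF'.clm_apply ((contDiffAt_inverse_field hG hi).clm_apply hF')
  exact ((contDiffAt_metricTrace hG hi (contDiffAt_ricci hG hi)).sub
    ((contDiffAt_const.div hF h0).mul
      (contDiffAt_metricTrace hG hi (contDiffAt_hessian hG hi hF)))).sub
    ((contDiffAt_const.div (hF.pow 2) (pow_ne_zero 2 h0)).mul (hgrad.sub contDiffAt_const))

theorem contDiffAt_schoutenW (hG : ContDiffAt ℝ ∞ G y) (hi : (G y).IsInvertible)
    (hF : ContDiffAt ℝ ∞ F y) (h0 : F y ≠ 0) : ContDiffAt ℝ ∞ (schoutenW m μ G F) y := by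
  have h1 := contDiffAt_ricci hG hi
  have h2 := contDiffAt_hessian hG hi hF
  have h3 := contDiffAt_scalarW m μ hG hi hF h0
  change ContDiffAt ℝ ∞ (fun z => (1 / (Module.finrank ℝ E + m - 2) : ℝ) •
    (ricci G z - (m / F z) • hessian G F z
      - (1 / (2 * (Module.finrank ℝ E + m - 1)) * scalarW m μ G F z) • G z)) y
  fun_prop (disch := assumption)

theorem contDiffAt_traceDefectW (hG : ContDiffAt ℝ ∞ G y) (hi : (G y).IsInvertible)
    (hF : ContDiffAt ℝ ∞ F y) (h0 : F y ≠ 0) : ContDiffAt ℝ ∞ (traceDefectW m μ G F) y :=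
  (contDiffAt_const.mul (contDiffAt_scalarW m μ hG hi hF h0)).sub
    (contDiffAt_metricTrace hG hi (contDiffAt_schoutenW m μ hG hi hF h0))

end Smoothness

/-! ### Weighted locally conformally flat metrics -/

section ConformallyFlat

variable {E : Type*} [NormedAddCommGroup E] [NormedSpace ℝ E]
variable {G : E → E →L[ℝ] E →L[ℝ] ℝ} {F : E → ℝ} {y : E}

/-- The endomorphism `A` with `P(u, v) = g(A u, v)`. -/
def raise (g P : E →L[ℝ] E →L[ℝ] ℝ) : E →L[ℝ] E := g.inverse.comp P

theorem metric_raise {g : E →L[ℝ] E →L[ℝ] ℝ} (hi : g.IsInvertible) (P : E →L[ℝ] E →L[ℝ] ℝ)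
    (u v : E) : g (raise g P u) v = P u v := by
  change g (g.inverse (P u)) v = _
  rw [hi.self_apply_inverse]

theorem ext_of_metric {g : E →L[ℝ] E →L[ℝ] ℝ} (hi : g.IsInvertible) {u v : E}
    (h : ∀ w, g u w = g v w) : u = v :=
  hi.injective (ContinuousLinearMap.ext h)

theorem curvature_eq_of_kulkarniNomizu {P : E →L[ℝ] E →L[ℝ] ℝ} (hi : (G y).IsInvertible)
    (hW : ∀ u v w z, riemann G y u v w z = kulkarniNomizu P (G y) u v w z) (u v w : E) :
    curvature G y v w u = G y v w • raise (G y) P u + P v w • u - P u w • v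
      - G y u w • raise (G y) P v := by
  refine ext_of_metric hi fun z => ?_
  have := hW u v z w
  rw [riemann, kulkarniNomizu] at this
  rw [this]
  simp only [map_sub, map_add, map_smul, sub_apply, add_apply, smul_apply, smul_eq_mul,
    metric_raise hi]
  ring

/-- The first Bianchi identity. -/
theorem curvature_bianchi (hΓ : DifferentiableAt ℝ (christoffel G) y)
    (hs : ∀ᶠ z in 𝓝 y, ∀ u v, christoffel G z u v = christoffel G z v u) (u v w : E) :
    curvature G y v w u + curvature G y w u v + curvature G y u v w = 0 := by
  have h1 : ∀ u v w, fderiv ℝ (christoffel G) y u v w = fderiv ℝ (christoffel G) y u w v := by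
    intro u v w
    rw [← fderiv_apply₂_const hΓ, ← fderiv_apply₂_const hΓ]
    exact DFunLike.congr_fun (Filter.EventuallyEq.fderiv_eq
      (by filter_upwards [hs] with z hz using hz v w)) u
  have h2 := hs.self_of_nhds
  rw [curvature_apply, curvature_apply, curvature_apply, h1 u v w, h1 v u w, h1 w u v, h2 w v,
    h2 u w, h2 u v]
  abel

variable [FiniteDimensional ℝ E]

theorem exists_ne_zero_orthogonal₂ (g : E →L[ℝ] E →L[ℝ] ℝ) (hd : 3 ≤ Module.finrank ℝ E)
    (v w : E) : ∃ u : E, u ≠ 0 ∧ g u v = 0 ∧ g u w = 0 := by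
  let T : E →ₗ[ℝ] ℝ × ℝ := ((g.flip v : E →L[ℝ] ℝ) : E →ₗ[ℝ] ℝ).prod ((g.flip w : E →L[ℝ] ℝ))
  have : LinearMap.ker T ≠ ⊥ := LinearMap.ker_ne_bot_of_finrank_lt (by simp; omega)
  obtain ⟨u, hu, hu0⟩ := (Submodule.ne_bot_iff _).1 this
  have h : (g u v, g u w) = (0, 0) := hu
  exact ⟨u, hu0, (Prod.ext_iff.1 h).1, (Prod.ext_iff.1 h).2⟩

/-- A tensor `P` with `Rm = P ∧ g` is symmetric: evaluate the first Bianchi identity on `u, v, w, u`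
with `u` orthogonal to `v` and `w`. -/
theorem symm_of_kulkarniNomizu {P : E →L[ℝ] E →L[ℝ] ℝ} (hd : 3 ≤ Module.finrank ℝ E)
    (hG : ContDiffAt ℝ ∞ G y) (hpos : ∀ v, v ≠ 0 → 0 < G y v v)
    (hi : ∀ᶠ z in 𝓝 y, (G z).IsInvertible)
    (hs : ∀ᶠ z in 𝓝 y, ∀ u v, G z u v = G z v u)
    (hW : ∀ u v w z, riemann G y u v w z = kulkarniNomizu P (G y) u v w z) (v w : E) :
    P v w = P w v := by
  have := FiniteDimensional.complete ℝ E
  obtain ⟨u, hu, huv, huw⟩ := exists_ne_zero_orthogonal₂ (G y) hd v w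
  have hsy := hs.self_of_nhds
  have hiy := hi.self_of_nhds
  have hΓs : ∀ᶠ z in 𝓝 y, ∀ u v, christoffel G z u v = christoffel G z v u := by
    filter_upwards [hs.eventually_nhds, eventually_differentiableAt hG] with z hz hGz
      using christoffel_symm hGz hz
  have hB := curvature_bianchi
    ((contDiffAt_christoffel hG hiy).differentiableAt (by simp)) hΓs u v w
  have h2 := congrArg (fun X => G y X u) hB
  simp only [curvature_eq_of_kulkarniNomizu hiy hW, map_sub, map_add, map_smul, sub_apply,
    add_apply, smul_apply, smul_eq_mul, metric_raise hiy, map_zero, zero_apply, hsy v u, hsy w u,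
    huv, huw, hsy w v] at h2
  have h3 : (P v w - P w v) * G y u u = 0 := by linear_combination h2
  rcases mul_eq_zero.1 h3 with h | h
  · linarith
  · exact absurd h (hpos u hu).ne'

theorem trace_smulRight (l : E →L[ℝ] ℝ) (v : E) :
    LinearMap.trace ℝ E ((l.smulRight v : E →L[ℝ] E) : E →ₗ[ℝ] E) = l v :=
  LinearMap.trace_smulRight (l : E →ₗ[ℝ] ℝ) v

theorem ricci_eq_of_kulkarniNomizu {P : E →L[ℝ] E →L[ℝ] ℝ} (hi : (G y).IsInvertible)
    (hs : ∀ u v, G y u v = G y v u) (hP : ∀ u v, P u v = P v u)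
    (hW : ∀ u v w z, riemann G y u v w z = kulkarniNomizu P (G y) u v w z) :
    ricci G y = metricTrace (G y) P • G y + ((Module.finrank ℝ E : ℝ) - 2) • P := by
  ext v w
  have h1 : curvature G y v w = G y v w • raise (G y) P + P v w • ContinuousLinearMap.id ℝ E
      - (P w).smulRight v - (G y w).smulRight (raise (G y) P v) := by
    ext u
    rw [curvature_eq_of_kulkarniNomizu hi hW u v w, hP u w, hs u w]
    rfl
  have h2 : ∀ A B C D : E →L[ℝ] E, ∀ a b : ℝ,
      LinearMap.trace ℝ E ((a • A + b • B - C - D : E →L[ℝ] E) : E →ₗ[ℝ] E) =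
        a * LinearMap.trace ℝ E (A : E →ₗ[ℝ] E) + b * LinearMap.trace ℝ E (B : E →ₗ[ℝ] E)
          - LinearMap.trace ℝ E (C : E →ₗ[ℝ] E) - LinearMap.trace ℝ E (D : E →ₗ[ℝ] E) := by
    intros; simp
  rw [ricci_apply, h1, h2, trace_smulRight, trace_smulRight, hs w, metric_raise hi, hP w v]
  have h3 : LinearMap.trace ℝ E ((ContinuousLinearMap.id ℝ E : E →L[ℝ] E) : E →ₗ[ℝ] E) =
    Module.finrank ℝ E := LinearMap.trace_id ℝ E
  rw [h3]
  simp only [add_apply, smul_apply, smul_eq_mul, metricTrace, raise]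
  ring

end ConformallyFlat

section Trace

variable {E : Type*} [NormedAddCommGroup E] [NormedSpace ℝ E]
variable {g B C : E →L[ℝ] E →L[ℝ] ℝ}

theorem metricTrace_add : metricTrace g (B + C) = metricTrace g B + metricTrace g C := by
  simp only [metricTrace, ← map_add]
  congr 1
  ext u
  simp

theorem metricTrace_smul (c : ℝ) : metricTrace g (c • B) = c * metricTrace g B := by
  rw [metricTrace, metricTrace, ← smul_eq_mul, ← map_smul]
  congr 1
  ext u
  simp

theorem metricTrace_self [FiniteDimensional ℝ E] (hi : g.IsInvertible) :
    metricTrace g g = Module.finrank ℝ E := by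
  rw [metricTrace, hi.inverse_comp_self]
  exact LinearMap.trace_id ℝ E

end Trace

section FlatDensity

variable {E : Type*} [NormedAddCommGroup E] [NormedSpace ℝ E] [FiniteDimensional ℝ E]
variable {G P : E → E →L[ℝ] E →L[ℝ] ℝ} {F U : E → ℝ} {y : E}

/-- The function `u = (f / m) Y_φ^m`, the derivative of `f_ρ` with respect to `ρ`. -/
def slopeW (m μ : ℝ) (G : E → E →L[ℝ] E →L[ℝ] ℝ) (F : E → ℝ) (y : E) : ℝ :=
  F y / m * traceDefectW m μ G F y

variable {m μ : ℝ}

/-- If `Rm = P_φ^m ∧ g`, then the trace of this identity is an equation for the Hessian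
of `f`. -/
theorem hessian_eq_of_kulkarniNomizu (hd : 3 ≤ Module.finrank ℝ E) (hm : 0 < m)
    (hi : (G y).IsInvertible) (hs : ∀ u v, G y u v = G y v u) (hF : F y ≠ 0)
    (hP : ∀ u v, schoutenW m μ G F y u v = schoutenW m μ G F y v u)
    (hW : ∀ u v w z, riemann G y u v w z = kulkarniNomizu (schoutenW m μ G F y) (G y) u v w z) :
    hessian G F y = -(F y • schoutenW m μ G F y + slopeW m μ G F y • G y) := by
  have hd' : (3 : ℝ) ≤ Module.finrank ℝ E := by exact_mod_cast hd
  have hn : (Module.finrank ℝ E + m - 2 : ℝ) ≠ 0 := by linarith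
  have h1 := ricci_eq_of_kulkarniNomizu hi hs hP hW
  have h2 : ∀ u v, (Module.finrank ℝ E + m - 2 : ℝ) * schoutenW m μ G F y u v =
      ricci G y u v - m / F y * hessian G F y u v - schoutenScalarW m μ G F y * G y u v := by
    intro u v
    have : schoutenW m μ G F y u v = (1 / (Module.finrank ℝ E + m - 2) : ℝ) *
      (ricci G y u v - m / F y * hessian G F y u v - schoutenScalarW m μ G F y * G y u v) := rfl
    rw [this, ← mul_assoc, mul_one_div_cancel hn, one_mul]
  ext u v
  have h3 := h2 u v
  rw [h1] at h3
  simp only [add_apply, smul_apply, smul_eq_mul, neg_apply, slopeW, traceDefectW] at h3 ⊢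
  field_simp
  field_simp at h3
  linear_combination h3

/-- The trace of the Hessian equation, compared with the definition of the weighted scalar
curvature. For `m = 1` it is empty, as `μ` enters none of the weighted curvatures. -/
theorem gradNormSq_of_kulkarniNomizu (hd : 3 ≤ Module.finrank ℝ E) (hm : 0 < m)
    (hi : (G y).IsInvertible) (hs : ∀ u v, G y u v = G y v u) (hF : F y ≠ 0)
    (hP : ∀ u v, schoutenW m μ G F y u v = schoutenW m μ G F y v u)
    (hW : ∀ u v w z, riemann G y u v w z = kulkarniNomizu (schoutenW m μ G F y) (G y) u v w z) :
    (m - 1) * (2 * F y * slopeW m μ G F y + gradNormSq G F y - μ) = 0 := by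
  have hd' : (3 : ℝ) ≤ Module.finrank ℝ E := by exact_mod_cast hd
  have hn : (2 * (Module.finrank ℝ E + m - 1) : ℝ) ≠ 0 := by linarith
  set p := metricTrace (G y) (schoutenW m μ G F y) with hp
  set n : ℝ := (Module.finrank ℝ E : ℝ) with hn'
  set Y := traceDefectW m μ G F y with hY
  have h1 : scalarCurvature G y = 2 * (n - 1) * p := by
    rw [scalarCurvature, ricci_eq_of_kulkarniNomizu hi hs hP hW, metricTrace_add,
      metricTrace_smul, metricTrace_smul, metricTrace_self hi]
    ring
  have h2 : laplacian G F y = -(F y * p + F y / m * Y * n) := by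
    rw [laplacian, hessian_eq_of_kulkarniNomizu hd hm hi hs hF hP hW, ← neg_one_smul ℝ,
      metricTrace_smul, metricTrace_add, metricTrace_smul, metricTrace_smul, metricTrace_self hi,
      slopeW]
    ring
  have h3 : scalarW m μ G F y = 2 * (n + m - 1) * (Y + p) := by
    have : Y = 1 / (2 * (n + m - 1)) * scalarW m μ G F y - p := rfl
    rw [this, sub_add_cancel, ← mul_assoc, mul_one_div_cancel hn, one_mul]
  rw [scalarW, h1, h2] at h3
  rw [slopeW]
  field_simp at h3 ⊢
  linear_combination (-1) * h3

/-- Along a solution of `∇²f + f P + u g = 0` with `Rm = P ∧ g` and `P` Codazzi, the Ricci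
identity for `∇³f` gives `du = P(∇f, ·)`. -/
theorem fderiv_slope_eq (hd : 3 ≤ Module.finrank ℝ E)
    (hG : ContDiffAt ℝ ∞ G y) (hpos : ∀ v, v ≠ 0 → 0 < G y v v) (hi : (G y).IsInvertible)
    (hs : ∀ᶠ z in 𝓝 y, ∀ u v, G z u v = G z v u)
    (hFs : ContDiffAt ℝ ∞ F y) (hU : DifferentiableAt ℝ U y) (hPd : DifferentiableAt ℝ P y)
    (hW : ∀ u v w z, riemann G y u v w z = kulkarniNomizu (P y) (G y) u v w z)
    (hC : ∀ u v w, covDeriv G P y u v w = covDeriv G P y v u w)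
    (hH : ∀ᶠ z in 𝓝 y, hessian G F z = -(F z • P z + U z • G z)) (v : E) :
    fderiv ℝ U y v = fderiv ℝ F y (raise (G y) (P y) v) := by
  have := FiniteDimensional.complete ℝ E
  have hsy := hs.self_of_nhds
  have hΓ := (contDiffAt_christoffel hG hi).differentiableAt (by simp)
  have hGd := hG.differentiableAt (by simp)
  have hF' := contDiffAt_fderiv hFs
  have hFd := hFs.differentiableAt (by simp)
  have hFd' := hF'.differentiableAt (by simp)
  have hFd'' := (contDiffAt_fderiv hF').differentiableAt (by simp)
  have hc : ∀ x : E, DifferentiableAt ℝ (fun _ : E => x) y := fun _ => differentiableAt_const _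
  have hH1 : ∀ u w, fderiv ℝ (fderiv ℝ F) y u w =
      fderiv ℝ F y (christoffel G y u w) - (F y * P y u w + U y * G y u w) := by
    intro u w
    have h1 : hessian G F y u w =
      fderiv ℝ (fderiv ℝ F) y u w - fderiv ℝ F y (christoffel G y u w) := rfl
    have h2 := hH.self_of_nhds
    rw [h2] at h1
    simp only [neg_apply, add_apply, smul_apply, smul_eq_mul] at h1
    linarith
  -- the derivative of the Hessian equation in the direction `x`
  have hH2 : ∀ x u w, fderiv ℝ (fderiv ℝ (fderiv ℝ F)) y x u w =
      fderiv ℝ (fderiv ℝ F) y x (christoffel G y u w)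
        + fderiv ℝ F y (fderiv ℝ (christoffel G) y x u w)
        - (fderiv ℝ F y x * P y u w + F y * fderiv ℝ P y x u w
          + (fderiv ℝ U y x * G y u w + U y * fderiv ℝ G y x u w)) := by
    intro x u w
    have h1 : (fun z => fderiv ℝ (fderiv ℝ F) z u w) =ᶠ[𝓝 y] fun z =>
        fderiv ℝ F z (christoffel G z u w) - (F z * P z u w + U z * G z u w) := by
      filter_upwards [hH] with z hz
      have h1 : hessian G F z u w =
        fderiv ℝ (fderiv ℝ F) z u w - fderiv ℝ F z (christoffel G z u w) := rfl
      rw [hz] at h1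
      simp only [neg_apply, add_apply, smul_apply, smul_eq_mul] at h1
      linarith
    have hΓa := (hΓ.clm_apply (hc u)).clm_apply (hc w)
    have hPa := (hPd.clm_apply (hc u)).clm_apply (hc w)
    have hGa := (hGd.clm_apply (hc u)).clm_apply (hc w)
    have h2 := DFunLike.congr_fun (h1.fderiv_eq (𝕜 := ℝ)) x
    rw [fderiv_apply₂_const hFd'', fderiv_fun_sub (hFd'.clm_apply hΓa)
      ((hFd.fun_mul hPa).fun_add (hU.fun_mul hGa)),
      fderiv_fun_add (hFd.fun_mul hPa) (hU.fun_mul hGa),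
      fderiv_fun_mul hFd hPa, fderiv_fun_mul hU hGa, sub_apply, fderiv_apply_field hFd' hΓa,
      fderiv_apply₂_const hΓ] at h2
    simp only [add_apply, smul_apply, smul_eq_mul, fderiv_apply₂_const hPd,
      fderiv_apply₂_const hGd] at h2
    rw [h2]
    ring
  -- antisymmetrize in `x, u`: since `Rm = P ∧ g` and `P` is Codazzi, the form
  -- `β = dU - P(∇F, ·)` satisfies `β(x) g(u, w) = β(u) g(x, w)`, which forces `β = 0`
  have key : ∀ x u w, (fderiv ℝ U y x - fderiv ℝ F y (raise (G y) (P y) x)) * G y u w =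
      (fderiv ℝ U y u - fderiv ℝ F y (raise (G y) (P y) u)) * G y x w := by
    intro x u w
    have h1 : fderiv ℝ (fderiv ℝ (fderiv ℝ F)) y x u w =
        fderiv ℝ (fderiv ℝ (fderiv ℝ F)) y u x w := by
      rw [fderiv_fderiv_symm hF' (by norm_cast)]
    have h2 := congrArg (fderiv ℝ F y) (curvature_eq_of_kulkarniNomizu hi hW x u w)
    rw [curvature_apply] at h2
    simp only [map_sub, map_add, map_smul, smul_eq_mul] at h2
    have h3 := hC x u w
    rw [covDeriv, covDeriv, christoffel_symm hGd hs u x] at h3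
    rw [hH2, hH2, hH1, hH1, fderiv_metric_eq hGd hi hs, fderiv_metric_eq hGd hi hs,
      christoffel_symm hGd hs u x] at h1
    linear_combination (-1) * h1 + h2 - F y * h3
  rcases eq_or_ne v 0 with rfl | hv
  · simp
  obtain ⟨w, hw, hwv, -⟩ := exists_ne_zero_orthogonal₂ (G y) hd v v
  have h1 := key v w w
  rw [hsy v w, hwv, mul_zero] at h1
  rcases mul_eq_zero.1 h1 with h | h
  · linarith
  · exact absurd h (hpos w hw).ne'

end FlatDensity

/-! ### The ambient metric in coordinates -/

section AmbientForms

variable {E : Type*} [NormedAddCommGroup E] [NormedSpace ℝ E]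

/-- The form `2 ρ dt² + 2 t dρ dt + t² K` on `ℝ × E × ℝ`.  For `t = 1` and `ρ = 0` this is the
tractor metric `(a, ξ, b) ↦ 2 a b + K(ξ, ξ)`. -/
def straightForm (t ρ : ℝ) (K : E →L[ℝ] E →L[ℝ] ℝ) :
    (ℝ × E × ℝ) →L[ℝ] (ℝ × E × ℝ) →L[ℝ] ℝ :=
  let dt : (ℝ × E × ℝ) →L[ℝ] ℝ := ContinuousLinearMap.fst ℝ ℝ (E × ℝ)
  let dx : (ℝ × E × ℝ) →L[ℝ] E :=
    (ContinuousLinearMap.fst ℝ E ℝ).comp (ContinuousLinearMap.snd ℝ ℝ (E × ℝ))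
  let dρ : (ℝ × E × ℝ) →L[ℝ] ℝ :=
    (ContinuousLinearMap.snd ℝ E ℝ).comp (ContinuousLinearMap.snd ℝ ℝ (E × ℝ))
  (2 * ρ) • dt.smulRight dt + t • (dt.smulRight dρ + dρ.smulRight dt)
    + t ^ 2 • K.bilinearComp dx dx

theorem straightForm_apply (t ρ : ℝ) (K : E →L[ℝ] E →L[ℝ] ℝ) (X Z : ℝ × E × ℝ) :
    straightForm t ρ K X Z = 2 * ρ * (X.1 * Z.1) + t * (X.1 * Z.2.2 + X.2.2 * Z.1)
      + t ^ 2 * K X.2.1 Z.2.1 := rfl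

/-- The form `g_ρ = g + 2 ρ P + ρ² P²`, where `P²(u, v) = P(u, P v)` with an index raised. -/
def quadraticForm (g P : E →L[ℝ] E →L[ℝ] ℝ) (ρ : ℝ) : E →L[ℝ] E →L[ℝ] ℝ :=
  g + (2 * ρ) • P + ρ ^ 2 • (((raise g P).precomp ℝ).comp P)

theorem quadraticForm_apply {g P : E →L[ℝ] E →L[ℝ] ℝ} (hi : g.IsInvertible)
    (hs : ∀ u v, g u v = g v u) (hP : ∀ u v, P u v = P v u) (ρ : ℝ) (u v : E) :
    quadraticForm g P ρ u v = g (u + ρ • raise g P u) (v + ρ • raise g P v) := by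
  have h : quadraticForm g P ρ u v = g u v + 2 * ρ * P u v + ρ ^ 2 * P u (raise g P v) := rfl
  rw [h]
  simp only [map_add, map_smul, add_apply, smul_apply, smul_eq_mul, metric_raise hi]
  rw [hs u (raise g P v), metric_raise hi, hP v u]
  ring

/-- The coframe `dt, (t + t ρ A) dx, d(t ρ)`, in which the ambient connection is the tractor
connection, as the map from coordinate vectors to frame vectors; `A` is `P` with an index
raised. -/
def ambientFrame (A : E →L[ℝ] E) (t ρ : ℝ) : (ℝ × E × ℝ) →L[ℝ] (ℝ × E × ℝ) :=
  let dt : (ℝ × E × ℝ) →L[ℝ] ℝ := ContinuousLinearMap.fst ℝ ℝ (E × ℝ)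
  let dx : (ℝ × E × ℝ) →L[ℝ] E :=
    (ContinuousLinearMap.fst ℝ E ℝ).comp (ContinuousLinearMap.snd ℝ ℝ (E × ℝ))
  let dρ : (ℝ × E × ℝ) →L[ℝ] ℝ :=
    (ContinuousLinearMap.snd ℝ E ℝ).comp (ContinuousLinearMap.snd ℝ ℝ (E × ℝ))
  dt.prod (((t • ContinuousLinearMap.id ℝ E + (t * ρ) • A).comp dx).prod (ρ • dt + t • dρ))

theorem ambientFrame_apply (A : E →L[ℝ] E) (t ρ : ℝ) (X : ℝ × E × ℝ) :
    ambientFrame A t ρ X =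
      (X.1, t • X.2.1 + (t * ρ) • A X.2.1, ρ * X.1 + t * X.2.2) := rfl

/-- The ambient frame maps the ambient metric to the tractor metric. -/
theorem straightForm_eq_frame {g P : E →L[ℝ] E →L[ℝ] ℝ} (hi : g.IsInvertible)
    (hs : ∀ u v, g u v = g v u) (hP : ∀ u v, P u v = P v u) (t ρ : ℝ) (X Z : ℝ × E × ℝ) :
    straightForm t ρ (quadraticForm g P ρ) X Z =
      straightForm 1 0 g (ambientFrame (raise g P) t ρ X) (ambientFrame (raise g P) t ρ Z) := by
  have h : ∀ u : E, t • u + (t * ρ) • raise g P u = t • (u + ρ • raise g P u) := fun u => by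
    rw [smul_add, smul_smul]
  simp only [straightForm_apply, ambientFrame_apply, h, quadraticForm_apply hi hs hP, map_smul,
    smul_apply, smul_eq_mul]
  ring

theorem straightForm_nondegenerate {t ρ : ℝ} {K : E →L[ℝ] E →L[ℝ] ℝ} (ht : t ≠ 0)
    (hK : ∀ v, v ≠ 0 → 0 < K v v) (X : ℝ × E × ℝ) (h : ∀ Z, straightForm t ρ K X Z = 0) :
    X = 0 := by
  obtain ⟨a, ξ, b⟩ := X
  have h1 := h (0, 0, 1)
  have h2 := h (0, ξ, 0)
  have h3 := h (1, 0, 0)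
  simp only [straightForm_apply, mul_zero, mul_one, add_zero, zero_add, map_zero, mul_eq_zero,
    ht, false_or, pow_eq_zero_iff, ne_eq, OfNat.ofNat_ne_zero, not_false_eq_true] at h1 h2
  subst h1
  have hξ : ξ = 0 := by
    by_contra h0
    exact (hK ξ h0).ne' h2
  subst hξ
  simp [straightForm_apply, ht] at h3
  simp [h3]

theorem ambientFrame_injective {g P : E →L[ℝ] E →L[ℝ] ℝ} (hi : g.IsInvertible)
    (hs : ∀ u v, g u v = g v u) (hP : ∀ u v, P u v = P v u) {t ρ : ℝ} (ht : t ≠ 0)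
    (hK : ∀ v, v ≠ 0 → 0 < quadraticForm g P ρ v v) :
    Function.Injective (ambientFrame (raise g P) t ρ) := by
  refine (injective_iff_map_eq_zero _).2 fun X hX => ?_
  refine straightForm_nondegenerate (ρ := ρ) ht hK X fun Z => ?_
  rw [straightForm_eq_frame hi hs hP, hX, map_zero, zero_apply]

variable [FiniteDimensional ℝ E]

/-- The connection form of the tractor connection,
`κ(η) (a, ξ, b) = (-P(η, ξ), Γ(η, ξ) + a η + b A η, -g(η, ξ))`. It is written as a form on
`ℝ × E × ℝ` which only depends on the component `η` in `E`, i.e. as the pullback to the ambient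
space. -/
def tractorConnection (Γ : E →L[ℝ] E →L[ℝ] E) (g P : E →L[ℝ] E →L[ℝ] ℝ) (A : E →L[ℝ] E) :
    (ℝ × E × ℝ) →L[ℝ] (ℝ × E × ℝ) →L[ℝ] (ℝ × E × ℝ) :=
  LinearMap.toContinuousBilinearMap <|
    LinearMap.mk₂ ℝ (fun U X : ℝ × E × ℝ =>
        ((-P U.2.1 X.2.1, Γ U.2.1 X.2.1 + X.1 • U.2.1 + X.2.2 • A U.2.1, -g U.2.1 X.2.1) :
          ℝ × E × ℝ))
      (fun U U' X => by
        refine Prod.ext ?_ (Prod.ext ?_ ?_) <;> simp [add_comm, add_left_comm, add_assoc])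
      (fun c U X => by
        refine Prod.ext ?_ (Prod.ext ?_ ?_) <;> simp [smul_smul, mul_comm])
      (fun U X X' => by
        refine Prod.ext ?_ (Prod.ext ?_ ?_) <;>
          simp [add_comm, add_left_comm, add_assoc, add_smul])
      (fun c U X => by
        refine Prod.ext ?_ (Prod.ext ?_ ?_) <;> simp [smul_smul])

theorem tractorConnection_apply (Γ : E →L[ℝ] E →L[ℝ] E) (g P : E →L[ℝ] E →L[ℝ] ℝ)
    (A : E →L[ℝ] E) (U X : ℝ × E × ℝ) :
    tractorConnection Γ g P A U X =
      (-P U.2.1 X.2.1, Γ U.2.1 X.2.1 + X.1 • U.2.1 + X.2.2 • A U.2.1, -g U.2.1 X.2.1) := rfl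

variable {X : Type*} [NormedAddCommGroup X] [NormedSpace ℝ X] {x : X} {n : WithTop ℕ∞}

theorem contDiffAt_straightForm {t ρ : X → ℝ} {K : X → E →L[ℝ] E →L[ℝ] ℝ}
    (ht : ContDiffAt ℝ n t x) (hρ : ContDiffAt ℝ n ρ x) (hK : ContDiffAt ℝ n K x) :
    ContDiffAt ℝ n (fun z => straightForm (t z) (ρ z) (K z)) x := by
  refine contDiffAt_clm_of_apply fun u => contDiffAt_clm_of_apply fun v => ?_
  simp only [straightForm_apply]
  have hKa := (hK.clm_apply (contDiffAt_const (c := u.2.1))).clm_apply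
    (contDiffAt_const (c := v.2.1))
  fun_prop

theorem contDiffAt_ambientFrame {t ρ : X → ℝ} {A : X → E →L[ℝ] E}
    (ht : ContDiffAt ℝ n t x) (hρ : ContDiffAt ℝ n ρ x) (hA : ContDiffAt ℝ n A x) :
    ContDiffAt ℝ n (fun z => ambientFrame (A z) (t z) (ρ z)) x := by
  refine contDiffAt_clm_of_apply fun u => ?_
  simp only [ambientFrame_apply]
  have hAa := hA.clm_apply (contDiffAt_const (c := u.2.1))
  fun_prop

theorem contDiffAt_tractorConnection {Γ : X → E →L[ℝ] E →L[ℝ] E} {g P : X → E →L[ℝ] E →L[ℝ] ℝ}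
    {A : X → E →L[ℝ] E} (hΓ : ContDiffAt ℝ n Γ x) (hg : ContDiffAt ℝ n g x)
    (hP : ContDiffAt ℝ n P x) (hA : ContDiffAt ℝ n A x) :
    ContDiffAt ℝ n (fun z => tractorConnection (Γ z) (g z) (P z) (A z)) x := by
  refine contDiffAt_clm_of_apply fun u => contDiffAt_clm_of_apply fun v => ?_
  simp only [tractorConnection_apply]
  have h1 := (hΓ.clm_apply (contDiffAt_const (c := u.2.1))).clm_apply
    (contDiffAt_const (c := v.2.1))
  have h2 := (hg.clm_apply (contDiffAt_const (c := u.2.1))).clm_apply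
    (contDiffAt_const (c := v.2.1))
  have h3 := (hP.clm_apply (contDiffAt_const (c := u.2.1))).clm_apply
    (contDiffAt_const (c := v.2.1))
  have h4 := hA.clm_apply (contDiffAt_const (c := u.2.1))
  fun_prop

theorem contDiffAt_raise {g P : X → E →L[ℝ] E →L[ℝ] ℝ} (hg : ContDiffAt ℝ n g x)
    (hi : (g x).IsInvertible) (hP : ContDiffAt ℝ n P x) :
    ContDiffAt ℝ n (fun z => raise (g z) (P z)) x := by
  have := FiniteDimensional.complete ℝ E
  exact (contDiffAt_inverse_field hg hi).clm_comp hP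

theorem contDiffAt_quadraticForm {g P : X → E →L[ℝ] E →L[ℝ] ℝ} {ρ : X → ℝ}
    (hg : ContDiffAt ℝ n g x) (hi : (g x).IsInvertible) (hP : ContDiffAt ℝ n P x)
    (hρ : ContDiffAt ℝ n ρ x) :
    ContDiffAt ℝ n (fun z => quadraticForm (g z) (P z) (ρ z)) x := by
  refine contDiffAt_clm_of_apply fun u => contDiffAt_clm_of_apply fun v => ?_
  change ContDiffAt ℝ n (fun z => g z u v + 2 * ρ z * P z u v
    + ρ z ^ 2 * P z u (raise (g z) (P z) v)) x
  have hA := contDiffAt_raise hg hi hP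
  have h1 := (hg.clm_apply (contDiffAt_const (c := u))).clm_apply (contDiffAt_const (c := v))
  have h2 := (hP.clm_apply (contDiffAt_const (c := u))).clm_apply (contDiffAt_const (c := v))
  have h3 := (hP.clm_apply (contDiffAt_const (c := u))).clm_apply
    (hA.clm_apply (contDiffAt_const (c := v)))
  fun_prop

end AmbientForms

/-! ### The ambient connection and its curvature -/

section AmbientConnection

variable {E : Type*} [NormedAddCommGroup E] [NormedSpace ℝ E]
variable {G P : E → E →L[ℝ] E →L[ℝ] ℝ}

theorem contDiffAt_pullback_base {X : Type*} [NormedAddCommGroup X] [NormedSpace ℝ X]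
    {n : WithTop ℕ∞} {T : E → X} {p : ℝ × E × ℝ} (hT : ContDiffAt ℝ n T p.2.1) :
    ContDiffAt ℝ n (fun q : ℝ × E × ℝ => T q.2.1) p :=
  ContDiffAt.comp p (f := fun q : ℝ × E × ℝ => q.2.1) hT (by fun_prop)

theorem hasFDerivAt_pullback_base {X : Type*} [NormedAddCommGroup X] [NormedSpace ℝ X]
    {T : E → X} {p : ℝ × E × ℝ} (hT : DifferentiableAt ℝ T p.2.1) :
    HasFDerivAt (fun q : ℝ × E × ℝ => T q.2.1) ((fderiv ℝ T p.2.1).comp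
      ((ContinuousLinearMap.fst ℝ E ℝ).comp (ContinuousLinearMap.snd ℝ ℝ (E × ℝ)))) p :=
  HasFDerivAt.comp p (f := fun q : ℝ × E × ℝ => q.2.1) hT.hasFDerivAt
    ((ContinuousLinearMap.fst ℝ E ℝ).comp (ContinuousLinearMap.snd ℝ ℝ (E × ℝ))).hasFDerivAt

theorem fderiv_pullback_base {X : Type*} [NormedAddCommGroup X] [NormedSpace ℝ X]
    {T : E → X} {p : ℝ × E × ℝ} (hT : DifferentiableAt ℝ T p.2.1) (U : ℝ × E × ℝ) :
    fderiv ℝ (fun q : ℝ × E × ℝ => T q.2.1) p U = fderiv ℝ T p.2.1 U.2.1 := by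
  rw [(hasFDerivAt_pullback_base hT).fderiv]; rfl

theorem fderiv_radial {p : ℝ × E × ℝ} (U : ℝ × E × ℝ) :
    fderiv ℝ (fun q : ℝ × E × ℝ => q.1) p U = U.1 := by
  have h := (ContinuousLinearMap.fst ℝ ℝ (E × ℝ)).hasFDerivAt (x := p)
  exact DFunLike.congr_fun h.fderiv U

theorem fderiv_defining {p : ℝ × E × ℝ} (U : ℝ × E × ℝ) :
    fderiv ℝ (fun q : ℝ × E × ℝ => q.2.2) p U = U.2.2 := by
  have h := ((ContinuousLinearMap.snd ℝ E ℝ).comp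
    (ContinuousLinearMap.snd ℝ ℝ (E × ℝ))).hasFDerivAt (x := p)
  exact DFunLike.congr_fun h.fderiv U

theorem fderiv_prod_apply {X Y Z : Type*} [NormedAddCommGroup X] [NormedSpace ℝ X]
    [NormedAddCommGroup Y] [NormedSpace ℝ Y] [NormedAddCommGroup Z] [NormedSpace ℝ Z]
    {a : X → Y} {b : X → Z} {x : X} (ha : DifferentiableAt ℝ a x) (hb : DifferentiableAt ℝ b x)
    (u : X) : fderiv ℝ (fun z => (a z, b z)) x u = (fderiv ℝ a x u, fderiv ℝ b x u) := by
  rw [(ha.hasFDerivAt.prodMk hb.hasFDerivAt).fderiv]; rfl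

variable [FiniteDimensional ℝ E]

theorem fderiv_straightForm {p : ℝ × E × ℝ} (hG : ContDiffAt ℝ 1 G p.2.1)
    (U X Z : ℝ × E × ℝ) :
    fderiv ℝ (fun q : ℝ × E × ℝ => straightForm 1 0 (G q.2.1)) p U X Z =
      fderiv ℝ G p.2.1 U.2.1 X.2.1 Z.2.1 := by
  have hG' := (contDiffAt_pullback_base hG).differentiableAt one_ne_zero
  have h := (contDiffAt_straightForm (contDiffAt_const (c := (1 : ℝ)))
    (contDiffAt_const (c := (0 : ℝ))) (contDiffAt_pullback_base hG)).differentiableAt one_ne_zero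
  rw [← fderiv_apply₂_const h]
  simp only [straightForm_apply, one_pow, one_mul]
  rw [fderiv_const_add, fderiv_apply₂_const hG',
    fderiv_pullback_base (hG.differentiableAt one_ne_zero)]

theorem fderiv_ambientFrame {A : E → E →L[ℝ] E} {p : ℝ × E × ℝ} (hA : ContDiffAt ℝ 1 A p.2.1)
    (U Z : ℝ × E × ℝ) :
    fderiv ℝ (fun q : ℝ × E × ℝ => ambientFrame (A q.2.1) q.1 q.2.2) p U Z =
      (0, U.1 • Z.2.1 + (U.1 * p.2.2 + p.1 * U.2.2) • A p.2.1 Z.2.1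
        + (p.1 * p.2.2) • fderiv ℝ A p.2.1 U.2.1 Z.2.1, U.2.2 * Z.1 + U.1 * Z.2.2) := by
  have hA' := (contDiffAt_pullback_base hA).differentiableAt one_ne_zero
  have h := (contDiffAt_ambientFrame (x := p) (t := fun q : ℝ × E × ℝ => q.1)
    (ρ := fun q : ℝ × E × ℝ => q.2.2) (by fun_prop) (by fun_prop)
    (contDiffAt_pullback_base hA)).differentiableAt one_ne_zero
  have ht : DifferentiableAt ℝ (fun q : ℝ × E × ℝ => q.1) p := by fun_prop
  have hρ : DifferentiableAt ℝ (fun q : ℝ × E × ℝ => q.2.2) p := by fun_prop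
  have hAZ := hA'.clm_apply (differentiableAt_const Z.2.1)
  rw [← fderiv_apply_const h]
  simp only [ambientFrame_apply]
  have h1 : DifferentiableAt ℝ (fun q : ℝ × E × ℝ => q.1 • Z.2.1) p := by fun_prop
  have h2 : DifferentiableAt ℝ (fun q : ℝ × E × ℝ => q.1 * q.2.2) p := by fun_prop
  rw [fderiv_prod_apply (by fun_prop) (by fun_prop), fderiv_prod_apply (by fun_prop) (by fun_prop),
    fderiv_fun_add h1 (h2.fun_smul hAZ), fderiv_fun_smul h2 hAZ, fderiv_fun_mul ht hρ,
    fderiv_fun_add (by fun_prop) (by fun_prop), fderiv_mul_const hρ, fderiv_mul_const ht,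
    fderiv_smul_const ht]
  simp only [fderiv_fun_const, add_apply, smul_apply, ContinuousLinearMap.smulRight_apply,
    fderiv_radial, fderiv_defining, smul_eq_mul, fderiv_apply_const hA',
    fderiv_pullback_base (hA.differentiableAt one_ne_zero)]
  refine Prod.ext (by simp) (Prod.ext ?_ ?_)
  · simp only
    module
  · simp only
    ring

theorem fderiv_tractorConnection {Γ : E → E →L[ℝ] E →L[ℝ] E} {A : E → E →L[ℝ] E}
    {p : ℝ × E × ℝ} (hΓ : ContDiffAt ℝ 1 Γ p.2.1) (hG : ContDiffAt ℝ 1 G p.2.1)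
    (hP : ContDiffAt ℝ 1 P p.2.1) (hA : ContDiffAt ℝ 1 A p.2.1) (U V X : ℝ × E × ℝ) :
    fderiv ℝ (fun q : ℝ × E × ℝ =>
        tractorConnection (Γ q.2.1) (G q.2.1) (P q.2.1) (A q.2.1)) p U V X =
      (-fderiv ℝ P p.2.1 U.2.1 V.2.1 X.2.1, fderiv ℝ Γ p.2.1 U.2.1 V.2.1 X.2.1
        + X.2.2 • fderiv ℝ A p.2.1 U.2.1 V.2.1, -fderiv ℝ G p.2.1 U.2.1 V.2.1 X.2.1) := by
  have hA' := (contDiffAt_pullback_base hA).differentiableAt one_ne_zero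
  have hP' := (contDiffAt_pullback_base hP).differentiableAt one_ne_zero
  have hG' := (contDiffAt_pullback_base hG).differentiableAt one_ne_zero
  have hΓ' := (contDiffAt_pullback_base hΓ).differentiableAt one_ne_zero
  have h := (contDiffAt_tractorConnection (contDiffAt_pullback_base hΓ)
    (contDiffAt_pullback_base hG) (contDiffAt_pullback_base hP)
    (contDiffAt_pullback_base hA)).differentiableAt one_ne_zero
  have hAV := hA'.clm_apply (differentiableAt_const V.2.1)
  have hPV := (hP'.clm_apply (differentiableAt_const V.2.1)).clm_apply
    (differentiableAt_const X.2.1)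
  have hGV := (hG'.clm_apply (differentiableAt_const V.2.1)).clm_apply
    (differentiableAt_const X.2.1)
  have hΓV := (hΓ'.clm_apply (differentiableAt_const V.2.1)).clm_apply
    (differentiableAt_const X.2.1)
  rw [← fderiv_apply₂_const h]
  simp only [tractorConnection_apply]
  rw [fderiv_prod_apply (by fun_prop) (by fun_prop), fderiv_prod_apply (by fun_prop) (by fun_prop),
    fderiv_fun_add (by fun_prop) (by fun_prop), fderiv_fun_add (by fun_prop) (by fun_prop),
    fderiv_fun_neg, fderiv_fun_neg, fderiv_fun_const_smul hAV]
  simp only [fderiv_fun_const, add_apply, smul_apply, neg_apply, fderiv_apply_const hA',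
    fderiv_apply₂_const hP', fderiv_apply₂_const hG', fderiv_apply₂_const hΓ',
    fderiv_pullback_base (hA.differentiableAt one_ne_zero),
    fderiv_pullback_base (hP.differentiableAt one_ne_zero),
    fderiv_pullback_base (hG.differentiableAt one_ne_zero),
    fderiv_pullback_base (hΓ.differentiableAt one_ne_zero)]
  simp

/-- `∇_u P(v, w) = g((∇_u A) v, w)` for `P = g(A ·, ·)`. -/
theorem covDeriv_eq_raise {y : E} (hG : ContDiffAt ℝ 1 G y) (hP : ContDiffAt ℝ 1 P y)
    (hi : ∀ᶠ z in 𝓝 y, (G z).IsInvertible) (hs : ∀ᶠ z in 𝓝 y, ∀ u v, G z u v = G z v u)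
    (u v w : E) :
    covDeriv G P y u v w = G y (fderiv ℝ (fun z => raise (G z) (P z)) y u v
      + christoffel G y u (raise (G y) (P y) v)
      - raise (G y) (P y) (christoffel G y u v)) w := by
  have hiy := hi.self_of_nhds
  have hGd := hG.differentiableAt one_ne_zero
  have hA := (contDiffAt_raise hG hiy hP).differentiableAt one_ne_zero
  have h1 : (fun z => P z v w) =ᶠ[𝓝 y] fun z => G z (raise (G z) (P z) v) w := by
    filter_upwards [hi] with z hz using (metric_raise hz _ _ _).symm
  have h2 := fderiv_apply₂_const (hP.differentiableAt one_ne_zero) v w u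
  rw [h1.fderiv_eq,
      fderiv_apply₂_field hGd (hA.clm_apply (differentiableAt_const v)) (differentiableAt_const w),
      fderiv_apply_const hA, fderiv_metric_eq hGd hiy hs] at h2
  rw [covDeriv, ← h2]
  simp only [map_sub, map_add, sub_apply, add_apply, metric_raise hiy, fderiv_fun_const,
    zero_apply, map_zero, Pi.zero_apply]
  ring

/-- The pointwise conditions on a metric `G` and a Codazzi tensor `P` under which the tractor
connection is torsion-free in the ambient frame. -/
structure IsCodazziAt (G P : E → E →L[ℝ] E →L[ℝ] ℝ) (y : E) : Prop where
  smooth_metric : ContDiffAt ℝ 2 G y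
  smooth_form : ContDiffAt ℝ 1 P y
  invertible : ∀ᶠ z in 𝓝 y, (G z).IsInvertible
  symm_metric : ∀ᶠ z in 𝓝 y, ∀ u v, G z u v = G z v u
  symm_form : ∀ᶠ z in 𝓝 y, ∀ u v, P z u v = P z v u
  codazzi : ∀ u v w, covDeriv G P y u v w = covDeriv G P y v u w

/-- The Codazzi equation for `P` with an index raised; two terms cancel because the Christoffel
symbols are symmetric. -/
theorem IsCodazziAt.codazzi_raise {y : E} (h : IsCodazziAt G P y) (u v : E) :
    fderiv ℝ (fun z => raise (G z) (P z)) y u v + christoffel G y u (raise (G y) (P y) v) =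
      fderiv ℝ (fun z => raise (G z) (P z)) y v u
        + christoffel G y v (raise (G y) (P y) u) := by
  have hG1 : ContDiffAt ℝ 1 G y := h.smooth_metric.of_le (by norm_num)
  refine ext_of_metric h.invertible.self_of_nhds fun w => ?_
  have h1 := h.codazzi u v w
  rw [covDeriv_eq_raise hG1 h.smooth_form h.invertible h.symm_metric,
    covDeriv_eq_raise hG1 h.smooth_form h.invertible h.symm_metric,
    christoffel_symm (hG1.differentiableAt one_ne_zero) h.symm_metric v u] at h1
  simp only [map_sub, sub_apply] at h1
  linarith

/-- The ambient metric `2 ρ dt² + 2 t dρ dt + t² g_ρ` in coordinates `(t, y, ρ)`. -/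
def ambientMetric (G P : E → E →L[ℝ] E →L[ℝ] ℝ) (q : ℝ × E × ℝ) :
    (ℝ × E × ℝ) →L[ℝ] (ℝ × E × ℝ) →L[ℝ] ℝ :=
  straightForm q.1 q.2.2 (quadraticForm (G q.2.1) (P q.2.1) q.2.2)

/-- In the ambient frame the Levi-Civita connection of the ambient metric is the tractor
connection. -/
theorem isTorsionFreeFrame_ambient {p : ℝ × E × ℝ} (h : IsCodazziAt G P p.2.1)
    (hΘ : (ambientFrame (raise (G p.2.1) (P p.2.1)) p.1 p.2.2).IsInvertible)
    (hGt : (ambientMetric G P p).IsInvertible) :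
    IsTorsionFreeFrame (ambientMetric G P) (fun q => straightForm 1 0 (G q.2.1))
      (fun q => ambientFrame (raise (G q.2.1) (P q.2.1)) q.1 q.2.2)
      (fun q => tractorConnection (christoffel G q.2.1) (G q.2.1) (P q.2.1)
        (raise (G q.2.1) (P q.2.1))) p := by
  have hi := h.invertible.self_of_nhds
  have hs := h.symm_metric.self_of_nhds
  have hPs := h.symm_form.self_of_nhds
  have hG1 : ContDiffAt ℝ 1 G p.2.1 := h.smooth_metric.of_le (by norm_num)
  have hGd := hG1.differentiableAt one_ne_zero
  have hA := contDiffAt_raise hG1 hi h.smooth_form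
  have hbase : Tendsto (fun q : ℝ × E × ℝ => q.2.1) (𝓝 p) (𝓝 p.2.1) :=
    Continuous.tendsto (by fun_prop) p
  have hAs : ∀ u v, P p.2.1 u (raise (G p.2.1) (P p.2.1) v) =
      P p.2.1 v (raise (G p.2.1) (P p.2.1) u) := fun u v => by
    rw [← metric_raise hi (P p.2.1) u, ← metric_raise hi (P p.2.1) v, hs]
  have hGA : ∀ u v, G p.2.1 u (raise (G p.2.1) (P p.2.1) v) = P p.2.1 u v := fun u v => by
    rw [hs, metric_raise hi, hPs]
  -- the last two goals: the tractor connection is metric, and torsion-free in the frame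
  refine ⟨?_, ?_, ?_, ?_, ?_, ?_, ?_, hΘ, hGt⟩
  · filter_upwards [hbase.eventually h.invertible, hbase.eventually h.symm_metric,
      hbase.eventually h.symm_form] with q h1 h2 h3 X Z
    exact straightForm_eq_frame h1 h2 h3 _ _ _ _
  · exact (contDiffAt_straightForm (t := fun q : ℝ × E × ℝ => q.1)
      (ρ := fun q : ℝ × E × ℝ => q.2.2) (by fun_prop) (by fun_prop)
      (contDiffAt_quadraticForm (contDiffAt_pullback_base hG1) hi
        (contDiffAt_pullback_base h.smooth_form) (by fun_prop))).differentiableAt one_ne_zero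
  · exact (contDiffAt_straightForm contDiffAt_const contDiffAt_const
      (contDiffAt_pullback_base hG1)).differentiableAt one_ne_zero
  · exact (contDiffAt_ambientFrame (t := fun q : ℝ × E × ℝ => q.1)
      (ρ := fun q : ℝ × E × ℝ => q.2.2) (by fun_prop) (by fun_prop)
      (contDiffAt_pullback_base (T := fun z => raise (G z) (P z)) hA)).differentiableAt one_ne_zero
  · intro X Z
    rw [straightForm_apply, straightForm_apply, hs]
    ring
  · intro U X Z
    rw [fderiv_straightForm hG1, fderiv_metric_eq hGd hi h.symm_metric]
    simp only [straightForm_apply, tractorConnection_apply, map_add, map_smul, add_apply,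
      smul_apply, smul_eq_mul, metric_raise hi, hs X.2.1 (raise _ _ _), hPs U.2.1,
      hs U.2.1]
    ring
  · intro U Z
    rw [fderiv_ambientFrame (A := fun z => raise (G z) (P z)) hA,
      fderiv_ambientFrame (A := fun z => raise (G z) (P z)) hA]
    simp only [tractorConnection_apply, ambientFrame_apply, Prod.mk_add_mk, map_add, map_smul]
    refine Prod.ext ?_ (Prod.ext ?_ ?_)
    · simp only [smul_eq_mul, hAs U.2.1 Z.2.1, hPs U.2.1 Z.2.1]
    · have h1 := h.codazzi_raise U.2.1 Z.2.1
      have h2 := christoffel_symm hGd h.symm_metric U.2.1 Z.2.1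
      simp only [h2]
      linear_combination (norm := module) (p.1 * p.2.2) • h1
    · simp only [smul_eq_mul, hGA, hs U.2.1 Z.2.1, hPs U.2.1 Z.2.1]
      ring

end AmbientConnection

section AmbientCurvature

variable {E : Type*} [NormedAddCommGroup E] [NormedSpace ℝ E]

theorem eventually_isInvertible {X Y Z : Type*} [TopologicalSpace X] [NormedAddCommGroup Y]
    [NormedSpace ℝ Y] [CompleteSpace Y] [NormedAddCommGroup Z] [NormedSpace ℝ Z]
    {T : X → Y →L[ℝ] Z} {x : X} (hT : ContinuousAt T x) (hi : (T x).IsInvertible) :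
    ∀ᶠ z in 𝓝 x, (T z).IsInvertible := by
  obtain ⟨e, he⟩ := hi
  have h := e.nhds
  rw [he] at h
  exact hT.eventually h

variable {F U : E → ℝ} {p : ℝ × E × ℝ}

/-- The density `t (f + ρ u)` in coordinates. -/
def ambientDensity (F U : E → ℝ) (q : ℝ × E × ℝ) : ℝ := q.1 * (F q.2.1 + q.2.2 * U q.2.1)

/-- The linear form `(x, ξ, z) ↦ a x + l(ξ) + b z` on tractors. For `(a, l, b) = (f, df, u)` it is
the differential of the ambient density in the ambient frame. -/
def densityForm (a : ℝ) (l : E →L[ℝ] ℝ) (b : ℝ) : (ℝ × E × ℝ) →L[ℝ] ℝ :=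
  a • ContinuousLinearMap.fst ℝ ℝ (E × ℝ)
    + l.comp ((ContinuousLinearMap.fst ℝ E ℝ).comp (ContinuousLinearMap.snd ℝ ℝ (E × ℝ)))
    + b • (ContinuousLinearMap.snd ℝ E ℝ).comp (ContinuousLinearMap.snd ℝ ℝ (E × ℝ))

theorem densityForm_apply (a : ℝ) (l : E →L[ℝ] ℝ) (b : ℝ) (X : ℝ × E × ℝ) :
    densityForm a l b X = a * X.1 + l X.2.1 + b * X.2.2 := rfl

theorem contDiffAt_ambientDensity (hF : ContDiffAt ℝ ∞ F p.2.1) (hU : ContDiffAt ℝ ∞ U p.2.1) :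
    ContDiffAt ℝ ∞ (ambientDensity F U) p := by
  have h1 := contDiffAt_pullback_base hF
  have h2 := contDiffAt_pullback_base hU
  unfold ambientDensity
  fun_prop

theorem fderiv_ambientDensity {A : E →L[ℝ] E} (hF : DifferentiableAt ℝ F p.2.1)
    (hU : DifferentiableAt ℝ U p.2.1)
    (hA : ∀ v, fderiv ℝ U p.2.1 v = fderiv ℝ F p.2.1 (A v)) (X : ℝ × E × ℝ) :
    fderiv ℝ (ambientDensity F U) p X =
      densityForm (F p.2.1) (fderiv ℝ F p.2.1) (U p.2.1) (ambientFrame A p.1 p.2.2 X) := by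
  have h1 := (hasFDerivAt_pullback_base hF).differentiableAt
  have h2 := (hasFDerivAt_pullback_base hU).differentiableAt
  have ht : DifferentiableAt ℝ (fun q : ℝ × E × ℝ => q.1) p := by fun_prop
  have hρ : DifferentiableAt ℝ (fun q : ℝ × E × ℝ => q.2.2) p := by fun_prop
  unfold ambientDensity
  rw [fderiv_fun_mul ht (h1.fun_add (hρ.fun_mul h2)), fderiv_fun_add h1 (hρ.fun_mul h2),
    fderiv_fun_mul hρ h2]
  simp only [add_apply, smul_apply, smul_eq_mul, fderiv_radial, fderiv_defining,
    fderiv_pullback_base hF, fderiv_pullback_base hU, hA, densityForm_apply, ambientFrame_apply,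
    map_add, map_smul]
  ring

variable {G P : E → E →L[ℝ] E →L[ℝ] ℝ}

/-- Smooth functions `F` and `U` near a point of the base with `dU = P(∇F, ·)`. -/
structure IsAmbientDensityPoint (G P : E → E →L[ℝ] E →L[ℝ] ℝ) (F U : E → ℝ) (y : E) : Prop where
  smooth_density : ContDiffAt ℝ ∞ F y
  smooth_slope : ContDiffAt ℝ ∞ U y
  fderiv_slope : ∀ᶠ z in 𝓝 y, ∀ v, fderiv ℝ U z v = fderiv ℝ F z (raise (G z) (P z) v)

theorem IsAmbientDensityPoint.fderiv_density (hF : IsAmbientDensityPoint G P F U p.2.1) :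
    ∀ᶠ q in 𝓝 p, ∀ X, fderiv ℝ (ambientDensity F U) q X =
      densityForm (F q.2.1) (fderiv ℝ F q.2.1) (U q.2.1)
        (ambientFrame (raise (G q.2.1) (P q.2.1)) q.1 q.2.2 X) := by
  have hbase : Tendsto (fun q : ℝ × E × ℝ => q.2.1) (𝓝 p) (𝓝 p.2.1) :=
    Continuous.tendsto (by fun_prop) p
  filter_upwards [hbase.eventually hF.fderiv_slope,
    hbase.eventually (eventually_differentiableAt hF.smooth_density),
    hbase.eventually (eventually_differentiableAt hF.smooth_slope)] with q h1 h2 h3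
  exact fderiv_ambientDensity h2 h3 h1

variable [FiniteDimensional ℝ E]

/-- A smooth metric `G` with a smooth Codazzi tensor `P` near a point of the base, such that at the
point `p` above it `t ≠ 0` and `g_ρ` is positive definite; in particular the ambient metric is
nondegenerate at `p`. -/
structure IsAmbientPoint (G P : E → E →L[ℝ] E →L[ℝ] ℝ) (p : ℝ × E × ℝ) : Prop where
  smooth_metric : ContDiffAt ℝ ∞ G p.2.1
  smooth_form : ContDiffAt ℝ ∞ P p.2.1
  codazzi : ∀ᶠ z in 𝓝 p.2.1, IsCodazziAt G P z
  radial_ne_zero : p.1 ≠ 0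
  pos : ∀ v, v ≠ 0 → 0 < quadraticForm (G p.2.1) (P p.2.1) p.2.2 v v

theorem IsAmbientPoint.contDiffAt_raise (h : IsAmbientPoint G P p) :
    ContDiffAt ℝ ∞ (fun z => raise (G z) (P z)) p.2.1 :=
  WeightedAmbient.contDiffAt_raise h.smooth_metric h.codazzi.self_of_nhds.invertible.self_of_nhds
    h.smooth_form

theorem contDiffAt_ambientMetric (hG : ContDiffAt ℝ ∞ G p.2.1) (hP : ContDiffAt ℝ ∞ P p.2.1)
    (hi : (G p.2.1).IsInvertible) : ContDiffAt ℝ ∞ (ambientMetric G P) p :=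
  contDiffAt_straightForm (t := fun q : ℝ × E × ℝ => q.1)
    (ρ := fun q : ℝ × E × ℝ => q.2.2) (by fun_prop) (by fun_prop)
    (contDiffAt_quadraticForm (contDiffAt_pullback_base hG) hi
      (contDiffAt_pullback_base hP) (by fun_prop))

theorem IsAmbientPoint.contDiffAt_metric (h : IsAmbientPoint G P p) :
    ContDiffAt ℝ ∞ (ambientMetric G P) p :=
  contDiffAt_ambientMetric h.smooth_metric h.smooth_form
    h.codazzi.self_of_nhds.invertible.self_of_nhds

theorem IsAmbientPoint.contDiffAt_frame (h : IsAmbientPoint G P p) :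
    ContDiffAt ℝ ∞ (fun q : ℝ × E × ℝ => ambientFrame (raise (G q.2.1) (P q.2.1)) q.1 q.2.2) p :=
  contDiffAt_ambientFrame (t := fun q : ℝ × E × ℝ => q.1)
    (ρ := fun q : ℝ × E × ℝ => q.2.2) (by fun_prop) (by fun_prop)
    (contDiffAt_pullback_base (T := fun z => raise (G z) (P z)) h.contDiffAt_raise)

theorem IsAmbientPoint.metric_invertible (h : IsAmbientPoint G P p) :
    (ambientMetric G P p).IsInvertible :=
  isInvertible_of_nondegenerate (straightForm_nondegenerate h.radial_ne_zero h.pos)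

theorem IsAmbientPoint.frame (h : IsAmbientPoint G P p) :
    ∀ᶠ q in 𝓝 p, IsTorsionFreeFrame (ambientMetric G P) (fun q => straightForm 1 0 (G q.2.1))
      (fun q => ambientFrame (raise (G q.2.1) (P q.2.1)) q.1 q.2.2)
      (fun q => tractorConnection (christoffel G q.2.1) (G q.2.1) (P q.2.1)
        (raise (G q.2.1) (P q.2.1))) q := by
  have := FiniteDimensional.complete ℝ (ℝ × E × ℝ)
  have hbase : Tendsto (fun q : ℝ × E × ℝ => q.2.1) (𝓝 p) (𝓝 p.2.1) :=
    Continuous.tendsto (by fun_prop) p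
  have h0 := h.codazzi.self_of_nhds
  have hΘ := isInvertible_of_injective (ambientFrame_injective h0.invertible.self_of_nhds
    h0.symm_metric.self_of_nhds h0.symm_form.self_of_nhds h.radial_ne_zero h.pos)
  filter_upwards [hbase.eventually h.codazzi,
    eventually_isInvertible h.contDiffAt_metric.continuousAt h.metric_invertible,
    eventually_isInvertible h.contDiffAt_frame.continuousAt hΘ] with q h1 h2 h3
  exact isTorsionFreeFrame_ambient h1 h3 h2

/-- The curvature of the ambient metric is that of the tractor connection, whose only component
is the "Weyl curvature" `Rm - P ∧ g`. -/
theorem IsAmbientPoint.curvature_eq (h : IsAmbientPoint G P p) (X Y Z : ℝ × E × ℝ) :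
    ambientFrame (raise (G p.2.1) (P p.2.1)) p.1 p.2.2 (curvature (ambientMetric G P) p Y Z X) =
      (0, curvature G p.2.1 Y.2.1
          (ambientFrame (raise (G p.2.1) (P p.2.1)) p.1 p.2.2 Z).2.1 X.2.1
        - (G p.2.1 Y.2.1 (ambientFrame (raise (G p.2.1) (P p.2.1)) p.1 p.2.2 Z).2.1
              • raise (G p.2.1) (P p.2.1) X.2.1
            + P p.2.1 Y.2.1 (ambientFrame (raise (G p.2.1) (P p.2.1)) p.1 p.2.2 Z).2.1 • X.2.1
            - P p.2.1 X.2.1 (ambientFrame (raise (G p.2.1) (P p.2.1)) p.1 p.2.2 Z).2.1 • Y.2.1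
            - G p.2.1 X.2.1 (ambientFrame (raise (G p.2.1) (P p.2.1)) p.1 p.2.2 Z).2.1
              • raise (G p.2.1) (P p.2.1) Y.2.1), 0) := by
  have := FiniteDimensional.complete ℝ E
  have := FiniteDimensional.complete ℝ (ℝ × E × ℝ)
  have h0 := h.codazzi.self_of_nhds
  have hi := h0.invertible.self_of_nhds
  have hs := h0.symm_metric.self_of_nhds
  have hPs := h0.symm_form.self_of_nhds
  have hGd := h.smooth_metric.differentiableAt (by simp)
  have hΓ := contDiffAt_christoffel h.smooth_metric hi
  have hAs : ∀ u v, P p.2.1 u (raise (G p.2.1) (P p.2.1) v) =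
      P p.2.1 v (raise (G p.2.1) (P p.2.1) u) := fun u v => by
    rw [← metric_raise hi (P p.2.1) u, ← metric_raise hi (P p.2.1) v, hs]
  have hGA : ∀ u v, G p.2.1 u (raise (G p.2.1) (P p.2.1) v) = P p.2.1 u v := fun u v => by
    rw [hs, metric_raise hi, hPs]
  have hle : (1 : WithTop ℕ∞) ≤ ∞ := by norm_cast
  rw [curvature_eq_of_frame h.frame (h.contDiffAt_frame.of_le (by norm_cast))
    ((contDiffAt_tractorConnection (contDiffAt_pullback_base hΓ)
      (contDiffAt_pullback_base h.smooth_metric) (contDiffAt_pullback_base h.smooth_form)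
      (contDiffAt_pullback_base (T := fun z => raise (G z) (P z))
        h.contDiffAt_raise)).differentiableAt (by simp))
    ((contDiffAt_christoffel h.contDiffAt_metric h.metric_invertible).differentiableAt (by simp))]
  generalize ambientFrame (raise (G p.2.1) (P p.2.1)) p.1 p.2.2 Z = z
  rw [fderiv_tractorConnection (A := fun z => raise (G z) (P z)) (hΓ.of_le hle)
      (h.smooth_metric.of_le hle) (h.smooth_form.of_le hle) (h.contDiffAt_raise.of_le hle),
    fderiv_tractorConnection (A := fun z => raise (G z) (P z)) (hΓ.of_le hle)
      (h.smooth_metric.of_le hle) (h.smooth_form.of_le hle) (h.contDiffAt_raise.of_le hle)]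
  obtain ⟨a, ξ, b⟩ := z
  have hC := h0.codazzi X.2.1 Y.2.1 ξ
  have hΓs := christoffel_symm hGd h0.symm_metric Y.2.1 X.2.1
  rw [covDeriv, covDeriv, hΓs] at hC
  have hA := h0.codazzi_raise X.2.1 Y.2.1
  simp only [tractorConnection_apply, Prod.mk_add_mk, Prod.mk_sub_mk]
  -- the first component is the Cotton tensor, the last one vanishes for any symmetric `P`
  refine Prod.ext ?_ (Prod.ext ?_ ?_)
  · simp only [map_add, map_smul, smul_eq_mul, hAs X.2.1 Y.2.1, hPs X.2.1 Y.2.1]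
    linear_combination (-1) * hC
  · simp only [curvature_apply, map_add, map_smul, hΓs]
    linear_combination (norm := module) b • hA
  · simp only [map_add, map_smul, smul_eq_mul, hGA, fderiv_metric_eq hGd hi h0.symm_metric, hΓs,
      hs X.2.1 Y.2.1, hPs X.2.1 Y.2.1]
    ring

theorem contDiffAt_densityForm {X : Type*} [NormedAddCommGroup X] [NormedSpace ℝ X] {x : X}
    {a b : X → ℝ} {l : X → E →L[ℝ] ℝ} (ha : ContDiffAt ℝ ∞ a x) (hl : ContDiffAt ℝ ∞ l x)
    (hb : ContDiffAt ℝ ∞ b x) : ContDiffAt ℝ ∞ (fun z => densityForm (a z) (l z) (b z)) x := by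
  refine contDiffAt_clm_of_apply fun v => ?_
  simp only [densityForm_apply]
  have := hl.clm_apply (contDiffAt_const (c := v.2.1))
  fun_prop

/-- The Hessian of the ambient density is that of the tractor `(f, ∇f, u)`, whose only component
is `∇²f + f P + u g`. -/
theorem IsAmbientPoint.hessian_eq (h : IsAmbientPoint G P p)
    (hF : IsAmbientDensityPoint G P F U p.2.1) (X Z : ℝ × E × ℝ) :
    hessian (ambientMetric G P) (ambientDensity F U) p X Z =
      (hessian G F p.2.1 + F p.2.1 • P p.2.1 + U p.2.1 • G p.2.1) X.2.1
        (ambientFrame (raise (G p.2.1) (P p.2.1)) p.1 p.2.2 Z).2.1 := by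
  have hFd' := contDiffAt_fderiv hF.smooth_density
  have hl := (contDiffAt_densityForm (contDiffAt_pullback_base hF.smooth_density)
    (contDiffAt_pullback_base hFd')
    (contDiffAt_pullback_base hF.smooth_slope)).differentiableAt (by simp)
  rw [h.frame.self_of_nhds.hessian_eq hl hF.fderiv_density
    ((contDiffAt_fderiv (contDiffAt_ambientDensity hF.smooth_density
      hF.smooth_slope)).differentiableAt (by simp))]
  generalize ambientFrame (raise (G p.2.1) (P p.2.1)) p.1 p.2.2 Z = z
  have hFp := (contDiffAt_pullback_base hF.smooth_density).differentiableAt (by simp)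
  have hUp := (contDiffAt_pullback_base hF.smooth_slope).differentiableAt (by simp)
  have hFp' := (contDiffAt_pullback_base hFd').differentiableAt (by simp)
  have hFpz := hFp'.clm_apply (differentiableAt_const z.2.1)
  rw [← fderiv_apply_const hl]
  simp only [densityForm_apply]
  rw [fderiv_fun_add ((hFp.mul_const _).fun_add hFpz) (hUp.mul_const _),
    fderiv_fun_add (hFp.mul_const _) hFpz, fderiv_mul_const hFp, fderiv_mul_const hUp]
  have hH : ∀ u w, hessian G F p.2.1 u w =
    fderiv ℝ (fderiv ℝ F) p.2.1 u w - fderiv ℝ F p.2.1 (christoffel G p.2.1 u w) := fun _ _ => rfl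
  simp only [add_apply, smul_apply, smul_eq_mul, fderiv_apply_const hFp',
    fderiv_pullback_base (hF.smooth_density.differentiableAt (by simp)),
    fderiv_pullback_base (hF.smooth_slope.differentiableAt (by simp)),
    fderiv_pullback_base (hFd'.differentiableAt (by simp)), tractorConnection_apply, hH,
    map_add, map_smul, hF.fderiv_slope.self_of_nhds]
  ring

theorem IsAmbientPoint.gradNormSq_eq (h : IsAmbientPoint G P p)
    (hF : IsAmbientDensityPoint G P F U p.2.1) :
    gradNormSq (ambientMetric G P) (ambientDensity F U) p =
      2 * F p.2.1 * U p.2.1 + gradNormSq G F p.2.1 := by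
  have hi := h.codazzi.self_of_nhds.invertible.self_of_nhds
  rw [h.frame.self_of_nhds.gradNormSq_eq hF.fderiv_density.self_of_nhds
    (X := (U p.2.1, (G p.2.1).inverse (fderiv ℝ F p.2.1), F p.2.1))]
  · rw [densityForm_apply, gradNormSq]
    ring
  · intro v
    rw [straightForm_apply, densityForm_apply]
    simp only [hi.self_apply_inverse]
    ring

end AmbientCurvature

/-! ### Vanishing of the weighted curvatures of the ambient metric -/

section AmbientFlatness

variable {E : Type*} [NormedAddCommGroup E] [NormedSpace ℝ E]

theorem bilin_ext {B B' : E →L[ℝ] E →L[ℝ] ℝ} (h : ∀ u v, B u v = B' u v) : B = B' :=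
  ContinuousLinearMap.ext fun u => ContinuousLinearMap.ext fun v => h u v

theorem quadraticForm_smul_self {g : E →L[ℝ] E →L[ℝ] ℝ} (hi : g.IsInvertible)
    (hs : ∀ u v, g u v = g v u) (c ρ : ℝ) (u v : E) :
    quadraticForm g (c • g) ρ u v = (1 + c * ρ) ^ 2 * g u v := by
  have hr : ∀ u, raise g (c • g) u = c • u := fun u => by
    refine ext_of_metric hi fun w => ?_
    rw [metric_raise hi]; simp
  rw [quadraticForm_apply hi hs (fun u v => by simp [hs u v]), hr, hr]
  simp only [map_add, map_smul, add_apply, smul_apply, smul_eq_mul]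
  ring

variable [FiniteDimensional ℝ E]
variable {G P : E → E →L[ℝ] E →L[ℝ] ℝ} {F U : E → ℝ} {p : ℝ × E × ℝ} {m μ : ℝ}

/-- If `Rm = P ∧ g`, then the ambient metric is flat; if also `∇²f + f P + u g = 0`, then the
ambient density is affine. -/
theorem IsAmbientPoint.ricciW_fibreW_of_kulkarniNomizu (h : IsAmbientPoint G P p)
    (hF : IsAmbientDensityPoint G P F U p.2.1)
    (hW : ∀ u v w z, riemann G p.2.1 u v w z = kulkarniNomizu (P p.2.1) (G p.2.1) u v w z)
    (hH : hessian G F p.2.1 = -(F p.2.1 • P p.2.1 + U p.2.1 • G p.2.1))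
    (hgrad : (m - 1) * (2 * F p.2.1 * U p.2.1 + gradNormSq G F p.2.1 - μ) = 0) :
    ricciW m (ambientMetric G P) (ambientDensity F U) p = 0 ∧
      fibreW m μ (ambientMetric G P) (ambientDensity F U) p = 0 := by
  have h0 := h.codazzi.self_of_nhds
  have hi := h0.invertible.self_of_nhds
  have hcurv : ∀ X Y Z, curvature (ambientMetric G P) p Y Z X = 0 := by
    intro X Y Z
    refine h.frame.self_of_nhds.frame_invertible.injective ?_
    rw [h.curvature_eq, curvature_eq_of_kulkarniNomizu hi hW, sub_self, map_zero]
    rfl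
  have hhess : hessian (ambientMetric G P) (ambientDensity F U) p = 0 := by
    refine bilin_ext fun X Z => ?_
    rw [h.hessian_eq hF, hH]
    simp
  have hric : ricci (ambientMetric G P) p = 0 := by
    refine bilin_ext fun Y Z => ?_
    rw [ricci_apply, show curvature (ambientMetric G P) p Y Z = 0 from
      ContinuousLinearMap.ext fun X => hcurv X Y Z]
    simp
  constructor
  · rw [ricciW, hric, hhess, smul_zero, sub_zero]
  · have htr : metricTrace (ambientMetric G P p) 0 = 0 := by simp [metricTrace]
    rw [fibreW, laplacian, hhess, htr, h.gradNormSq_eq hF, mul_zero, zero_add, hgrad]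

/-- The trace of an endomorphism of `ℝ × E × ℝ` which only acts on `E`. -/
theorem trace_base (T : (ℝ × E × ℝ) →L[ℝ] (ℝ × E × ℝ)) (S : E →L[ℝ] E)
    (h : ∀ X, T X = (0, S X.2.1, 0)) :
    LinearMap.trace ℝ (ℝ × E × ℝ) (T : (ℝ × E × ℝ) →ₗ[ℝ] (ℝ × E × ℝ)) =
      LinearMap.trace ℝ E (S : E →ₗ[ℝ] E) := by
  let i : E →ₗ[ℝ] ℝ × E × ℝ := (LinearMap.inr ℝ ℝ (E × ℝ)).comp (LinearMap.inl ℝ E ℝ)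
  let π : (ℝ × E × ℝ) →ₗ[ℝ] E := (LinearMap.fst ℝ E ℝ).comp (LinearMap.snd ℝ ℝ (E × ℝ))
  have hT : (T : (ℝ × E × ℝ) →ₗ[ℝ] (ℝ × E × ℝ)) = i.comp ((S : E →ₗ[ℝ] E).comp π) :=
    LinearMap.ext fun X => h X
  rw [hT, LinearMap.trace_comp_comm', LinearMap.comp_assoc]
  rfl

/-- The metric trace over `ℝ × E × ℝ` of a form pulled back from `E`, for `P = c g`. -/
theorem metricTrace_ambient {g K : E →L[ℝ] E →L[ℝ] ℝ} {B : (ℝ × E × ℝ) →L[ℝ] (ℝ × E × ℝ) →L[ℝ] ℝ}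
    {t ρ c b : ℝ} (hi : g.IsInvertible) (hs : ∀ u v, g u v = g v u)
    (hGt : (straightForm t ρ (quadraticForm g (c • g) ρ)).IsInvertible)
    (hc : t + t * ρ * c ≠ 0) (hB : ∀ X Z, B X Z = b * K X.2.1 Z.2.1) :
    metricTrace (straightForm t ρ (quadraticForm g (c • g) ρ)) B =
      b / (t + t * ρ * c) ^ 2 * metricTrace g K := by
  rw [← metricTrace_smul]
  refine trace_base _ _ fun X => ?_
  change (straightForm t ρ (quadraticForm g (c • g) ρ)).inverse (B X) =
    (0, g.inverse ((b / (t + t * ρ * c) ^ 2) • K X.2.1), 0)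
  rw [hGt.inverse_apply_eq]
  refine ContinuousLinearMap.ext fun Z => ?_
  rw [hB, straightForm_apply, quadraticForm_smul_self hi hs]
  simp only [hi.self_apply_inverse, smul_apply, smul_eq_mul]
  have h1 : t ^ 2 * ((1 + c * ρ) ^ 2 * (b / (t + t * ρ * c) ^ 2 * K X.2.1 Z.2.1)) =
      b * K X.2.1 Z.2.1 := by
    rw [← mul_assoc, show t ^ 2 * (1 + c * ρ) ^ 2 = (t + t * ρ * c) ^ 2 by ring]
    generalize t + t * ρ * c = s at hc ⊢
    field_simp
  linear_combination -h1

/-- If `P = c g`, then the ambient Ricci tensor is `Ric - 2 c (d - 1) g`, and the ambient Hessian is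
`t (1 + c ρ)` times `H = ∇²f + (c f + u) g`. The ambient density is `t (1 + c ρ) f` if `u = c f`, so
that the factors cancel in the weighted curvatures; otherwise `H` is assumed to vanish. -/
theorem IsAmbientPoint.ricciW_fibreW_of_conical {c : ℝ} (h : IsAmbientPoint G P p)
    (hF : IsAmbientDensityPoint G P F U p.2.1)
    (hP : P p.2.1 = c • G p.2.1) (hc : p.1 + p.1 * p.2.2 * c ≠ 0)
    (hU : U p.2.1 = c * F p.2.1 ∨ hessian G F p.2.1 = -((c * F p.2.1 + U p.2.1) • G p.2.1))
    (hF0 : F p.2.1 ≠ 0)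
    (hric : ricciW m G F p.2.1 = (2 * c * (Module.finrank ℝ E - 1)
      + m / F p.2.1 * (c * F p.2.1 + U p.2.1)) • G p.2.1)
    (hfib : fibreW m μ G F p.2.1 + Module.finrank ℝ E * (F p.2.1 * (c * F p.2.1 + U p.2.1))
      + (m - 1) * (2 * F p.2.1 * U p.2.1) = 0) :
    ricciW m (ambientMetric G P) (ambientDensity F U) p = 0 ∧
      fibreW m μ (ambientMetric G P) (ambientDensity F U) p = 0 := by
  have h0 := h.codazzi.self_of_nhds
  have hi := h0.invertible.self_of_nhds
  have hs := h0.symm_metric.self_of_nhds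
  have hr : ∀ u, raise (G p.2.1) (P p.2.1) u = c • u := fun u => by
    refine ext_of_metric hi fun w => ?_
    rw [metric_raise hi, hP]; simp
  set s := p.1 + p.1 * p.2.2 * c with hs'
  set H := hessian G F p.2.1 + (c * F p.2.1 + U p.2.1) • G p.2.1 with hH
  have hΘ : ∀ Z : ℝ × E × ℝ,
      (ambientFrame (raise (G p.2.1) (P p.2.1)) p.1 p.2.2 Z).2.1 = s • Z.2.1 := fun Z => by
    rw [ambientFrame_apply, hr, hs', add_smul, mul_smul (p.1 * p.2.2)]
  have hhess : ∀ X Z, hessian (ambientMetric G P) (ambientDensity F U) p X Z =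
      s * H X.2.1 Z.2.1 := by
    intro X Z
    rw [h.hessian_eq hF, hΘ, hP, hH]
    simp only [add_apply, smul_apply, smul_eq_mul, map_smul]
    ring
  have hricci : ∀ Y Z, ricci (ambientMetric G P) p Y Z =
      ricci G p.2.1 Y.2.1 Z.2.1 - 2 * c * (Module.finrank ℝ E - 1) * G p.2.1 Y.2.1 Z.2.1 := by
    intro Y Z
    rw [ricci_apply, trace_base _ (curvature G p.2.1 Y.2.1 Z.2.1
      - ((2 * c * G p.2.1 Y.2.1 Z.2.1) • ContinuousLinearMap.id ℝ E
        - (2 * c) • (G p.2.1 Z.2.1).smulRight Y.2.1)), ricci_apply]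
    · have h2 : ∀ A B C : E →L[ℝ] E, ∀ a b : ℝ,
          LinearMap.trace ℝ E ((A - (a • B - b • C) : E →L[ℝ] E) : E →ₗ[ℝ] E) =
            LinearMap.trace ℝ E (A : E →ₗ[ℝ] E) - (a * LinearMap.trace ℝ E (B : E →ₗ[ℝ] E)
              - b * LinearMap.trace ℝ E (C : E →ₗ[ℝ] E)) := by
        intros; simp
      have h3 : LinearMap.trace ℝ E ((ContinuousLinearMap.id ℝ E : E →L[ℝ] E) : E →ₗ[ℝ] E) =
        Module.finrank ℝ E := LinearMap.trace_id ℝ E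
      rw [h2, h3, trace_smulRight, hs Z.2.1]
      ring
    · intro X
      refine h.frame.self_of_nhds.frame_invertible.injective ?_
      simp only [h.curvature_eq, hΘ]
      rw [ambientFrame_apply]
      simp only [hr]
      simp only [hP]
      have hlin : curvature G p.2.1 Y.2.1 (s • Z.2.1) X.2.1 =
          s • curvature G p.2.1 Y.2.1 Z.2.1 X.2.1 := by
        simp only [curvature_apply, map_smul, smul_sub, smul_add]
      refine Prod.ext rfl (Prod.ext ?_ (by simp))
      simp only [hlin, map_smul, smul_apply, smul_eq_mul, sub_apply,
        ContinuousLinearMap.id_apply, ContinuousLinearMap.smulRight_apply, hs X.2.1]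
      rw [hs']
      module
  have htr : metricTrace (G p.2.1) H = laplacian G F p.2.1
      + (c * F p.2.1 + U p.2.1) * Module.finrank ℝ E := by
    rw [hH, metricTrace_add, metricTrace_smul, metricTrace_self hi, laplacian]
  have hlap : metricTrace (ambientMetric G P p)
      (hessian (ambientMetric G P) (ambientDensity F U) p) =
        s / s ^ 2 * metricTrace (G p.2.1) H := by
    have hGt := h.metric_invertible
    rw [ambientMetric, hP] at hGt ⊢
    exact metricTrace_ambient hi hs hGt hc hhess
  have hFt : (ambientDensity F U p = s * F p.2.1) ∨ H = 0 := by
    rcases hU with hU | hU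
    · left
      rw [ambientDensity, hU, hs']
      ring
    · right
      rw [hH, hU, neg_add_cancel]
  constructor
  · refine bilin_ext fun Y Z => ?_
    have h1 : ricciW m (ambientMetric G P) (ambientDensity F U) p Y Z =
      ricci (ambientMetric G P) p Y Z - m / ambientDensity F U p *
        hessian (ambientMetric G P) (ambientDensity F U) p Y Z := rfl
    have h2 : ricci G p.2.1 Y.2.1 Z.2.1 - m / F p.2.1 * hessian G F p.2.1 Y.2.1 Z.2.1 =
        (2 * c * (Module.finrank ℝ E - 1) + m / F p.2.1 * (c * F p.2.1 + U p.2.1))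
          * G p.2.1 Y.2.1 Z.2.1 :=
      DFunLike.congr_fun (DFunLike.congr_fun hric Y.2.1) Z.2.1
    have h3 : m / ambientDensity F U p * (s * H Y.2.1 Z.2.1) =
        m / F p.2.1 * H Y.2.1 Z.2.1 := by
      rcases hFt with hFt | hFt
      · rw [hFt]; field_simp
      · simp [hFt]
    have h4 : H Y.2.1 Z.2.1 = hessian G F p.2.1 Y.2.1 Z.2.1
      + (c * F p.2.1 + U p.2.1) * G p.2.1 Y.2.1 Z.2.1 := rfl
    rw [h1, hhess, hricci, h3, h4]
    simp only [zero_apply]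
    linear_combination h2
  -- two factors `s⁻¹` come from the inverse metric, one `s` from the Hessian, one from `f̃`
  · have h3 : ambientDensity F U p * (s / s ^ 2 * metricTrace (G p.2.1) H) =
        F p.2.1 * metricTrace (G p.2.1) H := by
      rcases hFt with hFt | hFt
      · rw [hFt]; field_simp
      · simp [hFt, metricTrace]
    rw [fibreW, laplacian, hlap, h3, htr, h.gradNormSq_eq hF]
    rw [fibreW] at hfib
    linear_combination hfib

end AmbientFlatness

/-! ### Tensors in charts -/

section Charts

variable {d : ℕ} {M : Type*} [TopologicalSpace M] [ChartedSpace (Model d) M]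

/-- The derivative of the inverse of the preferred chart at `x`, as an endomorphism of the model
space. -/
def chartDeriv (x : M) (y : Model d) : Model d →L[ℝ] Model d :=
  mfderiv 𝓘(ℝ, Model d) 𝓘(ℝ, Model d) (extChartAt 𝓘(ℝ, Model d) x).symm y

theorem inChart_eq (B : BilinField 𝓘(ℝ, Model d) M) (x : M) (y u v : Model d) :
    inChart B x y u v = (B ((extChartAt 𝓘(ℝ, Model d) x).symm y) : Model d →L[ℝ] Model d →L[ℝ] ℝ)
      (chartDeriv x y u) (chartDeriv x y v) := rfl

/-- The change of coordinates from the preferred chart at `x` to that at `x'`. -/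
def transition (x x' : M) (y : Model d) : Model d :=
  extChartAt 𝓘(ℝ, Model d) x' ((extChartAt 𝓘(ℝ, Model d) x).symm y)

/-- The domain of the change of coordinates. -/
def transitionDomain (x x' : M) : Set (Model d) :=
  (extChartAt 𝓘(ℝ, Model d) x).target ∩
    (extChartAt 𝓘(ℝ, Model d) x).symm ⁻¹' (extChartAt 𝓘(ℝ, Model d) x').source

theorem isOpen_transitionDomain (x x' : M) : IsOpen (transitionDomain (d := d) x x') :=
  (continuousOn_extChartAt_symm x).isOpen_inter_preimage (isOpen_extChartAt_target x)
    (isOpen_extChartAt_source x')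

theorem chartDeriv_eq_within (x : M) (y : Model d) :
    chartDeriv x y = mfderivWithin 𝓘(ℝ, Model d) 𝓘(ℝ, Model d)
      (extChartAt 𝓘(ℝ, Model d) x).symm (range 𝓘(ℝ, Model d)) y := by
  rw [chartDeriv, modelWithCornersSelf_coe, range_id, mfderivWithin_univ]

theorem transition_mem_target {x x' : M} {z : Model d} (hz : z ∈ transitionDomain x x') :
    transition x x' z ∈ (extChartAt 𝓘(ℝ, Model d) x').target :=
  (extChartAt 𝓘(ℝ, Model d) x').map_source hz.2

theorem chart_symm_transition {x x' : M} {z : Model d} (hz : z ∈ transitionDomain x x') :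
    (extChartAt 𝓘(ℝ, Model d) x').symm (transition x x' z) =
      (extChartAt 𝓘(ℝ, Model d) x).symm z :=
  (extChartAt 𝓘(ℝ, Model d) x').left_inv hz.2

theorem mem_transitionDomain {x : M} {y : Model d}
    (hy : y ∈ (extChartAt 𝓘(ℝ, Model d) x).target) :
    y ∈ transitionDomain x ((extChartAt 𝓘(ℝ, Model d) x).symm y) :=
  ⟨hy, mem_extChartAt_source _⟩

theorem funInChart_transition (f : M → ℝ) {x x' : M} {z : Model d}
    (hz : z ∈ transitionDomain x x') :
    funInChart 𝓘(ℝ, Model d) f x z = funInChart 𝓘(ℝ, Model d) f x' (transition x x' z) := by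
  rw [funInChart, funInChart, chart_symm_transition hz]

variable [IsManifold 𝓘(ℝ, Model d) ∞ M]

theorem chartDeriv_invertible (x : M) {y : Model d}
    (hy : y ∈ (extChartAt 𝓘(ℝ, Model d) x).target) : (chartDeriv x y).IsInvertible := by
  rw [chartDeriv_eq_within]
  exact isInvertible_mfderivWithin_extChartAt_symm hy

theorem chartDeriv_self (x : M) :
    chartDeriv x (extChartAt 𝓘(ℝ, Model d) x x) = ContinuousLinearMap.id ℝ (Model d) := by
  rw [chartDeriv_eq_within]
  exact mfderivWithin_range_extChartAt_symm

theorem mdifferentiableAt_chart_symm (x : M) {y : Model d}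
    (hy : y ∈ (extChartAt 𝓘(ℝ, Model d) x).target) :
    MDifferentiableAt 𝓘(ℝ, Model d) 𝓘(ℝ, Model d) (extChartAt 𝓘(ℝ, Model d) x).symm y := by
  have := mdifferentiableWithinAt_extChartAt_symm (I := 𝓘(ℝ, Model d)) hy
  rwa [modelWithCornersSelf_coe, range_id, mdifferentiableWithinAt_univ] at this

theorem inChart_self (B : BilinField 𝓘(ℝ, Model d) M) (x : M) :
    inChart B x (extChartAt 𝓘(ℝ, Model d) x x) = B x := by
  let B' : M → Model d →L[ℝ] Model d →L[ℝ] ℝ := B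
  refine bilin_ext fun u v => ?_
  rw [inChart_eq, chartDeriv_self]
  change B' _ u v = B' x u v
  rw [extChartAt_to_inv]

theorem contDiffAt_transition {x x' : M} {z : Model d} (hz : z ∈ transitionDomain x x') :
    ContDiffAt ℝ ∞ (transition x x') z := by
  have h := contDiffWithinAt_ext_coord_change (I := 𝓘(ℝ, Model d)) (n := ∞) x' x (y := z) hz
  rwa [modelWithCornersSelf_coe, range_id, contDiffWithinAt_univ] at h

theorem chartDeriv_transition {x x' : M} {z : Model d} (hz : z ∈ transitionDomain x x') :
    chartDeriv x z = (chartDeriv x' (transition x x' z)).comp (fderiv ℝ (transition x x') z) := by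
  have h1 := (mdifferentiableAt_chart_symm x' (transition_mem_target hz)).hasMFDerivAt
  have h2 := ((contDiffAt_transition hz).differentiableAt (by simp)).hasFDerivAt.hasMFDerivAt
  have h3 := h1.comp z h2
  have h4 : (extChartAt 𝓘(ℝ, Model d) x).symm =ᶠ[𝓝 z]
      (extChartAt 𝓘(ℝ, Model d) x').symm ∘ transition x x' := by
    filter_upwards [(isOpen_transitionDomain x x').mem_nhds hz] with w hw
    exact (chart_symm_transition hw).symm
  exact (h3.congr_of_eventuallyEq h4).mfderiv

theorem inChart_transition (B : BilinField 𝓘(ℝ, Model d) M) {x x' : M} {z : Model d}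
    (hz : z ∈ transitionDomain x x') (u v : Model d) :
    inChart B x z u v = inChart B x' (transition x x' z) (fderiv ℝ (transition x x') z u)
      (fderiv ℝ (transition x x') z v) := by
  let B' : M → Model d →L[ℝ] Model d →L[ℝ] ℝ := B
  rw [inChart_eq, inChart_eq, chartDeriv_transition hz]
  change B' _ _ _ = B' _ _ _
  rw [chart_symm_transition hz]
  rfl

theorem fderiv_transition_invertible {x x' : M} {z : Model d} (hz : z ∈ transitionDomain x x') :
    (fderiv ℝ (transition x x') z).IsInvertible := by
  refine isInvertible_of_injective fun u v huv => (chartDeriv_invertible x hz.1).injective ?_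
  rw [chartDeriv_transition hz, ContinuousLinearMap.comp_apply, huv]
  rfl

/-- At the centre of the chart at `x'`, the derivative of the transition map is the derivative of
the inverse of the chart at `x`. -/
theorem fderiv_transition_self {x : M} {y : Model d}
    (hy : y ∈ (extChartAt 𝓘(ℝ, Model d) x).target) :
    fderiv ℝ (transition x ((extChartAt 𝓘(ℝ, Model d) x).symm y)) y = chartDeriv x y := by
  rw [chartDeriv_transition (mem_transitionDomain hy), transition, chartDeriv_self]
  rfl

theorem contDiffAt_funInChart {f : M → ℝ} (hf : ContMDiff 𝓘(ℝ, Model d) 𝓘(ℝ, ℝ) ∞ f) {x : M}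
    {y : Model d} (hy : y ∈ (extChartAt 𝓘(ℝ, Model d) x).target) :
    ContDiffAt ℝ ∞ (funInChart 𝓘(ℝ, Model d) f x) y := by
  have h1 : ContMDiffAt 𝓘(ℝ, Model d) 𝓘(ℝ, Model d) ∞ (extChartAt 𝓘(ℝ, Model d) x).symm y :=
    (contMDiffOn_extChartAt_symm x).contMDiffAt ((isOpen_extChartAt_target x).mem_nhds hy)
  exact contMDiffAt_iff_contDiffAt.1 (hf.contMDiffAt.comp y h1)

variable (g : SmoothMetric d M)

theorem inChart_metric_symm (x : M) (y u v : Model d) :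
    inChart g.inner x y u v = inChart g.inner x y v u :=
  g.symm _ _ _

theorem inChart_metric_pos {x : M} {y : Model d}
    (hy : y ∈ (extChartAt 𝓘(ℝ, Model d) x).target) (v : Model d) (hv : v ≠ 0) :
    0 < inChart g.inner x y v v :=
  g.pos _ _ ((map_ne_zero_iff _ (chartDeriv_invertible x hy).injective).2 hv)

theorem isInvertible_of_pos {E : Type*} [NormedAddCommGroup E] [NormedSpace ℝ E]
    [FiniteDimensional ℝ E] {B : E →L[ℝ] E →L[ℝ] ℝ} (h : ∀ v, v ≠ 0 → 0 < B v v) :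
    B.IsInvertible :=
  isInvertible_of_nondegenerate fun v hv => by
    by_contra h0
    exact (h v h0).ne' (hv v)

theorem inChart_metric_invertible {x : M} {y : Model d}
    (hy : y ∈ (extChartAt 𝓘(ℝ, Model d) x).target) : (inChart g.inner x y).IsInvertible :=
  isInvertible_of_pos (inChart_metric_pos g hy)

/-- The smoothness of a metric is defined through the trivializations of the tangent bundle; the one
at `x` is given by the derivative of the preferred chart at `x`. -/
theorem contDiffAt_inChart_metric {x : M} {y : Model d}
    (hy : y ∈ (extChartAt 𝓘(ℝ, Model d) x).target) :
    ContDiffAt ℝ ∞ (inChart g.inner x) y := by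
  set x' := (extChartAt 𝓘(ℝ, Model d) x).symm y with hx'
  have hs : x' ∈ (extChartAt 𝓘(ℝ, Model d) x).source :=
    (extChartAt 𝓘(ℝ, Model d) x).map_target hy
  have hs' : x' ∈ (chartAt (Model d) x).source := by rwa [extChartAt_source] at hs
  let e := trivializationAt (Model d) (TangentSpace 𝓘(ℝ, Model d) : M → Type _) x
  have hb : x' ∈ e.baseSet := by simpa [e] using hs'
  have hsec : ∀ u : Model d, ContMDiffAt 𝓘(ℝ, Model d) (𝓘(ℝ, Model d).prod 𝓘(ℝ, Model d)) ∞
      (fun b : M => Bundle.TotalSpace.mk' (Model d) (E := TangentSpace 𝓘(ℝ, Model d)) b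
        (e.symmL ℝ b u)) x' := by
    intro u
    have hc : ContMDiffAt 𝓘(ℝ, Model d) (𝓘(ℝ, Model d).prod 𝓘(ℝ, Model d)) ∞
        (fun b : M => Bundle.TotalSpace.mk' (Model d) (E := Bundle.Trivial M (Model d)) b u) x' :=
      Bundle.contMDiffAt_totalSpace.2 ⟨contMDiffAt_id, contMDiffAt_const⟩
    exact ContMDiffAt.clm_bundle_apply (F₁ := Model d) (F₂ := Model d)
      (E₁ := Bundle.Trivial M (Model d)) (e.contMDiffAt_symmL hb) hc
  refine contDiffAt_clm_of_apply fun u => contDiffAt_clm_of_apply fun v => ?_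
  have h1 : ContMDiffAt 𝓘(ℝ, Model d) (𝓘(ℝ, Model d).prod 𝓘(ℝ)) ∞
      (fun b : M => Bundle.TotalSpace.mk' ℝ (E := Bundle.Trivial M ℝ) b
        (g.inner b (e.symmL ℝ b u) (e.symmL ℝ b v))) x' :=
    ContMDiffAt.clm_bundle_apply₂ (F₁ := Model d) (F₂ := Model d) g.contMDiff.contMDiffAt
      (hsec u) (hsec v)
  have h2 := (Bundle.contMDiffAt_totalSpace.1 h1).2
  have h3 : ContMDiffAt 𝓘(ℝ, Model d) 𝓘(ℝ, Model d) ∞ (extChartAt 𝓘(ℝ, Model d) x).symm y :=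
    (contMDiffOn_extChartAt_symm x).contMDiffAt ((isOpen_extChartAt_target x).mem_nhds hy)
  have h4 := contMDiffAt_iff_contDiffAt.1 (ContMDiffAt.comp y h2 h3)
  refine h4.congr_of_eventuallyEq ?_
  filter_upwards [(isOpen_extChartAt_target x).mem_nhds hy] with z hz
  have hz' : (extChartAt 𝓘(ℝ, Model d) x).symm z ∈ (chartAt (Model d) x).source := by
    rw [← extChartAt_source 𝓘(ℝ, Model d)]
    exact (extChartAt 𝓘(ℝ, Model d) x).map_target hz
  have h5 : e.symmL ℝ ((extChartAt 𝓘(ℝ, Model d) x).symm z) = chartDeriv x z := by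
    rw [TangentBundle.symmL_trivializationAt hz', (extChartAt 𝓘(ℝ, Model d) x).right_inv hz,
      chartDeriv_eq_within]
  rw [inChart_eq]
  change _ = g.inner _ (e.symmL ℝ ((extChartAt 𝓘(ℝ, Model d) x).symm z) u)
    (e.symmL ℝ ((extChartAt 𝓘(ℝ, Model d) x).symm z) v)
  rw [h5]
  rfl

theorem isIsometryAt_transition {x x' : M} {z : Model d} (hz : z ∈ transitionDomain x x') :
    IsIsometryAt (transition x x') (inChart g.inner x) (inChart g.inner x') z where
  smooth := contDiffAt_transition hz
  smooth_source := contDiffAt_inChart_metric g hz.1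
  smooth_target := contDiffAt_inChart_metric g (transition_mem_target hz)
  fderiv_invertible := fderiv_transition_invertible hz
  source_invertible := inChart_metric_invertible g hz.1
  target_invertible := inChart_metric_invertible g (transition_mem_target hz)
  target_symm := Eventually.of_forall fun w => inChart_metric_symm g x' w
  eq := by
    filter_upwards [(isOpen_transitionDomain x x').mem_nhds hz] with w hw
    exact inChart_transition g.inner hw

theorem eventually_isIsometryAt_transition {x x' : M} {z : Model d}
    (hz : z ∈ transitionDomain x x') :
    ∀ᶠ w in 𝓝 z, IsIsometryAt (transition x x') (inChart g.inner x) (inChart g.inner x') w := by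
  filter_upwards [(isOpen_transitionDomain x x').mem_nhds hz] with w hw
    using isIsometryAt_transition g hw

theorem isPullbackAt_transition {f : M → ℝ} (hf : ContMDiff 𝓘(ℝ, Model d) 𝓘(ℝ, ℝ) ∞ f)
    {x x' : M} {z : Model d} (hz : z ∈ transitionDomain x x') :
    IsPullbackAt (transition x x') (funInChart 𝓘(ℝ, Model d) f x)
      (funInChart 𝓘(ℝ, Model d) f x') z where
  smooth := contDiffAt_funInChart hf (transition_mem_target hz)
  eq := by
    filter_upwards [(isOpen_transitionDomain x x').mem_nhds hz] with w hw
    exact funInChart_transition f hw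

end Charts

/-! ### The weighted curvatures on a chart domain -/

section ChartNaturality

variable {d : ℕ} {M : Type*} [TopologicalSpace M] [ChartedSpace (Model d) M]
  [IsManifold 𝓘(ℝ, Model d) ∞ M] (g : SmoothMetric d M) {f : M → ℝ}

/-- The components of `P_φ^m` in a chart are the `P_φ^m` of the components of `g` and `f`. At the
centre of the chart this holds by definition; elsewhere it is naturality under the change to the
chart that defines `P_φ^m` there. -/
theorem inChart_schoutenTensor (hf : ContMDiff 𝓘(ℝ, Model d) 𝓘(ℝ, ℝ) ∞ f) (m μ : ℝ) {x : M}
    {y : Model d} (hy : y ∈ (extChartAt 𝓘(ℝ, Model d) x).target) :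
    inChart (schoutenTensor g.inner f m μ) x y =
      schoutenW m μ (inChart g.inner x) (funInChart 𝓘(ℝ, Model d) f x) y := by
  have hz := mem_transitionDomain hy
  refine bilin_ext fun u v => ?_
  rw [schoutenW_of_isometry m μ (eventually_isIsometryAt_transition g hz)
    (isPullbackAt_transition hf hz), fderiv_transition_self hy]
  rfl

theorem funInChart_traceDefect (hf : ContMDiff 𝓘(ℝ, Model d) 𝓘(ℝ, ℝ) ∞ f) (m μ : ℝ) {x : M}
    {y : Model d} (hy : y ∈ (extChartAt 𝓘(ℝ, Model d) x).target) :
    funInChart 𝓘(ℝ, Model d) (traceDefect g.inner f m μ) x y =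
      traceDefectW m μ (inChart g.inner x) (funInChart 𝓘(ℝ, Model d) f x) y := by
  have hz := mem_transitionDomain hy
  rw [traceDefectW_of_isometry m μ (eventually_isIsometryAt_transition g hz)
    (isPullbackAt_transition hf hz)]
  rfl

theorem riemann_inChart {x : M} {y : Model d} (hy : y ∈ (extChartAt 𝓘(ℝ, Model d) x).target)
    (u v w z : Model d) :
    riemann (inChart g.inner x) y u v w z =
      riemannTensor g.inner ((extChartAt 𝓘(ℝ, Model d) x).symm y) (chartDeriv x y u)
        (chartDeriv x y v) (chartDeriv x y w) (chartDeriv x y z) := by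
  have hz := mem_transitionDomain hy
  have := FiniteDimensional.complete ℝ (Model d)
  rw [riemann_of_isometry (eventually_isIsometryAt_transition g hz), fderiv_transition_self hy]
  rfl

theorem contDiffAt_schoutenW_inChart (hf : ContMDiff 𝓘(ℝ, Model d) 𝓘(ℝ, ℝ) ∞ f)
    (hfpos : ∀ x, 0 < f x) (m μ : ℝ) {x : M} {y : Model d}
    (hy : y ∈ (extChartAt 𝓘(ℝ, Model d) x).target) :
    ContDiffAt ℝ ∞ (schoutenW m μ (inChart g.inner x) (funInChart 𝓘(ℝ, Model d) f x)) y :=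
  contDiffAt_schoutenW m μ (contDiffAt_inChart_metric g hy) (inChart_metric_invertible g hy)
    (contDiffAt_funInChart hf hy) (hfpos _).ne'

theorem contDiffAt_traceDefectW_inChart (hf : ContMDiff 𝓘(ℝ, Model d) 𝓘(ℝ, ℝ) ∞ f)
    (hfpos : ∀ x, 0 < f x) (m μ : ℝ) {x : M} {y : Model d}
    (hy : y ∈ (extChartAt 𝓘(ℝ, Model d) x).target) :
    ContDiffAt ℝ ∞ (traceDefectW m μ (inChart g.inner x) (funInChart 𝓘(ℝ, Model d) f x)) y :=
  contDiffAt_traceDefectW m μ (contDiffAt_inChart_metric g hy) (inChart_metric_invertible g hy)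
    (contDiffAt_funInChart hf hy) (hfpos _).ne'

theorem cottonW_inChart (hf : ContMDiff 𝓘(ℝ, Model d) 𝓘(ℝ, ℝ) ∞ f)
    (hfpos : ∀ x, 0 < f x) (m μ : ℝ) {x : M} {y : Model d}
    (hy : y ∈ (extChartAt 𝓘(ℝ, Model d) x).target) (u v w : Model d) :
    cottonW m μ (inChart g.inner x) (funInChart 𝓘(ℝ, Model d) f x) y u v w =
      cottonTensor g.inner f m μ ((extChartAt 𝓘(ℝ, Model d) x).symm y) (chartDeriv x y u)
        (chartDeriv x y v) (chartDeriv x y w) := by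
  have hz := mem_transitionDomain hy
  have := FiniteDimensional.complete ℝ (Model d)
  have hP : ∀ᶠ z in 𝓝 y, ∀ u v : Model d,
      schoutenW m μ (inChart g.inner x) (funInChart 𝓘(ℝ, Model d) f x) z u v =
        schoutenW m μ (inChart g.inner ((extChartAt 𝓘(ℝ, Model d) x).symm y))
          (funInChart 𝓘(ℝ, Model d) f ((extChartAt 𝓘(ℝ, Model d) x).symm y))
          (transition x ((extChartAt 𝓘(ℝ, Model d) x).symm y) z)
          (fderiv ℝ (transition x ((extChartAt 𝓘(ℝ, Model d) x).symm y)) z u)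
          (fderiv ℝ (transition x ((extChartAt 𝓘(ℝ, Model d) x).symm y)) z v) := by
    filter_upwards [(isOpen_transitionDomain x _).mem_nhds hz] with w hw u v
    exact schoutenW_of_isometry m μ (eventually_isIsometryAt_transition g hw)
      (isPullbackAt_transition hf hw) u v
  have h1 := (contDiffAt_schoutenW_inChart g hf hfpos m μ hy).differentiableAt (by simp)
  have h2 := (contDiffAt_schoutenW_inChart g hf hfpos m μ
    (transition_mem_target hz)).differentiableAt (by simp)
  rw [cottonW, covDeriv_of_isometry (isIsometryAt_transition g hz) h1 h2 hP,
    covDeriv_of_isometry (isIsometryAt_transition g hz) h1 h2 hP, fderiv_transition_self hy]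
  rfl

end ChartNaturality

/-! ### The ambient metric in the charts of the ambient space -/

section AmbientChart

variable {d : ℕ} {M : Type*} [TopologicalSpace M] [ChartedSpace (Model d) M]

/-- The inverse of the preferred chart of `ℝ × M × ℝ` at any point over `x`. It does not depend on
the other coordinates of the point, as the charts of `ℝ` are trivial. -/
def ambientChartSymm (x : M) (z : ℝ × Model d × ℝ) : ℝ × M × ℝ :=
  (z.1, (extChartAt 𝓘(ℝ, Model d) x).symm z.2.1, z.2.2)

theorem extChartAt_ambient_symm (p : ℝ × M × ℝ) :
    ⇑(extChartAt (ambientModel d) p).symm = ambientChartSymm p.2.1 := by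
  funext z
  simp only [extChartAt_prod, extChartAt_model_space_eq_id]
  rfl

theorem extChartAt_ambient_self (p : ℝ × M × ℝ) :
    extChartAt (ambientModel d) p p = (p.1, extChartAt 𝓘(ℝ, Model d) p.2.1 p.2.1, p.2.2) := by
  simp only [extChartAt_prod, extChartAt_model_space_eq_id]
  rfl

theorem funInChart_straightNormalDensity (fρ : ℝ → M → ℝ) (p : ℝ × M × ℝ)
    (z : ℝ × Model d × ℝ) :
    funInChart (ambientModel d) (straightNormalDensity fρ) p z =
      z.1 * funInChart 𝓘(ℝ, Model d) (fρ z.2.2) p.2.1 z.2.1 := by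
  rw [funInChart, extChartAt_ambient_symm]
  rfl

theorem eventually_mem_target (p : ℝ × M × ℝ) : ∀ᶠ z in 𝓝 (extChartAt (ambientModel d) p p),
    z.2.1 ∈ (extChartAt 𝓘(ℝ, Model d) p.2.1).target := by
  have hc : Continuous fun z : ℝ × Model d × ℝ => z.2.1 := by fun_prop
  refine hc.continuousAt.eventually ?_
  rw [extChartAt_ambient_self]
  exact extChartAt_target_mem_nhds (I := 𝓘(ℝ, Model d)) p.2.1

variable [IsManifold 𝓘(ℝ, Model d) ∞ M]

theorem hasMFDerivAt_ambientChartSymm (x : M) {z : ℝ × Model d × ℝ}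
    (hz : z.2.1 ∈ (extChartAt 𝓘(ℝ, Model d) x).target) :
    HasMFDerivAt 𝓘(ℝ, ℝ × Model d × ℝ) (ambientModel d) (ambientChartSymm x) z
      ((ContinuousLinearMap.fst ℝ ℝ (Model d × ℝ)).prod
        (((chartDeriv x z.2.1).comp ((ContinuousLinearMap.fst ℝ (Model d) ℝ).comp
          (ContinuousLinearMap.snd ℝ ℝ (Model d × ℝ)))).prod
          ((ContinuousLinearMap.snd ℝ (Model d) ℝ).comp
            (ContinuousLinearMap.snd ℝ ℝ (Model d × ℝ))))) := by
  have h1 := (ContinuousLinearMap.fst ℝ ℝ (Model d × ℝ)).hasFDerivAt (x := z) |>.hasMFDerivAt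
  have h2 := ((ContinuousLinearMap.fst ℝ (Model d) ℝ).comp
          (ContinuousLinearMap.snd ℝ ℝ (Model d × ℝ))).hasFDerivAt (x := z) |>.hasMFDerivAt
  have h3 := ((ContinuousLinearMap.snd ℝ (Model d) ℝ).comp
          (ContinuousLinearMap.snd ℝ ℝ (Model d × ℝ))).hasFDerivAt (x := z) |>.hasMFDerivAt
  have h4 := (mdifferentiableAt_chart_symm x hz).hasMFDerivAt
  have h5 := HasMFDerivAt.comp z (f := fun w : ℝ × Model d × ℝ => w.2.1) h4 h2
  exact h1.prodMk (h5.prodMk h3)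

theorem inChart_ambient (B : BilinField (ambientModel d) (ℝ × M × ℝ)) (p : ℝ × M × ℝ)
    {z : ℝ × Model d × ℝ} (hz : z.2.1 ∈ (extChartAt 𝓘(ℝ, Model d) p.2.1).target)
    (u v : ℝ × Model d × ℝ) :
    inChart B p z u v = (B (ambientChartSymm p.2.1 z) :
        (ℝ × Model d × ℝ) →L[ℝ] (ℝ × Model d × ℝ) →L[ℝ] ℝ)
      (u.1, chartDeriv p.2.1 z.2.1 u.2.1, u.2.2) (v.1, chartDeriv p.2.1 z.2.1 v.2.1, v.2.2) := by
  have h : ∀ (φ : ℝ × Model d × ℝ → ℝ × M × ℝ), φ = ambientChartSymm p.2.1 →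
      ∀ w : ℝ × Model d × ℝ, (mfderiv 𝓘(ℝ, ℝ × Model d × ℝ) (ambientModel d) φ z :
        (ℝ × Model d × ℝ) →L[ℝ] ℝ × Model d × ℝ) w =
          (w.1, chartDeriv p.2.1 z.2.1 w.2.1, w.2.2) := by
    rintro _ rfl w
    rw [(hasMFDerivAt_ambientChartSymm p.2.1 hz).mfderiv]
    rfl
  have h' := h _ (extChartAt_ambient_symm p)
  have h0 := congr_fun (extChartAt_ambient_symm p) z
  let B' : (ℝ × M × ℝ) → (ℝ × Model d × ℝ) →L[ℝ] (ℝ × Model d × ℝ) →L[ℝ] ℝ := B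
  rw [← h' u, ← h' v]
  change _ = B' (ambientChartSymm p.2.1 z) _ _
  rw [← h0]
  rfl

theorem inChart_straightNormalMetric (gρ : ℝ → BilinField 𝓘(ℝ, Model d) M) (p : ℝ × M × ℝ)
    {z : ℝ × Model d × ℝ} (hz : z.2.1 ∈ (extChartAt 𝓘(ℝ, Model d) p.2.1).target) :
    inChart (straightNormalMetric gρ) p z =
      straightForm z.1 z.2.2 (inChart (gρ z.2.2) p.2.1 z.2.1) :=
  bilin_ext fun u v => inChart_ambient _ p hz u v

theorem raise_of_pullback {E : Type*} [NormedAddCommGroup E] [NormedSpace ℝ E]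
    {g P g' P' : E →L[ℝ] E →L[ℝ] ℝ} {A : E →L[ℝ] E} (hA : A.IsInvertible)
    (hg' : g'.IsInvertible) (hg : g.IsInvertible)
    (h : ∀ u v, g' u v = g (A u) (A v)) (hP : ∀ u v, P' u v = P (A u) (A v)) (u : E) :
    A (raise g' P' u) = raise g P (A u) := by
  refine ext_of_metric hg fun w => ?_
  obtain ⟨w, rfl⟩ := hA.surjective w
  rw [metric_raise hg, ← h, metric_raise hg', hP]

theorem quadraticForm_of_pullback {E : Type*} [NormedAddCommGroup E] [NormedSpace ℝ E]
    {g P g' P' : E →L[ℝ] E →L[ℝ] ℝ} {A : E →L[ℝ] E} (hA : A.IsInvertible)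
    (hg' : g'.IsInvertible) (hg : g.IsInvertible)
    (h : ∀ u v, g' u v = g (A u) (A v)) (hP : ∀ u v, P' u v = P (A u) (A v)) (ρ : ℝ) (u v : E) :
    quadraticForm g' P' ρ u v = quadraticForm g P ρ (A u) (A v) := by
  change g' u v + 2 * ρ * P' u v + ρ ^ 2 * P' u (raise g' P' v) =
    g (A u) (A v) + 2 * ρ * P (A u) (A v) + ρ ^ 2 * P (A u) (raise g P (A v))
  rw [h, hP, hP, raise_of_pullback hA hg' hg h hP]

variable (g : SmoothMetric d M) {f : M → ℝ}

theorem metric_invertible (x : M) :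
    (letI B : Model d →L[ℝ] Model d →L[ℝ] ℝ := g.inner x; B).IsInvertible :=
  isInvertible_of_pos (E := Model d) (g.pos x)

theorem gRho_eq (f : M → ℝ) (m μ ρ : ℝ) (x : M) :
    gRho g.inner f m μ ρ x = quadraticForm (E := Model d) (g.inner x)
      (schoutenTensor g.inner f m μ x) ρ := rfl

theorem inChart_gRho (hf : ContMDiff 𝓘(ℝ, Model d) 𝓘(ℝ, ℝ) ∞ f) (m μ ρ : ℝ) {x : M}
    {y : Model d} (hy : y ∈ (extChartAt 𝓘(ℝ, Model d) x).target) :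
    inChart (gRho g.inner f m μ ρ) x y =
      quadraticForm (inChart g.inner x y)
        (schoutenW m μ (inChart g.inner x) (funInChart 𝓘(ℝ, Model d) f x) y) ρ := by
  refine bilin_ext fun u v => ?_
  rw [← inChart_schoutenTensor g hf m μ hy,
    quadraticForm_of_pullback (E := Model d)
      (P := schoutenTensor g.inner f m μ ((extChartAt 𝓘(ℝ, Model d) x).symm y))
      (chartDeriv_invertible x hy) (inChart_metric_invertible g hy)
      (metric_invertible g _) (fun _ _ => rfl) (fun _ _ => rfl)]
  rfl

/-- In the charts of `ℝ × M × ℝ` the straight and normal metric of `g_ρ` is the ambient metric of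
the components of `g` and `P_φ^m`. -/
theorem inChart_ambientMetric (hf : ContMDiff 𝓘(ℝ, Model d) 𝓘(ℝ, ℝ) ∞ f) (m μ : ℝ)
    (p : ℝ × M × ℝ) {z : ℝ × Model d × ℝ}
    (hz : z.2.1 ∈ (extChartAt 𝓘(ℝ, Model d) p.2.1).target) :
    inChart (straightNormalMetric (gRho g.inner f m μ)) p z =
      ambientMetric (inChart g.inner p.2.1)
        (schoutenW m μ (inChart g.inner p.2.1) (funInChart 𝓘(ℝ, Model d) f p.2.1)) z := by
  rw [inChart_straightNormalMetric _ p hz, inChart_gRho g hf m μ _ hz]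
  rfl

theorem funInChart_ambientDensity (hf : ContMDiff 𝓘(ℝ, Model d) 𝓘(ℝ, ℝ) ∞ f) (m μ : ℝ)
    (p : ℝ × M × ℝ) {z : ℝ × Model d × ℝ}
    (hz : z.2.1 ∈ (extChartAt 𝓘(ℝ, Model d) p.2.1).target) :
    funInChart (ambientModel d) (straightNormalDensity (fRho g.inner f m μ)) p z =
      ambientDensity (funInChart 𝓘(ℝ, Model d) f p.2.1)
        (slopeW m μ (inChart g.inner p.2.1) (funInChart 𝓘(ℝ, Model d) f p.2.1)) z := by
  rw [funInChart_straightNormalDensity, ambientDensity, slopeW,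
    ← funInChart_traceDefect g hf m μ hz]
  simp only [funInChart, fRho]
  ring

end AmbientChart

/-! ### Curvatures depend only on germs -/

section Germs

variable {E : Type*} [NormedAddCommGroup E] [NormedSpace ℝ E] {G G' : E → E →L[ℝ] E →L[ℝ] ℝ}
  {F F' : E → ℝ} {y : E}

theorem christoffel_congr (h : G =ᶠ[𝓝 y] G') : christoffel G y = christoffel G' y := by
  refine ContinuousLinearMap.ext fun u => ContinuousLinearMap.ext fun v => ?_
  rw [christoffel_apply, christoffel_apply, h.self_of_nhds]
  congr 1
  refine ContinuousLinearMap.ext fun w => ?_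
  rw [christoffelLow_apply, christoffelLow_apply, h.fderiv_eq]

theorem hessian_congr (h : G =ᶠ[𝓝 y] G') (hF : F =ᶠ[𝓝 y] F') :
    hessian G F y = hessian G' F' y := by
  rw [hessian, hessian, christoffel_congr h, hF.fderiv_eq, hF.fderiv.fderiv_eq]

theorem fibreW_congr (m μ : ℝ) (h : G =ᶠ[𝓝 y] G') (hF : F =ᶠ[𝓝 y] F') :
    fibreW m μ G F y = fibreW m μ G' F' y := by
  rw [fibreW, fibreW, laplacian, laplacian, gradNormSq, gradNormSq, hessian_congr h hF,
    hF.fderiv_eq, hF.self_of_nhds, h.self_of_nhds]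

variable [FiniteDimensional ℝ E]

theorem ricci_congr (h : G =ᶠ[𝓝 y] G') : ricci G y = ricci G' y := by
  have h1 : christoffel G =ᶠ[𝓝 y] christoffel G' :=
    h.eventuallyEq_nhds.mono fun _ hz => christoffel_congr hz
  refine bilin_ext fun v w => ?_
  rw [ricci_apply, ricci_apply, curvature, curvature, h1.fderiv_eq, h1.self_of_nhds]

theorem ricciW_congr (m : ℝ) (h : G =ᶠ[𝓝 y] G') (hF : F =ᶠ[𝓝 y] F') :
    ricciW m G F y = ricciW m G' F' y := by
  rw [ricciW, ricciW, ricci_congr h, hessian_congr h hF, hF.self_of_nhds]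

end Germs

/-! ### The ambient weighted curvatures in coordinates -/

section AmbientCurvature

variable {d : ℕ} {M : Type*} [TopologicalSpace M] [ChartedSpace (Model d) M]
  [IsManifold 𝓘(ℝ, Model d) ∞ M] (g : SmoothMetric d M) {f : M → ℝ}

theorem bakryEmeryRicci_ambient (hf : ContMDiff 𝓘(ℝ, Model d) 𝓘(ℝ, ℝ) ∞ f) (m μ : ℝ)
    (p : ℝ × M × ℝ) :
    bakryEmeryRicci (straightNormalMetric (gRho g.inner f m μ))
      (straightNormalDensity (fRho g.inner f m μ)) m p =
    ricciW m (ambientMetric (inChart g.inner p.2.1)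
        (schoutenW m μ (inChart g.inner p.2.1) (funInChart 𝓘(ℝ, Model d) f p.2.1)))
      (ambientDensity (funInChart 𝓘(ℝ, Model d) f p.2.1)
        (slopeW m μ (inChart g.inner p.2.1) (funInChart 𝓘(ℝ, Model d) f p.2.1)))
      (p.1, extChartAt 𝓘(ℝ, Model d) p.2.1 p.2.1, p.2.2) := by
  rw [bakryEmeryRicci, ← extChartAt_ambient_self]
  refine ricciW_congr m ?_ ?_ <;> filter_upwards [eventually_mem_target p] with z hz
  exacts [inChart_ambientMetric g hf m μ p hz, funInChart_ambientDensity g hf m μ p hz]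

theorem fibreCurvature_ambient (hf : ContMDiff 𝓘(ℝ, Model d) 𝓘(ℝ, ℝ) ∞ f) (m μ : ℝ)
    (p : ℝ × M × ℝ) :
    fibreCurvature (straightNormalMetric (gRho g.inner f m μ))
      (straightNormalDensity (fRho g.inner f m μ)) m μ p =
    fibreW m μ (ambientMetric (inChart g.inner p.2.1)
        (schoutenW m μ (inChart g.inner p.2.1) (funInChart 𝓘(ℝ, Model d) f p.2.1)))
      (ambientDensity (funInChart 𝓘(ℝ, Model d) f p.2.1)
        (slopeW m μ (inChart g.inner p.2.1) (funInChart 𝓘(ℝ, Model d) f p.2.1)))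
      (p.1, extChartAt 𝓘(ℝ, Model d) p.2.1 p.2.1, p.2.2) := by
  rw [fibreCurvature, ← extChartAt_ambient_self]
  refine fibreW_congr m μ ?_ ?_ <;> filter_upwards [eventually_mem_target p] with z hz
  exacts [inChart_ambientMetric g hf m μ p hz, funInChart_ambientDensity g hf m μ p hz]

end AmbientCurvature

/-! ### Einstein-type conditions -/

section Einstein

variable {E : Type*} [NormedAddCommGroup E] [NormedSpace ℝ E]
  {G P : E → E →L[ℝ] E →L[ℝ] ℝ} {F : E → ℝ} {y : E} {m μ a b : ℝ}

/-- If `P = c g` for a constant `c`, then `∇P = 0`. -/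
theorem covDeriv_eq_zero_of_smul {c : ℝ} (hG : DifferentiableAt ℝ G y)
    (hi : (G y).IsInvertible) (hs : ∀ᶠ z in 𝓝 y, ∀ u v, G z u v = G z v u)
    (hP : P =ᶠ[𝓝 y] fun z => c • G z) (u v w : E) : covDeriv G P y u v w = 0 := by
  rw [covDeriv, hP.fderiv_eq, hP.self_of_nhds, fderiv_fun_const_smul hG]
  simp only [smul_apply, smul_eq_mul, fderiv_metric_eq hG hi hs]
  ring

theorem hessian_const (G : E → E →L[ℝ] E →L[ℝ] ℝ) (a : ℝ) (y : E) :
    hessian G (fun _ => a) y = 0 := by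
  refine bilin_ext fun u v => ?_
  have h : fderiv ℝ (fun _ : E => a) = fun _ => 0 := funext fun z => fderiv_const_apply a
  rw [hessian, h, fderiv_const_apply]
  simp

variable [FiniteDimensional ℝ E]

/-- The weighted scalar curvature is the trace of `Ric_φ^m` minus `(m / f²) F_φ^m`. -/
theorem scalarW_eq (m μ : ℝ) (hF : F y ≠ 0) :
    scalarW m μ G F y = metricTrace (G y) (ricciW m G F y) - m / F y ^ 2 * fibreW m μ G F y := by
  have h : ricciW m G F y = ricci G y + (-(m / F y)) • hessian G F y := by
    rw [ricciW, neg_smul, sub_eq_add_neg]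
  rw [h, metricTrace_add, metricTrace_smul, scalarW, scalarCurvature, fibreW, laplacian]
  field_simp
  ring

theorem schoutenScalarW_of_einstein (hi : (G y).IsInvertible) (hF : F y ≠ 0)
    (hric : ricciW m G F y = a • G y) (hfib : fibreW m μ G F y = -b * F y ^ 2) :
    schoutenScalarW m μ G F y =
      (Module.finrank ℝ E * a + m * b) / (2 * (Module.finrank ℝ E + m - 1)) := by
  rw [schoutenScalarW, scalarW_eq m μ hF, hric, hfib, metricTrace_smul, metricTrace_self hi]
  field_simp
  ring

theorem schoutenW_of_einstein (hi : (G y).IsInvertible) (hF : F y ≠ 0)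
    (hric : ricciW m G F y = a • G y) (hfib : fibreW m μ G F y = -b * F y ^ 2) :
    schoutenW m μ G F y = (1 / (Module.finrank ℝ E + m - 2) *
      (a - (Module.finrank ℝ E * a + m * b) / (2 * (Module.finrank ℝ E + m - 1)))) • G y := by
  rw [schoutenW, schoutenScalarW_of_einstein hi hF hric hfib, hric, ← sub_smul, smul_smul]

end Einstein

section Base

variable {d : ℕ} {M : Type*} [TopologicalSpace M] [ChartedSpace (Model d) M]

theorem eventually_mem_chart_target (x : M) :
    ∀ᶠ z in 𝓝 (extChartAt 𝓘(ℝ, Model d) x x), z ∈ (extChartAt 𝓘(ℝ, Model d) x).target :=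
  extChartAt_target_mem_nhds (I := 𝓘(ℝ, Model d)) x

variable [IsManifold 𝓘(ℝ, Model d) ∞ M]

/-- The conditions on `(M, g, f, m, μ)` under which the straight and normal ambient metric of
`g_ρ` has a simple connection: in each chart, `P_φ^m` is a symmetric Codazzi tensor and
`d ((f / m) Y_φ^m) = P_φ^m(∇f, ·)`. -/
structure IsCodazziBase (g : SmoothMetric d M) (f : M → ℝ) (m μ : ℝ) : Prop where
  symm : ∀ (x : M), ∀ y ∈ (extChartAt 𝓘(ℝ, Model d) x).target, ∀ u v,
    schoutenW m μ (inChart g.inner x) (funInChart 𝓘(ℝ, Model d) f x) y u v =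
      schoutenW m μ (inChart g.inner x) (funInChart 𝓘(ℝ, Model d) f x) y v u
  codazzi : ∀ (x : M), ∀ y ∈ (extChartAt 𝓘(ℝ, Model d) x).target, ∀ u v w,
    cottonW m μ (inChart g.inner x) (funInChart 𝓘(ℝ, Model d) f x) y u v w = 0
  slope : ∀ (x : M), ∀ y ∈ (extChartAt 𝓘(ℝ, Model d) x).target, ∀ v,
    fderiv ℝ (slopeW m μ (inChart g.inner x) (funInChart 𝓘(ℝ, Model d) f x)) y v =
      fderiv ℝ (funInChart 𝓘(ℝ, Model d) f x) y (raise (inChart g.inner x y)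
        (schoutenW m μ (inChart g.inner x) (funInChart 𝓘(ℝ, Model d) f x) y) v)

variable {g : SmoothMetric d M} {f : M → ℝ} {m μ : ℝ}

theorem inChart_gRho_self (hf : ContMDiff 𝓘(ℝ, Model d) 𝓘(ℝ, ℝ) ∞ f) (ρ : ℝ) (x : M) :
    quadraticForm (inChart g.inner x (extChartAt 𝓘(ℝ, Model d) x x))
      (schoutenW m μ (inChart g.inner x) (funInChart 𝓘(ℝ, Model d) f x)
        (extChartAt 𝓘(ℝ, Model d) x x)) ρ = gRho g.inner f m μ ρ x := by
  rw [← inChart_gRho g hf m μ ρ (mem_extChartAt_target x), inChart_self]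

theorem contDiffAt_slopeW_inChart (hf : ContMDiff 𝓘(ℝ, Model d) 𝓘(ℝ, ℝ) ∞ f)
    (hfpos : ∀ x, 0 < f x) {x : M} {y : Model d}
    (hy : y ∈ (extChartAt 𝓘(ℝ, Model d) x).target) :
    ContDiffAt ℝ ∞ (slopeW m μ (inChart g.inner x) (funInChart 𝓘(ℝ, Model d) f x)) y :=
  ((contDiffAt_funInChart hf hy).div_const m).mul
    (contDiffAt_traceDefectW_inChart g hf hfpos m μ hy)

theorem IsCodazziBase.isAmbientPoint (h : IsCodazziBase g f m μ)
    (hf : ContMDiff 𝓘(ℝ, Model d) 𝓘(ℝ, ℝ) ∞ f) (hfpos : ∀ x, 0 < f x) {p : ℝ × M × ℝ}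
    (ht : p.1 ≠ 0) (hpos : ∀ v : TangentSpace 𝓘(ℝ, Model d) p.2.1, v ≠ 0 →
      0 < gRho g.inner f m μ p.2.2 p.2.1 v v) :
    IsAmbientPoint (inChart g.inner p.2.1)
      (schoutenW m μ (inChart g.inner p.2.1) (funInChart 𝓘(ℝ, Model d) f p.2.1))
      (p.1, extChartAt 𝓘(ℝ, Model d) p.2.1 p.2.1, p.2.2) where
  smooth_metric := contDiffAt_inChart_metric g (mem_extChartAt_target _)
  smooth_form := contDiffAt_schoutenW_inChart g hf hfpos m μ (mem_extChartAt_target _)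
  codazzi := by
    filter_upwards [(eventually_mem_chart_target p.2.1).eventually_nhds] with y hy
    have hy0 := hy.self_of_nhds
    exact
      { smooth_metric := (contDiffAt_inChart_metric g hy0).of_le (by norm_cast)
        smooth_form := (contDiffAt_schoutenW_inChart g hf hfpos m μ hy0).of_le (by norm_cast)
        invertible := hy.mono fun z hz => inChart_metric_invertible g hz
        symm_metric := Eventually.of_forall fun z => inChart_metric_symm g _ z
        symm_form := hy.mono fun z hz => h.symm _ z hz
        codazzi := fun u v w => sub_eq_zero.1 (h.codazzi _ y hy0 u v w) }
  radial_ne_zero := ht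
  pos := by
    intro v hv
    rw [inChart_gRho_self hf]
    exact hpos v hv

theorem IsCodazziBase.isAmbientDensityPoint (h : IsCodazziBase g f m μ)
    (hf : ContMDiff 𝓘(ℝ, Model d) 𝓘(ℝ, ℝ) ∞ f) (hfpos : ∀ x, 0 < f x) (x : M) :
    IsAmbientDensityPoint (inChart g.inner x)
      (schoutenW m μ (inChart g.inner x) (funInChart 𝓘(ℝ, Model d) f x))
      (funInChart 𝓘(ℝ, Model d) f x)
      (slopeW m μ (inChart g.inner x) (funInChart 𝓘(ℝ, Model d) f x))
      (extChartAt 𝓘(ℝ, Model d) x x) where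
  smooth_density := contDiffAt_funInChart hf (mem_extChartAt_target _)
  smooth_slope := contDiffAt_slopeW_inChart hf hfpos (mem_extChartAt_target _)
  fderiv_slope := (eventually_mem_chart_target x).mono fun z hz => h.slope x z hz

/-- The weighted curvatures of the ambient metric vanish at all points where `t > 0` and `g_ρ` is
positive definite. -/
def IsAmbientFlat (g : SmoothMetric d M) (f : M → ℝ) (m μ : ℝ) : Prop :=
  ∀ p : ℝ × M × ℝ, 0 < p.1 → (∀ v : TangentSpace 𝓘(ℝ, Model d) p.2.1, v ≠ 0 →
      0 < gRho g.inner f m μ p.2.2 p.2.1 v v) →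
    bakryEmeryRicci (straightNormalMetric (gRho g.inner f m μ))
        (straightNormalDensity (fRho g.inner f m μ)) m p = 0 ∧
      fibreCurvature (straightNormalMetric (gRho g.inner f m μ))
        (straightNormalDensity (fRho g.inner f m μ)) m μ p = 0

/-! ### Locally conformally flat spaces -/

theorem kulkarniNomizu_inChart (hf : ContMDiff 𝓘(ℝ, Model d) 𝓘(ℝ, ℝ) ∞ f)
    (hlcf : IsWeightedLCF g.inner f m μ) {x : M} {y : Model d}
    (hy : y ∈ (extChartAt 𝓘(ℝ, Model d) x).target) (u v w z : Model d) :
    riemann (inChart g.inner x) y u v w z =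
      kulkarniNomizu (schoutenW m μ (inChart g.inner x) (funInChart 𝓘(ℝ, Model d) f x) y)
        (inChart g.inner x y) u v w z := by
  rw [← inChart_schoutenTensor g hf m μ hy]
  exact (riemann_inChart g hy u v w z).trans (hlcf.1 _ _ _ _ _)

theorem IsWeightedLCF.schouten_symm (hd : 3 ≤ d)
    (hf : ContMDiff 𝓘(ℝ, Model d) 𝓘(ℝ, ℝ) ∞ f) (hlcf : IsWeightedLCF g.inner f m μ) {x : M} {y : Model d}
    (hy : y ∈ (extChartAt 𝓘(ℝ, Model d) x).target) (u v : Model d) :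
    schoutenW m μ (inChart g.inner x) (funInChart 𝓘(ℝ, Model d) f x) y u v =
      schoutenW m μ (inChart g.inner x) (funInChart 𝓘(ℝ, Model d) f x) y v u :=
  symm_of_kulkarniNomizu (by simpa using hd) (contDiffAt_inChart_metric g hy)
    (inChart_metric_pos g hy)
    (by filter_upwards [(isOpen_extChartAt_target x).mem_nhds hy] with z hz
          using inChart_metric_invertible g hz)
    (Eventually.of_forall fun z => inChart_metric_symm g _ z)
    (kulkarniNomizu_inChart hf hlcf hy) u v

theorem IsWeightedLCF.hessian_inChart (hd : 3 ≤ d) (hm : 0 < m)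
    (hf : ContMDiff 𝓘(ℝ, Model d) 𝓘(ℝ, ℝ) ∞ f) (hfpos : ∀ x, 0 < f x)
    (hlcf : IsWeightedLCF g.inner f m μ) {x : M} {y : Model d}
    (hy : y ∈ (extChartAt 𝓘(ℝ, Model d) x).target) :
    hessian (inChart g.inner x) (funInChart 𝓘(ℝ, Model d) f x) y =
      -(funInChart 𝓘(ℝ, Model d) f x y •
          schoutenW m μ (inChart g.inner x) (funInChart 𝓘(ℝ, Model d) f x) y
        + slopeW m μ (inChart g.inner x) (funInChart 𝓘(ℝ, Model d) f x) y •
          inChart g.inner x y) :=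
  hessian_eq_of_kulkarniNomizu (by simpa using hd) hm (inChart_metric_invertible g hy)
    (inChart_metric_symm g x y) (hfpos _).ne' (hlcf.schouten_symm hd hf hy)
    (kulkarniNomizu_inChart hf hlcf hy)

theorem IsWeightedLCF.isCodazziBase (hd : 3 ≤ d) (hm : 0 < m)
    (hf : ContMDiff 𝓘(ℝ, Model d) 𝓘(ℝ, ℝ) ∞ f) (hfpos : ∀ x, 0 < f x)
    (hlcf : IsWeightedLCF g.inner f m μ) : IsCodazziBase g f m μ := by
  have hC : ∀ (x : M), ∀ y ∈ (extChartAt 𝓘(ℝ, Model d) x).target, ∀ u v w,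
      cottonW m μ (inChart g.inner x) (funInChart 𝓘(ℝ, Model d) f x) y u v w = 0 :=
    fun x y hy u v w => (cottonW_inChart g hf hfpos m μ hy u v w).trans (hlcf.2 _ _ _ _)
  refine ⟨fun x y hy => hlcf.schouten_symm hd hf hy, hC, fun x y hy => ?_⟩
  exact fderiv_slope_eq (by simpa using hd) (contDiffAt_inChart_metric g hy)
    (inChart_metric_pos g hy) (inChart_metric_invertible g hy)
    (Eventually.of_forall fun z => inChart_metric_symm g _ z) (contDiffAt_funInChart hf hy)
    ((contDiffAt_slopeW_inChart hf hfpos hy).differentiableAt (by simp))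
    ((contDiffAt_schoutenW_inChart g hf hfpos m μ hy).differentiableAt (by simp))
    (kulkarniNomizu_inChart hf hlcf hy) (fun u v w => sub_eq_zero.1 (hC x y hy u v w))
    (by filter_upwards [(isOpen_extChartAt_target x).mem_nhds hy] with z hz
          using hlcf.hessian_inChart hd hm hf hfpos hz)

theorem IsWeightedLCF.isAmbientFlat (hd : 3 ≤ d) (hm : 0 < m)
    (hf : ContMDiff 𝓘(ℝ, Model d) 𝓘(ℝ, ℝ) ∞ f) (hfpos : ∀ x, 0 < f x)
    (hlcf : IsWeightedLCF g.inner f m μ) : IsAmbientFlat g f m μ := by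
  intro p ht hpos
  have hy := mem_extChartAt_target (I := 𝓘(ℝ, Model d)) p.2.1
  have h := hlcf.isCodazziBase hd hm hf hfpos
  rw [bakryEmeryRicci_ambient g hf, fibreCurvature_ambient g hf]
  exact (h.isAmbientPoint hf hfpos ht.ne' hpos).ricciW_fibreW_of_kulkarniNomizu
    (h.isAmbientDensityPoint hf hfpos p.2.1) (kulkarniNomizu_inChart hf hlcf hy)
    (hlcf.hessian_inChart hd hm hf hfpos hy)
    (gradNormSq_of_kulkarniNomizu (by simpa using hd) hm (inChart_metric_invertible g hy)
      (inChart_metric_symm g _ _) (hfpos _).ne' (hlcf.schouten_symm hd hf hy)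
      (kulkarniNomizu_inChart hf hlcf hy))

/-! ### Spaces on which the weighted Schouten tensor is a multiple of the metric -/

theorem gRho_apply_of_smul {c : ℝ} {x : M}
    (hP : schoutenTensor g.inner f m μ x = c • g.inner x) (ρ : ℝ)
    (u v : TangentSpace 𝓘(ℝ, Model d) x) :
    gRho g.inner f m μ ρ x u v = (1 + c * ρ) ^ 2 * g.inner x u v := by
  rw [gRho_eq, hP]
  exact quadraticForm_smul_self (E := Model d) (metric_invertible g x) (g.symm x) c ρ u v

theorem schoutenW_inChart_of_smul {c : ℝ} (hf : ContMDiff 𝓘(ℝ, Model d) 𝓘(ℝ, ℝ) ∞ f)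
    (hP : ∀ x : M, schoutenTensor g.inner f m μ x = c • g.inner x) {x : M} {y : Model d}
    (hy : y ∈ (extChartAt 𝓘(ℝ, Model d) x).target) :
    schoutenW m μ (inChart g.inner x) (funInChart 𝓘(ℝ, Model d) f x) y =
      c • inChart g.inner x y := by
  rw [← inChart_schoutenTensor g hf m μ hy]
  refine bilin_ext fun u v => ?_
  exact DFunLike.congr_fun (DFunLike.congr_fun (hP ((extChartAt 𝓘(ℝ, Model d) x).symm y))
    (chartDeriv x y u)) (chartDeriv x y v)

theorem isCodazziBase_of_smul {c : ℝ} (hf : ContMDiff 𝓘(ℝ, Model d) 𝓘(ℝ, ℝ) ∞ f)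
    (hP : ∀ x : M, schoutenTensor g.inner f m μ x = c • g.inner x)
    (hU : ∀ (x : M), ∀ y ∈ (extChartAt 𝓘(ℝ, Model d) x).target, ∀ v,
      fderiv ℝ (slopeW m μ (inChart g.inner x) (funInChart 𝓘(ℝ, Model d) f x)) y v =
        c * fderiv ℝ (funInChart 𝓘(ℝ, Model d) f x) y v) :
    IsCodazziBase g f m μ := by
  refine ⟨fun x y hy u v => ?_, fun x y hy u v w => ?_, fun x y hy v => ?_⟩
  · rw [schoutenW_inChart_of_smul hf hP hy]
    simp [inChart_metric_symm g x y u v]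
  · have h := covDeriv_eq_zero_of_smul
      ((contDiffAt_inChart_metric g hy).differentiableAt (by simp))
      (inChart_metric_invertible g hy) (Eventually.of_forall fun z => inChart_metric_symm g x z)
      (P := schoutenW m μ (inChart g.inner x) (funInChart 𝓘(ℝ, Model d) f x)) (c := c)
      (by filter_upwards [(isOpen_extChartAt_target x).mem_nhds hy] with z hz
            using schoutenW_inChart_of_smul hf hP hz)
    rw [cottonW, h, h, sub_zero]
  · have hi := inChart_metric_invertible g hy
    have hr : raise (inChart g.inner x y) (c • inChart g.inner x y) v = c • v := by
      refine ext_of_metric hi fun w => ?_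
      rw [metric_raise hi]
      simp
    rw [hU x y hy, schoutenW_inChart_of_smul hf hP hy, hr, map_smul, smul_eq_mul]

/-- If `P_φ^m = c g`, then the ambient weighted curvatures vanish under pointwise conditions on
`M`. -/
theorem isAmbientFlat_of_smul {c : ℝ} (hf : ContMDiff 𝓘(ℝ, Model d) 𝓘(ℝ, ℝ) ∞ f)
    (hfpos : ∀ x, 0 < f x) (h : IsCodazziBase g f m μ)
    (hP : ∀ x : M, schoutenTensor g.inner f m μ x = c • g.inner x)
    (hd : 0 < d) (hU : ∀ x : M, (f x / m * traceDefect g.inner f m μ x = c * f x) ∨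
      hessian (inChart g.inner x) (funInChart 𝓘(ℝ, Model d) f x) (extChartAt 𝓘(ℝ, Model d) x x) =
        -((c * f x + f x / m * traceDefect g.inner f m μ x) • g.inner x))
    (hric : ∀ x : M, bakryEmeryRicci g.inner f m x = (2 * c * (d - 1)
      + m / f x * (c * f x + f x / m * traceDefect g.inner f m μ x)) • g.inner x)
    (hfib : ∀ x : M, fibreCurvature g.inner f m μ x
      + d * (f x * (c * f x + f x / m * traceDefect g.inner f m μ x))
      + (m - 1) * (2 * f x * (f x / m * traceDefect g.inner f m μ x)) = 0) :
    IsAmbientFlat g f m μ := by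
  intro p ht hpos
  obtain ⟨t, x, ρ⟩ := p
  have hF : funInChart 𝓘(ℝ, Model d) f x (extChartAt 𝓘(ℝ, Model d) x x) = f x := by
    rw [funInChart, extChartAt_to_inv]
  have hS : slopeW m μ (inChart g.inner x) (funInChart 𝓘(ℝ, Model d) f x)
      (extChartAt 𝓘(ℝ, Model d) x x) = f x / m * traceDefect g.inner f m μ x := by
    rw [slopeW, hF]
    rfl
  have hdim : (Module.finrank ℝ (Model d) : ℝ) = d := by simp
  rw [bakryEmeryRicci_ambient g hf, fibreCurvature_ambient g hf]
  refine (h.isAmbientPoint hf hfpos ht.ne' hpos).ricciW_fibreW_of_conical (c := c)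
    (h.isAmbientDensityPoint hf hfpos x) (schoutenW_inChart_of_smul hf hP
      (mem_extChartAt_target x)) ?_ ?_ ?_ ?_ ?_
  -- `1 + c ρ` does not vanish, since `g_ρ = (1 + c ρ)² g` is positive definite
  · have : Nonempty (Fin d) := ⟨⟨0, hd⟩⟩
    obtain ⟨v, hv⟩ := exists_ne (0 : Model d)
    have h1 := (hpos v hv).trans_eq (gRho_apply_of_smul (hP x) ρ v v)
    intro h3
    have h4 : 1 + c * ρ = 0 := by
      have : t * (1 + c * ρ) = 0 := by linear_combination h3
      exact (mul_eq_zero.1 this).resolve_left ht.ne'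
    rw [h4] at h1
    simp at h1
  · simp only [hS, hF, inChart_self]
    exact hU x
  · simp only [hF]
    exact (hfpos x).ne'
  · simp only [hS, hF, inChart_self, hdim]
    exact hric x
  · simp only [hS, hF, hdim]
    exact hfib x

/-- If `Ric_φ^m = a g` and `F_φ^m = -b f²`, then `P_φ^m` is a multiple of `g`. On quasi-Einstein
spaces `b = a`; for `f = 1` one has `b = (m - 1) μ`. -/
theorem schoutenTensor_of_einstein {a b : ℝ} (hfpos : ∀ x, 0 < f x)
    (hfib : ∀ x : M, fibreCurvature g.inner f m μ x = -b * f x ^ 2)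
    (hric : ∀ x : M, bakryEmeryRicci g.inner f m x = a • g.inner x) (x : M) :
    schoutenTensor g.inner f m μ x =
      (1 / (d + m - 2) * (a - (d * a + m * b) / (2 * (d + m - 1)))) • g.inner x ∧
    traceDefect g.inner f m μ x = (d * a + m * b) / (2 * (d + m - 1)) -
      (1 / (d + m - 2) * (a - (d * a + m * b) / (2 * (d + m - 1)))) * d := by
  have hF : funInChart 𝓘(ℝ, Model d) f x (extChartAt 𝓘(ℝ, Model d) x x) = f x := by
    rw [funInChart, extChartAt_to_inv]
  have hdim : (Module.finrank ℝ (Model d) : ℝ) = d := by simp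
  have hi := inChart_metric_invertible g (mem_extChartAt_target (I := 𝓘(ℝ, Model d)) x)
  have h1 : ricciW m (inChart g.inner x) (funInChart 𝓘(ℝ, Model d) f x)
      (extChartAt 𝓘(ℝ, Model d) x x) = a • inChart g.inner x (extChartAt 𝓘(ℝ, Model d) x x) := by
    rw [inChart_self]
    exact hric x
  have h2 : fibreW m μ (inChart g.inner x) (funInChart 𝓘(ℝ, Model d) f x)
      (extChartAt 𝓘(ℝ, Model d) x x) =
      -b * funInChart 𝓘(ℝ, Model d) f x (extChartAt 𝓘(ℝ, Model d) x x) ^ 2 := by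
    rw [hF]
    exact hfib x
  have hF0 : funInChart 𝓘(ℝ, Model d) f x (extChartAt 𝓘(ℝ, Model d) x x) ≠ 0 := by
    rw [hF]
    exact (hfpos x).ne'
  have h3 := schoutenW_of_einstein hi hF0 h1 h2
  have h4 : traceDefectW m μ (inChart g.inner x) (funInChart 𝓘(ℝ, Model d) f x)
      (extChartAt 𝓘(ℝ, Model d) x x) =
        (Module.finrank ℝ (Model d) * a + m * b) / (2 * (Module.finrank ℝ (Model d) + m - 1)) -
      (1 / (Module.finrank ℝ (Model d) + m - 2) * (a - (Module.finrank ℝ (Model d) * a + m * b)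
        / (2 * (Module.finrank ℝ (Model d) + m - 1)))) * Module.finrank ℝ (Model d) := by
    rw [traceDefectW, schoutenScalarW_of_einstein hi hF0 h1 h2, h3, metricTrace_smul,
      metricTrace_self hi]
  rw [hdim] at h3 h4
  rw [inChart_self] at h3
  exact ⟨h3, h4⟩

/-! ### Quasi-Einstein spaces -/

/-- On a quasi-Einstein space `P_φ^m = c g` and `Y_φ^m = m c` for a constant `c`. -/
theorem IsQuasiEinstein.exists_schoutenTensor (hd : 3 ≤ d) (hm : 0 < m) (hfpos : ∀ x, 0 < f x)
    (hqe : IsQuasiEinstein g.inner f m μ) :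
    ∃ c : ℝ, (∀ x : M, schoutenTensor g.inner f m μ x = c • g.inner x) ∧
      (∀ x : M, traceDefect g.inner f m μ x = m * c) ∧
      (∀ x : M, fibreCurvature g.inner f m μ x = -(2 * c * (d + m - 1)) * f x ^ 2) ∧
      ∀ x : M, bakryEmeryRicci g.inner f m x = (2 * c * (d + m - 1)) • g.inner x := by
  obtain ⟨lam, hfib, hric⟩ := hqe
  have hd' : (3 : ℝ) ≤ d := by exact_mod_cast hd
  have h1 : (d + m - 1 : ℝ) ≠ 0 := by linarith
  have h2 : (d + m - 2 : ℝ) ≠ 0 := by linarith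
  have h3 : 2 * (lam / (2 * (d + m - 1))) * (d + m - 1) = lam := by field_simp
  refine ⟨lam / (2 * (d + m - 1)), fun x => ?_, fun x => ?_, ?_, ?_⟩
  · rw [(schoutenTensor_of_einstein hfpos hfib hric x).1]
    congr 1
    field_simp
    ring
  · rw [(schoutenTensor_of_einstein hfpos hfib hric x).2]
    field_simp
    ring
  · rwa [h3]
  · rwa [h3]

theorem IsQuasiEinstein.isCodazziBase (hd : 3 ≤ d) (hm : 0 < m)
    (hf : ContMDiff 𝓘(ℝ, Model d) 𝓘(ℝ, ℝ) ∞ f) (hfpos : ∀ x, 0 < f x)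
    (hqe : IsQuasiEinstein g.inner f m μ) : IsCodazziBase g f m μ := by
  obtain ⟨c, hP, hY, -⟩ := hqe.exists_schoutenTensor hd hm hfpos
  refine isCodazziBase_of_smul hf hP fun x y hy v => ?_
  have hU : slopeW m μ (inChart g.inner x) (funInChart 𝓘(ℝ, Model d) f x) =ᶠ[𝓝 y]
      fun z => c * funInChart 𝓘(ℝ, Model d) f x z := by
    filter_upwards [(isOpen_extChartAt_target x).mem_nhds hy] with z hz
    rw [slopeW, ← funInChart_traceDefect g hf m μ hz, funInChart, funInChart, hY]
    field_simp
  rw [hU.fderiv_eq, fderiv_const_mul ((contDiffAt_funInChart hf hy).differentiableAt (by simp))]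
  rfl

theorem IsQuasiEinstein.isAmbientFlat (hd : 3 ≤ d) (hm : 0 < m)
    (hf : ContMDiff 𝓘(ℝ, Model d) 𝓘(ℝ, ℝ) ∞ f) (hfpos : ∀ x, 0 < f x)
    (hqe : IsQuasiEinstein g.inner f m μ) : IsAmbientFlat g f m μ := by
  obtain ⟨c, hP, hY, hfib, hric⟩ := hqe.exists_schoutenTensor hd hm hfpos
  have hU : ∀ x, f x / m * traceDefect g.inner f m μ x = c * f x := fun x => by
    rw [hY]; field_simp
  refine isAmbientFlat_of_smul hf hfpos (hqe.isCodazziBase hd hm hf hfpos) hP (by omega)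
    (fun x => Or.inl (hU x)) (fun x => ?_) (fun x => ?_)
  · rw [hU, hric]
    congr 1
    have := (hfpos x).ne'
    field_simp
    ring
  · rw [hU, hfib]
    ring

/-! ### Constant densities on Einstein spaces -/

/-- Under the Gover-Leitner conditions `P_φ^m = c g` and `Y_φ^m = -m c` for a constant `c`. -/
theorem IsGoverLeitner.exists_schoutenTensor (hd : 3 ≤ d) (hm : 0 < m)
    (hgl : IsGoverLeitner g.inner f m μ) :
    ∃ c : ℝ, (∀ x : M, schoutenTensor g.inner f m μ x = c • g.inner x) ∧
      (∀ x : M, traceDefect g.inner f m μ x = -(m * c)) ∧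
      (∀ x : M, fibreCurvature g.inner f m μ x = 2 * c * (m - 1)) ∧
      ∀ x : M, bakryEmeryRicci g.inner f m x = (2 * c * (d - 1)) • g.inner x := by
  obtain ⟨hf1, lam, hric, -, hmu⟩ := hgl
  have hd' : (3 : ℝ) ≤ d := by exact_mod_cast hd
  have h1 : (d + m - 1 : ℝ) ≠ 0 := by linarith
  have h2 : (d + m - 2 : ℝ) ≠ 0 := by linarith
  have h3 : (d - 1 : ℝ) ≠ 0 := by linarith
  -- for `m = 1` both sides vanish, whatever the value of `μ`
  have h4 : (m - 1) * μ = -(m - 1) * (lam / (d - 1)) := by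
    rcases hmu with rfl | h
    · ring
    · rw [h]; field_simp
  have hfib : ∀ x : M, fibreCurvature g.inner f m μ x = -((m - 1) * μ) * f x ^ 2 := by
    intro x
    have hF : funInChart 𝓘(ℝ, Model d) f x = fun _ => 1 := funext fun _ => hf1 _
    rw [fibreCurvature, hF, fibreW, laplacian, gradNormSq, hf1]
    rw [hessian_const, fderiv_const_apply]
    simp [metricTrace]
  have hfpos : ∀ x, 0 < f x := fun x => by rw [hf1]; exact one_pos
  refine ⟨lam / (2 * (d - 1)), fun x => ?_, fun x => ?_, fun x => ?_, fun x => ?_⟩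
  · rw [(schoutenTensor_of_einstein hfpos hfib hric x).1, h4]
    congr 1
    field_simp
    ring
  · rw [(schoutenTensor_of_einstein hfpos hfib hric x).2, h4]
    field_simp
    ring
  · rw [hfib, h4, hf1]
    field_simp
  · rw [hric]
    congr 1
    field_simp

theorem IsGoverLeitner.isCodazziBase (hd : 3 ≤ d) (hm : 0 < m)
    (hf : ContMDiff 𝓘(ℝ, Model d) 𝓘(ℝ, ℝ) ∞ f)
    (hgl : IsGoverLeitner g.inner f m μ) : IsCodazziBase g f m μ := by
  obtain ⟨c, hP, hY, -⟩ := hgl.exists_schoutenTensor hd hm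
  refine isCodazziBase_of_smul hf hP fun x y hy v => ?_
  have hF : funInChart 𝓘(ℝ, Model d) f x = fun _ => 1 := funext fun _ => hgl.1 _
  have hU : slopeW m μ (inChart g.inner x) (funInChart 𝓘(ℝ, Model d) f x) =ᶠ[𝓝 y]
      fun _ => -c := by
    filter_upwards [(isOpen_extChartAt_target x).mem_nhds hy] with z hz
    rw [slopeW, ← funInChart_traceDefect g hf m μ hz, funInChart, funInChart, hY, hgl.1]
    field_simp
  rw [hU.fderiv_eq, hF]
  simp

theorem IsGoverLeitner.isAmbientFlat (hd : 3 ≤ d) (hm : 0 < m)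
    (hf : ContMDiff 𝓘(ℝ, Model d) 𝓘(ℝ, ℝ) ∞ f)
    (hgl : IsGoverLeitner g.inner f m μ) : IsAmbientFlat g f m μ := by
  obtain ⟨c, hP, hY, hfib, hric⟩ := hgl.exists_schoutenTensor hd hm
  have hf1 := hgl.1
  have hfpos : ∀ x, 0 < f x := fun x => by rw [hf1]; exact one_pos
  have hU : ∀ x, f x / m * traceDefect g.inner f m μ x = -c := fun x => by
    rw [hY, hf1]; field_simp
  refine isAmbientFlat_of_smul hf hfpos (hgl.isCodazziBase hd hm hf) hP (by omega)
    (fun x => Or.inr ?_) (fun x => ?_) (fun x => ?_)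
  · have hF : funInChart 𝓘(ℝ, Model d) f x = fun _ => 1 := funext fun _ => hf1 _
    rw [hU, hF, hessian_const, hf1, mul_one, add_neg_cancel, zero_smul, neg_zero]
    rfl
  · rw [hU, hric, hf1]
    congr 1
    ring
  · rw [hU, hfib, hf1]
    ring

end Base

/-! ### The weighted pre-ambient space -/

section StraightForm

variable {E : Type*} [NormedAddCommGroup E] [NormedSpace ℝ E]

theorem straightForm_symm (t ρ : ℝ) {K : E →L[ℝ] E →L[ℝ] ℝ} (hK : ∀ u v, K u v = K v u)
    (X Z : ℝ × E × ℝ) : straightForm t ρ K X Z = straightForm t ρ K Z X := by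
  rw [straightForm_apply, straightForm_apply, hK]
  ring

theorem straightForm_dilation (s t ρ : ℝ) (K : E →L[ℝ] E →L[ℝ] ℝ) (X Z : ℝ × E × ℝ) :
    straightForm (s * t) ρ K (s * X.1, X.2) (s * Z.1, Z.2) = s ^ 2 * straightForm t ρ K X Z := by
  simp only [straightForm_apply]
  ring

theorem straightForm_horizontal (t : ℝ) (K : E →L[ℝ] E →L[ℝ] ℝ) (X Z : ℝ × E) :
    straightForm t 0 K (X.1, X.2, 0) (Z.1, Z.2, 0) = t ^ 2 * K X.2 Z.2 := by
  simp only [straightForm_apply]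
  ring

variable [FiniteDimensional ℝ E]

/-- The ambient metric is Lorentzian. -/
theorem straightForm_signature {t ρ : ℝ} (ht : 0 < t) {K : E →L[ℝ] E →L[ℝ] ℝ}
    (hK : ∀ v, v ≠ 0 → 0 < K v v) :
    sigPos (LinearMap.BilinMap.toQuadraticMap (straightForm t ρ K).toBilinForm) =
        Module.finrank ℝ E + 1 ∧
      sigNeg (LinearMap.BilinMap.toQuadraticMap (straightForm t ρ K).toBilinForm) = 1 := by
  set Q := LinearMap.BilinMap.toQuadraticMap (straightForm t ρ K).toBilinForm with hQ
  have hQa : ∀ X, Q X = 2 * ρ * (X.1 * X.1) + t * (X.1 * X.2.2 + X.2.2 * X.1)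
      + t ^ 2 * K X.2.1 X.2.1 := fun X => straightForm_apply t ρ K X X
  have hdim : Module.finrank ℝ (ℝ × E × ℝ) = Module.finrank ℝ E + 2 := by
    simp only [Module.finrank_prod, Module.finrank_self]
    omega
  -- On the hyperplane `b = s a` the form is `(2 ρ + 2 t s) a² + t² K`; choose `s` such that the
  -- coefficient of `a²` is `1`. On the line through `(1, 0, r)` the form is `(2 ρ + 2 t r) a²`;
  -- choose `r` such that this is `-a²`.
  let s : ℝ := (1 - 2 * ρ) / (2 * t)
  let r : ℝ := (-1 - 2 * ρ) / (2 * t)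
  have hs : 2 * ρ + 2 * t * s = 1 := by
    simp only [s]; field_simp; ring
  have hr : 2 * ρ + 2 * t * r = -1 := by
    simp only [r]; field_simp; ring
  let i : (ℝ × E) →ₗ[ℝ] ℝ × E × ℝ := (LinearMap.fst ℝ ℝ E).prod
    ((LinearMap.snd ℝ ℝ E).prod (s • LinearMap.fst ℝ ℝ E))
  have hi : ∀ z, i z = (z.1, z.2, s * z.1) := fun z => rfl
  have hinj : Function.Injective i := by
    intro z w hzw
    rw [hi, hi] at hzw
    obtain ⟨h1, h2⟩ := Prod.mk.inj hzw
    exact Prod.ext h1 (Prod.mk.inj h2).1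
  let j : ℝ →ₗ[ℝ] ℝ × E × ℝ := LinearMap.toSpanSingleton ℝ _ (1, 0, r)
  have hj : ∀ a, j a = (a, 0, a * r) := fun a => by simp [j]
  have hjinj : Function.Injective j := by
    intro a b hab
    rw [hj, hj] at hab
    exact congrArg Prod.fst hab
  have hVi : Module.finrank ℝ (LinearMap.range i) = Module.finrank ℝ E + 1 := by
    rw [LinearMap.finrank_range_of_inj hinj, Module.finrank_prod, Module.finrank_self, add_comm]
  have hVj : Module.finrank ℝ (LinearMap.range j) = 1 := by
    rw [LinearMap.finrank_range_of_inj hjinj, Module.finrank_self]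
  have hKn : ∀ v, 0 ≤ K v v := fun v => by
    by_cases hv : v = 0
    · simp [hv]
    · exact (hK v hv).le
  have hQi : ∀ z, Q (i z) = z.1 ^ 2 + t ^ 2 * K z.2 z.2 := fun z => by
    rw [hQa, hi]
    linear_combination z.1 ^ 2 * hs
  have hQj : ∀ a, Q (j a) = -a ^ 2 := fun a => by
    rw [hQa, hj]
    simp only [map_zero]
    linear_combination a ^ 2 * hr
  have h1 : Module.finrank ℝ (LinearMap.range i) ≤ sigPos Q := by
    refine le_sigPos_of_posDef Q ?_
    rintro ⟨_, z, rfl⟩ hz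
    change 0 < Q (i z)
    rw [hQi]
    by_cases h2 : z.2 = 0
    · have h1 : z.1 ≠ 0 := fun h1 => hz (Subtype.ext (by
        change i z = 0
        rw [show z = 0 from Prod.ext h1 h2, map_zero]))
      have := hKn z.2
      positivity
    · have := hK _ h2
      positivity
  have h2 : Module.finrank ℝ (LinearMap.range j) ≤ sigNeg Q := by
    refine le_sigNeg_of_negDef Q ?_
    rintro ⟨_, a, rfl⟩ ha
    change 0 < -Q (j a)
    rw [hQj]
    have h1 : a ≠ 0 := fun h1 => ha (Subtype.ext (by
      change j a = 0
      rw [h1, map_zero]))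
    have : 0 < a ^ 2 := by positivity
    linarith
  have h3 : sigPos Q + Module.finrank ℝ (LinearMap.range j) ≤ Module.finrank ℝ (ℝ × E × ℝ) := by
    refine QuadraticForm.sigPos_add_finrank_le_of_nonpos ?_
    rintro _ ⟨a, rfl⟩
    rw [hQj]
    exact neg_nonpos.2 (sq_nonneg a)
  have h4 : sigPos (-Q) + Module.finrank ℝ (LinearMap.range i) ≤
      Module.finrank ℝ (ℝ × E × ℝ) := by
    refine QuadraticForm.sigPos_add_finrank_le_of_nonpos ?_
    rintro _ ⟨z, rfl⟩
    have := hKn z.2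
    change -Q (i z) ≤ 0
    rw [hQi]
    have : 0 ≤ z.1 ^ 2 + t ^ 2 * K z.2 z.2 := by positivity
    linarith
  rw [sigPos_neg] at h4
  omega

end StraightForm

section PreAmbient

theorem isOrder_of_eventually_eq_zero {M : Type*} {h : ℝ × M × ℝ → ℝ}
    (h0 : ∀ (t : ℝ) (x : M), 0 < t → ∀ᶠ ρ in 𝓝 (0 : ℝ), h (t, x, ρ) = 0) (k : ℕ) :
    IsOrder h k := fun t x ht =>
  (isBigO_zero (fun ρ : ℝ => ρ ^ k) (𝓝 0)).congr' ((h0 t x ht).mono fun _ hρ => hρ.symm)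
    EventuallyEq.rfl

variable {d : ℕ} {M : Type*} [TopologicalSpace M] [ChartedSpace (Model d) M]

theorem mfderiv_dilation (s : ℝ) (p : ℝ × M × ℝ) (u : ℝ × Model d × ℝ) :
    (mfderiv (ambientModel d) (ambientModel d) (dilation s) p :
      (ℝ × Model d × ℝ) →L[ℝ] ℝ × Model d × ℝ) u = (s * u.1, u.2) := by
  have h0 : HasMFDerivAt 𝓘(ℝ, ℝ) 𝓘(ℝ, ℝ) (fun t : ℝ => s * t) p.1
      (s • ContinuousLinearMap.id ℝ ℝ) :=
    ((hasFDerivAt_id p.1).const_mul s).hasMFDerivAt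
  have h1 := HasMFDerivAt.comp p h0 (hasMFDerivAt_fst (I := 𝓘(ℝ, ℝ))
    (I' := 𝓘(ℝ, Model d).prod 𝓘(ℝ, ℝ)) p)
  have h2 := h1.prodMk (hasMFDerivAt_snd (I := 𝓘(ℝ, ℝ)) (I' := 𝓘(ℝ, Model d).prod 𝓘(ℝ, ℝ)) p)
  have h3 : HasMFDerivAt (ambientModel d) (ambientModel d) (dilation (M := M) s) p _ := h2
  rw [h3.mfderiv]
  rfl

theorem mfderiv_iota (z : ℝ × M) (u : ℝ × Model d) :
    (mfderiv (𝓘(ℝ, ℝ).prod 𝓘(ℝ, Model d)) (ambientModel d) iota z :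
      (ℝ × Model d) →L[ℝ] ℝ × Model d × ℝ) u = (u.1, u.2, 0) := by
  have h1 := hasMFDerivAt_fst (I := 𝓘(ℝ, ℝ)) (I' := 𝓘(ℝ, Model d)) z
  have h2 := hasMFDerivAt_snd (I := 𝓘(ℝ, ℝ)) (I' := 𝓘(ℝ, Model d)) z
  have h3 := hasMFDerivAt_const (I := 𝓘(ℝ, ℝ).prod 𝓘(ℝ, Model d)) (I' := 𝓘(ℝ, ℝ)) (0 : ℝ) z
  have h4 : HasMFDerivAt (𝓘(ℝ, ℝ).prod 𝓘(ℝ, Model d)) (ambientModel d) (iota (M := M)) z _ :=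
    h1.prodMk (h2.prodMk h3)
  rw [h4.mfderiv]
  rfl

theorem straightNormalMetric_signature {gρ : ℝ → BilinField 𝓘(ℝ, Model d) M} (p : ℝ × M × ℝ)
    (ht : 0 < p.1) (hpos : ∀ v : TangentSpace 𝓘(ℝ, Model d) p.2.1, v ≠ 0 →
      0 < gρ p.2.2 p.2.1 v v) :
    sigPos (LinearMap.BilinMap.toQuadraticMap (straightNormalMetric gρ p).toBilinForm) = d + 1 ∧
      sigNeg (LinearMap.BilinMap.toQuadraticMap (straightNormalMetric gρ p).toBilinForm) = 1 := by
  have h1 := straightForm_signature (E := Model d) (ρ := p.2.2) ht hpos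
  rw [finrank_euclideanSpace_fin] at h1
  exact h1

variable [IsManifold 𝓘(ℝ, Model d) ∞ M] {g : SmoothMetric d M} {f : M → ℝ} {m μ : ℝ}

theorem gRho_zero (f : M → ℝ) (m μ : ℝ) (x : M) (u v : TangentSpace 𝓘(ℝ, Model d) x) :
    gRho g.inner f m μ 0 x u v = g.inner x u v := by
  change g.inner x u v + 2 * 0 * schoutenTensor g.inner f m μ x u v + 0 ^ 2 * _ = _
  ring

theorem IsCodazziBase.schoutenTensor_symm (h : IsCodazziBase g f m μ) (x : M)
    (u v : TangentSpace 𝓘(ℝ, Model d) x) :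
    schoutenTensor g.inner f m μ x u v = schoutenTensor g.inner f m μ x v u :=
  h.symm x _ (mem_extChartAt_target x) u v

theorem IsCodazziBase.gRho_symm (h : IsCodazziBase g f m μ) (ρ : ℝ) (x : M)
    (u v : TangentSpace 𝓘(ℝ, Model d) x) :
    gRho g.inner f m μ ρ x u v = gRho g.inner f m μ ρ x v u := by
  have h1 := quadraticForm_apply (E := Model d) (metric_invertible g x) (g.symm x)
    (h.schoutenTensor_symm x) ρ
  exact (h1 u v).trans ((g.symm x _ _).trans (h1 v u).symm)

theorem contMDiff_traceDefect (hf : ContMDiff 𝓘(ℝ, Model d) 𝓘(ℝ, ℝ) ∞ f)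
    (hfpos : ∀ x, 0 < f x) :
    ContMDiff 𝓘(ℝ, Model d) 𝓘(ℝ, ℝ) ∞ (traceDefect g.inner f m μ) := by
  intro x
  have h1 : ContDiffAt ℝ ∞ (funInChart 𝓘(ℝ, Model d) (traceDefect g.inner f m μ) x)
      (extChartAt 𝓘(ℝ, Model d) x x) := by
    refine (contDiffAt_traceDefectW_inChart g hf hfpos m μ
      (mem_extChartAt_target x)).congr_of_eventuallyEq ?_
    filter_upwards [eventually_mem_chart_target x] with y hy
      using funInChart_traceDefect g hf m μ hy
  have h2 := h1.contMDiffAt.comp x (contMDiffAt_extChartAt (I := 𝓘(ℝ, Model d)) (n := ∞))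
  refine h2.congr_of_eventuallyEq ?_
  filter_upwards [extChartAt_source_mem_nhds (I := 𝓘(ℝ, Model d)) x] with z hz
  rw [Function.comp_apply, funInChart, (extChartAt 𝓘(ℝ, Model d) x).left_inv hz]

theorem contMDiff_straightNormalDensity (hf : ContMDiff 𝓘(ℝ, Model d) 𝓘(ℝ, ℝ) ∞ f)
    (hfpos : ∀ x, 0 < f x) :
    ContMDiff (ambientModel d) 𝓘(ℝ, ℝ) ∞ (straightNormalDensity (fRho g.inner f m μ)) := by
  have ht : ContMDiff (ambientModel d) 𝓘(ℝ, ℝ) ∞ (fun p : ℝ × M × ℝ => p.1) := contMDiff_fst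
  have hx : ContMDiff (ambientModel d) 𝓘(ℝ, Model d) ∞ (fun p : ℝ × M × ℝ => p.2.1) :=
    contMDiff_fst.comp contMDiff_snd
  have hρ : ContMDiff (ambientModel d) 𝓘(ℝ, ℝ) ∞ (fun p : ℝ × M × ℝ => p.2.2) :=
    contMDiff_snd.comp contMDiff_snd
  have hF := hf.comp hx
  have hY := (contMDiff_traceDefect (g := g) (m := m) (μ := μ) hf hfpos).comp hx
  have hdiv : ContMDiff 𝓘(ℝ, ℝ) 𝓘(ℝ, ℝ) ∞ (fun a : ℝ => a / m) :=
    (contDiff_id.div_const m).contMDiff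
  exact ht.mul (hF.add (((hdiv.comp hF).mul hρ).mul hY))

theorem IsCodazziBase.isWeightedPreAmbient (h : IsCodazziBase g f m μ)
    (hf : ContMDiff 𝓘(ℝ, Model d) 𝓘(ℝ, ℝ) ∞ f) (hfpos : ∀ x, 0 < f x) {W : Set (M × ℝ)}
    (hW : IsAdmissible g.inner f m μ W) :
    IsWeightedPreAmbient g.inner f (rayDomain W) (straightNormalMetric (gRho g.inner f m μ))
      (straightNormalDensity (fRho g.inner f m μ)) where
  isOpen := isOpen_Ioi.prod hW.isOpen
  subset := fun p hp => hp.1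
  contains := fun t x ht => ⟨ht, hW.contains x⟩
  dilation_invariant := fun s hs p hp => ⟨mul_pos hs hp.1, hp.2⟩
  symm := by
    intro p _ u v
    exact straightForm_symm (E := Model d) p.1 p.2.2 (h.gRho_symm p.2.2 p.2.1) u v
  smooth_metric := by
    intro p _
    have hc : ContDiffAt ℝ ∞ (ambientMetric (inChart g.inner p.2.1)
        (schoutenW m μ (inChart g.inner p.2.1) (funInChart 𝓘(ℝ, Model d) f p.2.1)))
        (extChartAt (ambientModel d) p p) := by
      rw [extChartAt_ambient_self]
      have hy := mem_extChartAt_target (I := 𝓘(ℝ, Model d)) p.2.1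
      exact contDiffAt_ambientMetric (contDiffAt_inChart_metric g hy)
        (contDiffAt_schoutenW_inChart g hf hfpos m μ hy) (inChart_metric_invertible g hy)
    refine hc.congr_of_eventuallyEq ?_
    filter_upwards [eventually_mem_target p] with z hz using inChart_ambientMetric g hf m μ p hz
  signature := by
    intro p hp
    exact straightNormalMetric_signature p hp.1 (hW.metric_pos p.2 hp.2)
  smooth_density := (contMDiff_straightNormalDensity hf hfpos).contMDiffOn
  density_pos := fun p hp => mul_pos hp.1 (hW.density_pos p.2 hp.2)
  metric_homogeneous := by
    intro s _ p _ u v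
    have h1 := mfderiv_dilation s p u
    have h2 := mfderiv_dilation s p v
    exact (congrArg₂ (fun X Z => straightForm (E := Model d) (s * p.1) p.2.2
      (gRho g.inner f m μ p.2.2 p.2.1) X Z) h1 h2).trans
        (straightForm_dilation (E := Model d) s p.1 p.2.2 _ u v)
  density_homogeneous := fun s _ p _ => mul_assoc s p.1 _
  metric_pullback := by
    intro t x _ u v
    have h1 := mfderiv_iota (t, x) u
    have h2 := mfderiv_iota (t, x) v
    rw [mfderiv_snd]
    exact ((congrArg₂ (fun X Z => straightForm (E := Model d) t 0
      (gRho g.inner f m μ 0 x) X Z) h1 h2).trans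
        (straightForm_horizontal (E := Model d) t _ u v)).trans
          (congrArg (t ^ 2 * ·) (gRho_zero (g := g) f m μ x u.2 v.2))
  density_pullback := fun t x _ => by
    change t * (f x + f x / m * 0 * _) = t * f x
    ring

/-- A straight and normal weighted pre-ambient space with vanishing weighted curvatures is a
weighted ambient space. -/
theorem IsCodazziBase.isWeightedAmbient (h : IsCodazziBase g f m μ)
    (hflat : IsAmbientFlat g f m μ)
    (hf : ContMDiff 𝓘(ℝ, Model d) 𝓘(ℝ, ℝ) ∞ f) (hfpos : ∀ x, 0 < f x) {W : Set (M × ℝ)}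
    (hW : IsAdmissible g.inner f m μ W) :
    IsWeightedAmbient g.inner f m μ (rayDomain W) (straightNormalMetric (gRho g.inner f m μ))
      (straightNormalDensity (fRho g.inner f m μ)) := by
  set gt := straightNormalMetric (gRho g.inner f m μ)
  set ft := straightNormalDensity (fRho g.inner f m μ)
  have hzero : ∀ (t : ℝ) (x : M), 0 < t → ∀ᶠ ρ in 𝓝 (0 : ℝ),
      bakryEmeryRicci gt ft m (t, x, ρ) = 0 ∧ fibreCurvature gt ft m μ (t, x, ρ) = 0 := by
    intro t x ht
    have hc : ContinuousAt (fun ρ : ℝ => (x, ρ)) 0 := by fun_prop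
    filter_upwards [hc.eventually (hW.isOpen.mem_nhds (hW.contains x))] with ρ hρ
      using hflat (t, x, ρ) ht (hW.metric_pos _ hρ)
  have hS : ∀ (u v : ℝ × Model d × ℝ) (k : ℕ),
      IsOrder (component (bakryEmeryRicci gt ft m) u v) k := by
    intro u v
    refine isOrder_of_eventually_eq_zero fun t x ht => ?_
    filter_upwards [hzero t x ht] with ρ hρ
    rw [component, hρ.1]
    rfl
  have hh : ∀ k : ℕ, IsOrder (fibreCurvature gt ft m μ) k :=
    isOrder_of_eventually_eq_zero fun t x ht => (hzero t x ht).mono fun ρ hρ => hρ.2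
  refine ⟨h.isWeightedPreAmbient hf hfpos hW, fun _ k => ⟨fun u v => hS u v k, hh k⟩,
    fun k _ => ⟨⟨fun u v => hS u v k, hh k⟩, hS _ _ _, fun w => hS _ _ _, ?_⟩⟩
  refine isOrder_of_eventually_eq_zero (fun t x ht => ?_) _
  filter_upwards [hzero t x ht] with ρ hρ
  have h1 : tangentialPart (bakryEmeryRicci gt ft m) (t, x, ρ) = 0 := by
    rw [tangentialPart, hρ.1]
    rfl
  simp only [hρ.2, h1]
  simp [metricTrace]

end PreAmbient

/-! ### Admissible neighbourhoods -/

/-- Positive definiteness is an open condition. -/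
theorem eventually_posDef {E : Type*} [NormedAddCommGroup E] [NormedSpace ℝ E]
    [FiniteDimensional ℝ E] {B : E →L[ℝ] E →L[ℝ] ℝ} (hB : ∀ v, v ≠ 0 → 0 < B v v) :
    ∀ᶠ C in 𝓝 B, ∀ v, v ≠ 0 → 0 < C v v := by
  -- `c` is the minimum of `B` on the unit sphere, which is empty if `E = 0`
  have hc : ∃ c : ℝ, 0 < c ∧ ∀ v : E, ‖v‖ = 1 → c ≤ B v v := by
    rcases (Metric.sphere (0 : E) 1).eq_empty_or_nonempty with he | hne
    · refine ⟨1, one_pos, fun v hv => ?_⟩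
      have : v ∈ Metric.sphere (0 : E) 1 := by simpa using hv
      simp [he] at this
    · have := FiniteDimensional.proper ℝ E
      obtain ⟨w, hw, hmin⟩ := (isCompact_sphere (0 : E) 1).exists_isMinOn hne
        (f := fun v => B v v) (by fun_prop)
      refine ⟨B w w, hB w fun h0 => by simp [h0] at hw, fun v hv => hmin (by simpa using hv)⟩
  obtain ⟨c, hc0, hc⟩ := hc
  filter_upwards [Metric.ball_mem_nhds B hc0] with C hC v hv
  have hv0 : 0 < ‖v‖ := norm_pos_iff.2 hv
  set w := ‖v‖⁻¹ • v with hw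
  have hw1 : ‖w‖ = 1 := by
    rw [hw, norm_smul, norm_inv, norm_norm, inv_mul_cancel₀ hv0.ne']
  have hvw : v = ‖v‖ • w := by rw [hw, smul_inv_smul₀ hv0.ne']
  have h1 : ‖(C - B) w w‖ ≤ ‖C - B‖ * ‖w‖ * ‖w‖ := (C - B).le_opNorm₂ w w
  rw [hw1, mul_one, mul_one, Real.norm_eq_abs] at h1
  have h2 : ‖C - B‖ < c := by rwa [← dist_eq_norm]
  have h3 := hc w hw1
  have h4 : (C - B) w w = C w w - B w w := rfl
  have h5 : 0 < C w w := by
    have := neg_abs_le ((C - B) w w)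
    linarith
  rw [hvw]
  simp only [map_smul, smul_apply, smul_eq_mul]
  positivity

section Admissible

variable {d : ℕ} {M : Type*} [TopologicalSpace M] [ChartedSpace (Model d) M]

theorem IsAdmissible.mono {g : BilinField 𝓘(ℝ, Model d) M} {f : M → ℝ} {m μ : ℝ}
    {W W' : Set (M × ℝ)} (hW : IsAdmissible g f m μ W) (h : W' ⊆ W) (ho : IsOpen W')
    (hc : ∀ x : M, (x, (0 : ℝ)) ∈ W') : IsAdmissible g f m μ W' where
  isOpen := ho
  contains := hc
  metric_pos := fun q hq => hW.metric_pos q (h hq)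
  density_pos := fun q hq => hW.density_pos q (h hq)

theorem IsAdmissible.exists_slab [CompactSpace M] {g : BilinField 𝓘(ℝ, Model d) M} {f : M → ℝ}
    {m μ : ℝ} {W : Set (M × ℝ)} (hW : IsAdmissible g f m μ W) :
    ∃ ε : ℝ, 0 < ε ∧ IsAdmissible g f m μ (univ ×ˢ Ioo (-ε) ε) := by
  obtain ⟨u, v, -, hv, hu, h0, huv⟩ := generalized_tube_lemma (isCompact_univ (X := M))
    (isCompact_singleton (x := (0 : ℝ))) hW.isOpen (by rintro ⟨x, ρ⟩ ⟨-, rfl⟩; exact hW.contains x)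
  obtain ⟨ε, hε, hball⟩ := Metric.isOpen_iff.1 hv 0 (h0 rfl)
  rw [Real.ball_eq_Ioo, zero_sub, zero_add] at hball
  exact ⟨ε, hε, hW.mono ((prod_mono hu hball).trans huv) (isOpen_univ.prod isOpen_Ioo)
    fun x => ⟨mem_univ x, by simpa using hε⟩⟩

variable [IsManifold 𝓘(ℝ, Model d) ∞ M] {g : SmoothMetric d M} {f : M → ℝ} {m μ : ℝ}

/-- Near `(x, 0)` the form `g_ρ` is positive definite: it is continuous in the chart at `x`, and
equal to `g` at `ρ = 0`. -/
theorem eventually_gRho_pos (hf : ContMDiff 𝓘(ℝ, Model d) 𝓘(ℝ, ℝ) ∞ f)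
    (hfpos : ∀ x, 0 < f x) (x : M) : ∀ᶠ q in 𝓝 (x, (0 : ℝ)),
      ∀ v : TangentSpace 𝓘(ℝ, Model d) q.1, v ≠ 0 → 0 < gRho g.inner f m μ q.2 q.1 v v := by
  set y := extChartAt 𝓘(ℝ, Model d) x x
  have hy : y ∈ (extChartAt 𝓘(ℝ, Model d) x).target := mem_extChartAt_target x
  let K : Model d × ℝ → Model d →L[ℝ] Model d →L[ℝ] ℝ := fun z =>
    quadraticForm (inChart g.inner x z.1)
      (schoutenW m μ (inChart g.inner x) (funInChart 𝓘(ℝ, Model d) f x) z.1) z.2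
  have hK : ContDiffAt ℝ ∞ K (y, 0) :=
    contDiffAt_quadraticForm ((contDiffAt_inChart_metric g hy).comp (y, (0 : ℝ)) contDiffAt_fst)
      (inChart_metric_invertible g hy)
      (ContDiffAt.comp (g := schoutenW m μ (inChart g.inner x) (funInChart 𝓘(ℝ, Model d) f x))
        (y, (0 : ℝ)) (contDiffAt_schoutenW_inChart g hf hfpos m μ hy) contDiffAt_fst)
      contDiffAt_snd
  have hK0 : ∀ v, v ≠ 0 → 0 < K (y, 0) v v := by
    intro v hv
    have h1 := inChart_gRho_self (g := g) (m := m) (μ := μ) hf 0 x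
    change K (y, 0) = _ at h1
    rw [h1]
    exact (g.pos x v hv).trans_eq (gRho_zero f m μ x v v).symm
  have hc : ContinuousAt (fun q : M × ℝ => (extChartAt 𝓘(ℝ, Model d) x q.1, q.2))
      (x, (0 : ℝ)) :=
    ((continuousAt_extChartAt (I := 𝓘(ℝ, Model d)) x).comp continuousAt_fst).prodMk
      continuousAt_snd
  have h1 := hc.eventually (hK.continuousAt.eventually (eventually_posDef hK0))
  have h2 : ∀ᶠ q in 𝓝 (x, (0 : ℝ)), q.1 ∈ (extChartAt 𝓘(ℝ, Model d) x).source :=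
    continuousAt_fst.eventually (extChartAt_source_mem_nhds (I := 𝓘(ℝ, Model d)) x)
  filter_upwards [h1, h2] with q hq hqs
  have hqt := (extChartAt 𝓘(ℝ, Model d) x).map_source hqs
  let R : M → Model d →L[ℝ] Model d →L[ℝ] ℝ := gRho g.inner f m μ q.2
  have h3 : ∀ w : Model d, w ≠ 0 → 0 < R q.1
      (chartDeriv x (extChartAt 𝓘(ℝ, Model d) x q.1) w)
      (chartDeriv x (extChartAt 𝓘(ℝ, Model d) x q.1) w) := by
    intro w hw
    have h4 := hq w hw
    simp only [K] at h4
    rw [← inChart_gRho g hf m μ q.2 hqt, inChart_eq,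
      (extChartAt 𝓘(ℝ, Model d) x).left_inv hqs] at h4
    exact h4
  intro v hv
  obtain ⟨w, rfl⟩ := (chartDeriv_invertible x hqt).surjective v
  exact h3 w fun h0 => hv (by rw [h0]; exact map_zero _)

/-- The largest admissible neighbourhood is the interior of the set where `g_ρ` is positive definite
and `f_ρ > 0`. -/
theorem exists_isAdmissible (hf : ContMDiff 𝓘(ℝ, Model d) 𝓘(ℝ, ℝ) ∞ f) (hfpos : ∀ x, 0 < f x) :
    ∃ W : Set (M × ℝ), IsAdmissible g.inner f m μ W := by
  have hc : Continuous fun q : M × ℝ => fRho g.inner f m μ q.2 q.1 := by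
    have h1 : Continuous (traceDefect g.inner f m μ) :=
      (contMDiff_traceDefect hf hfpos).continuous
    have h2 := hf.continuous
    unfold fRho
    fun_prop
  refine ⟨interior {q | (∀ v : TangentSpace 𝓘(ℝ, Model d) q.1, v ≠ 0 →
    0 < gRho g.inner f m μ q.2 q.1 v v) ∧ 0 < fRho g.inner f m μ q.2 q.1}, isOpen_interior,
    fun x => ?_, fun q hq => (interior_subset hq).1, fun q hq => (interior_subset hq).2⟩
  have h0 : 0 < fRho g.inner f m μ 0 x := by
    have := hfpos x
    simpa [fRho] using this
  exact mem_interior_iff_mem_nhds.2 ((eventually_gRho_pos hf hfpos x).and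
    (hc.continuousAt.eventually (lt_mem_nhds h0)))

/-- If `P_φ^m = c g` and `Y_φ^m = ± m c`, then `g_ρ = (1 + c ρ)² g` and `f_ρ = (1 ± c ρ) f`, so that
`|ρ| < 1 / (1 + |c|)` suffices. -/
theorem exists_slab_of_smul {c : ℝ} (hm : 0 < m) (hfpos : ∀ x, 0 < f x)
    (hP : ∀ x : M, schoutenTensor g.inner f m μ x = c • g.inner x)
    (hY : ∀ x : M, |traceDefect g.inner f m μ x| = m * |c|) :
    ∃ ε : ℝ, 0 < ε ∧ IsAdmissible g.inner f m μ (univ ×ˢ Ioo (-ε) ε) := by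
  have hε : 0 < 1 / (1 + |c|) := by positivity
  have hb : ∀ ρ ∈ Ioo (-(1 / (1 + |c|))) (1 / (1 + |c|)), |c| * |ρ| < 1 := by
    intro ρ hρ
    have h1 : |ρ| < 1 / (1 + |c|) := abs_lt.2 hρ
    rw [lt_div_iff₀ (by positivity)] at h1
    nlinarith [abs_nonneg ρ]
  refine ⟨1 / (1 + |c|), hε, isOpen_univ.prod isOpen_Ioo,
    fun x => ⟨mem_univ x, neg_lt_zero.2 hε, hε⟩, fun q hq v hv => ?_, fun q hq => ?_⟩
  · have h1 : |c * q.2| < 1 := by rw [abs_mul]; exact hb q.2 hq.2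
    have h2 : 0 < 1 + c * q.2 := by linarith [(abs_lt.1 h1).1]
    exact (mul_pos (pow_pos h2 2) (g.pos q.1 v hv)).trans_eq
      (gRho_apply_of_smul (hP q.1) q.2 v v).symm
  · have h1 : fRho g.inner f m μ q.2 q.1 =
        f q.1 * (1 + q.2 * traceDefect g.inner f m μ q.1 / m) := by
      rw [fRho]; ring
    have h2 : |q.2 * traceDefect g.inner f m μ q.1 / m| < 1 := by
      rw [abs_div, abs_mul, hY, abs_of_pos hm]
      refine lt_of_eq_of_lt ?_ (hb q.2 hq.2)
      field_simp
    rw [h1]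
    exact mul_pos (hfpos _) (by linarith [(abs_lt.1 h2).1])

end Admissible

end WeightedAmbient

end

open WeightedAmbient in
theorem theorem1p2 {d : ℕ} (hd : 3 ≤ d)
    {M : Type*} [TopologicalSpace M] [ChartedSpace (Model d) M]
    [IsManifold 𝓘(ℝ, Model d) ∞ M]
    (g : SmoothMetric d M)
    (f : M → ℝ) (hf : ContMDiff 𝓘(ℝ, Model d) 𝓘(ℝ, ℝ) ∞ f) (hfpos : ∀ x, 0 < f x)
    (m μ : ℝ) (hm : 0 < m)
    (hcase : IsQuasiEinstein g.inner f m μ ∨ IsWeightedLCF g.inner f m μ ∨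
      IsGoverLeitner g.inner f m μ) :
    (∀ W : Set (M × ℝ), IsAdmissible g.inner f m μ W →
      IsWeightedAmbient g.inner f m μ (rayDomain W)
        (straightNormalMetric (gRho g.inner f m μ))
        (straightNormalDensity (fRho g.inner f m μ))) ∧
    (∃ W : Set (M × ℝ), IsAdmissible g.inner f m μ W) ∧
    (IsQuasiEinstein g.inner f m μ ∨ IsGoverLeitner g.inner f m μ ∨ CompactSpace M →
      ∃ ε : ℝ, 0 < ε ∧ IsAdmissible g.inner f m μ (univ ×ˢ Ioo (-ε) ε)) := by
  have hW := exists_isAdmissible (g := g) (m := m) (μ := μ) hf hfpos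
  refine ⟨fun W hW => ?_, hW, ?_⟩
  · rcases hcase with h | h | h
    · exact (h.isCodazziBase hd hm hf hfpos).isWeightedAmbient
        (h.isAmbientFlat hd hm hf hfpos) hf hfpos hW
    · exact (h.isCodazziBase hd hm hf hfpos).isWeightedAmbient
        (h.isAmbientFlat hd hm hf hfpos) hf hfpos hW
    · exact (h.isCodazziBase hd hm hf).isWeightedAmbient (h.isAmbientFlat hd hm hf) hf hfpos hW
  · rintro (h | h | h)
    · obtain ⟨c, hP, hY, -⟩ := h.exists_schoutenTensor hd hm hfpos
      exact exists_slab_of_smul hm hfpos hP fun x => by rw [hY, abs_mul, abs_of_pos hm]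
    · obtain ⟨c, hP, hY, -⟩ := h.exists_schoutenTensor hd hm
      exact exists_slab_of_smul hm hfpos hP fun x => by rw [hY, abs_neg, abs_mul, abs_of_pos hm]
    · obtain ⟨W, hW⟩ := hW
      exact hW.exists_slab
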